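/- Let $n\ge 0$ be an integer and let $\beta\in\mathbb C$ with $\beta/2\notin\mathbb Z$. Put $\alpha=\tfrac12+n$, and consider the fourth Painlevé equation $$y''=\frac{(y')^2}{2y}+\frac32y^3+4xy^2+2\Bigl(x^2-2\alpha+\frac{\beta}{2}\Bigr)y-\frac{\beta^2}{2y}.\qquad(\mathrm{P4})$$ Write $R_\infty^+[y]=\frac{y'}{2y}-\frac y2-x+\frac{\beta}{2y}$ (it changes the parameters $(\alpha,\beta)$ of $y$ into $(-\alpha,-2\alpha+\beta-1)$) and $R_0^-[y]=y+\frac{2(1-2\alpha)y}{y'+y^2+2xy+\beta}$ (it changes $(\alpha,\beta)$ into $(1-\alpha,-2\alpha+\beta+1)$). A classical solution of (P4) is a solution $(R_0^-R_\infty^+)^n[z'/z]$, where $z\not\equiv0$ is an entire solution of $z''+2xz'+\beta z=0$; here $z'/z$ solves the Riccati equation $y'=-y^2-2xy-\beta$ and $e^{x^2/2}z$ is a parabolic cylinder function. Let $\Theta(s)=0,\tfrac12,1$ for $s<0$, $s=0$, $s>0$. There are classical solutions $y=y_c$ of (P4), $c\in\mathbb C\cup\{\infty\}$, meromorphic in $\mathbb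 C$, with the following behaviour as $x\to\infty$, uniformly in closed subsectors of each of the four sectors (powers of $x$ are taken with the indicated value of $\arg x$). i) $\arg x\in(-\frac\pi4,\frac\pi4)$: if $c\ne\infty$, then $$y=-\frac{\beta}{2x}\bigl(1+O(x^{-2})\bigr)+\mu_1x^{2n+\beta}e^{-x^2}\bigl(1+O(x^{-2})\bigr),\qquad \mu_1=-2\bigl(c+i\sqrt\pi\,\Theta(\arg x)\bigr)\frac{2^{n+\beta/2}}{n!\,\Gamma(\beta/2)};$$ if $c=\infty$, then $y=-2x(1+O(x^{-2}))$. ii) $\arg x\in(\frac\pi4,\frac{3\pi}4)$: if $c+i\sqrt\pi\ne0$, then $$y=-2x\bigl(1+O(x^{-2})\bigr)+\mu_2x^{4n+2-\beta}e^{x^2}\bigl(1+O(x^{-2})\bigr),$$ $$\mu_2=2\sqrt\pi\Bigl(\frac{i\sqrt\pi}{(c+i\sqrt\pi)(e^{i\pi\beta}-1)}+\Theta\bigl(\arg x-\tfrac\pi2\bigr)\Bigr)e^{i\pi\beta/2}\frac{2^{2n+1-\beta/2}}{n!\,\Gamma(n+1-\beta/2)};$$ if $c+i\sqrt\pi=0$,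 then $y=-\frac{\beta}{2x}(1+O(x^{-2}))$. iii) $\arg x\in(\frac{3\pi}4,\frac{5\pi}4)$: if $c(1-e^{-i\pi\beta})+i\sqrt\pi\ne0$, then $$y=-\frac{\beta}{2x}\bigl(1+O(x^{-2})\bigr)+\mu_3x^{2n+\beta}e^{-x^2}\bigl(1+O(x^{-2})\bigr),$$ $$\mu_3=-2i\sqrt\pi\Bigl(\frac{c+i\sqrt\pi}{c(1-e^{-i\pi\beta})+i\sqrt\pi}-\Theta(\arg x-\pi)\Bigr)e^{-i\pi\beta}\frac{2^{n+\beta/2}}{n!\,\Gamma(\beta/2)};$$ if $c(1-e^{-i\pi\beta})+i\sqrt\pi=0$, then $y=-2x(1+O(x^{-2}))$. iv) $\arg x\in(\frac{5\pi}4,\frac{7\pi}4)$: if $c\ne0$, then $$y=-2x\bigl(1+O(x^{-2})\bigr)+\mu_4x^{4n+2-\beta}e^{x^2}\bigl(1+O(x^{-2})\bigr),$$ $$\mu_4=2\sqrt\pi\Bigl(\frac{i\sqrt\pi}{c(1-e^{-i\pi\beta})}+\Theta\bigl(\tfrac{3\pi}2-\arg x\bigr)\Bigr)e^{3i\pi\beta/2}\frac{2^{2n+1-\beta/2}}{n!\,\Gamma(n+1-\beta/2)};$$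 if $c=0$, then $y=-\frac{\beta}{2x}(1+O(x^{-2}))$. For $c=\infty$ the formulas in ii)–iv) hold with the limits of the multipliers as $c\to\infty$. The multipliers have the following precise meaning. For $k\in\mathbb Z/4$ there is a solution $B_k$ of (P4), meromorphic in $\mathbb C$ and independent of $c$, which in the whole sector $|\arg x-k\pi/2|<3\pi/4$ has no exponential terms: uniformly in closed subsectors it is $-2x(1+O(x^{-2}))$ for even $k$ and $-\frac{\beta}{2x}(1+O(x^{-2}))$ for odd $k$. In the sector $|\arg x-k\pi/2|<\pi/4$ the first (algebraic) term of a two-term formula above stands for $B_{k-1}$ if $\arg x<k\pi/2$, for $B_{k+1}$ if $\arg x>k\pi/2$, and for $\frac12(B_{k-1}+B_{k+1})$ on the Stokes ray $\arg x=k\pi/2$. On the ray itself, if the multiplier is $0$ there, the second term is replaced by an error $O(x^{-2})$ times the same power and exponential. -/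

import Mathlib

open Complex Filter

noncomputable section

namespace P4

/-- `y` is a (not identically vanishing) solution, meromorphic in the whole plane, of the fourth
Painlevé equation `y'' = (y')²/(2y) + (3/2) y³ + 4 x y² + 2 (x² - a) y - b/(2y)` with
`a = 2α - β/2`, `b = β²`. The equation is required off a closed discrete set, which contains the
poles and the zeros of `y`. -/
def IsSolution (α β : ℂ) (y : ℂ → ℂ) : Prop :=
  Meromorphic y ∧
  ∀ᶠ x in codiscrete ℂ, y x ≠ 0 ∧
    deriv (deriv y) x =
      (deriv y x) ^ 2 / (2 * y x) + 3 / 2 * (y x) ^ 3 + 4 * x * (y x) ^ 2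
        + 2 * (x ^ 2 - (2 * α - β / 2)) * y x - β ^ 2 / (2 * y x)

/-- The Bäcklund transformation `R_∞^+`; it sends a solution with parameters `(α, β)` to one with
parameters `(-α, -2α + β - 1)`. -/
def RInfPlus (β : ℂ) (y : ℂ → ℂ) : ℂ → ℂ := fun x =>
  deriv y x / (2 * y x) - y x / 2 - x + β / (2 * y x)

/-- The Bäcklund transformation `R_0^-`; it sends a solution with parameters `(α, β)` to one with
parameters `(-α + 1, -2α + β + 1)`. -/
def RZeroMinus (α β : ℂ) (y : ℂ → ℂ) : ℂ → ℂ := fun x =>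
  y x + 2 * (1 - 2 * α) * y x / (deriv y x + (y x) ^ 2 + 2 * x * y x + β)

/-- `(R_0^- R_∞^+)^n [y₀]`, where `y₀` is a solution with parameters `(1/2, β)`. One step takes the
parameters `(α, β)` to `(-α, -2α + β - 1)` and then to `(α + 1, β)`. -/
def ladder (β : ℂ) (y₀ : ℂ → ℂ) : ℕ → ℂ → ℂ
  | 0 => y₀
  | m + 1 =>
    let α : ℂ := 1 / 2 + m
    RZeroMinus (-α) (-2 * α + β - 1) (RInfPlus β (ladder β y₀ m))

/-- The classical functions for `α = 1/2 + n`: the images under `(R_0^- R_∞^+)^n` of `z'/z`, where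
`z` is a nontrivial entire solution of `z'' + 2 x z' + β z = 0` (that is, `z = e^{-x²/2} w` with
`w'' + (β - 1 - x²) w = 0`); `z'/z` solves the Riccati equation `y' = -y² - 2xy - β`. -/
def IsClassical (n : ℕ) (β : ℂ) (y : ℂ → ℂ) : Prop :=
  ∃ z : ℂ → ℂ, Differentiable ℂ z ∧ (∃ x, z x ≠ 0) ∧
    (∀ x, deriv (deriv z) x + 2 * x * deriv z x + β * z x = 0) ∧
    y = ladder β (fun x => deriv z x / z x) n

/-- The point `x = r e^{iθ}`. -/
def pt (r θ : ℝ) : ℂ := r * exp (θ * I)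

/-- The power `x^p` at `x = r e^{iθ}`, with the branch `log x = log r + iθ`. -/
def bpow (r θ : ℝ) (p : ℂ) : ℂ := exp (p * (Real.log r + θ * I))

/-- The step function: `0` for `s < 0`, `1/2` at `s = 0`, `1` for `s > 0`. -/
def Theta (s : ℝ) : ℝ := if s < 0 then 0 else if s = 0 then 1 / 2 else 1

/-- `f = L (1 + O(x⁻²))` as `x → ∞`, `|arg x - θ₀| < w`, uniformly in closed subsectors. -/
def Algebraic (f L : ℂ → ℂ) (θ₀ w : ℝ) : Prop :=
  ∀ δ : ℝ, 0 < δ → ∃ R C : ℝ, 0 < R ∧ ∀ r θ : ℝ, R ≤ r → |θ - θ₀| ≤ w - δ →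
    ‖f (pt r θ) - L (pt r θ)‖ ≤ C / r ^ 2 * ‖L (pt r θ)‖

/-- `y = B + μ E (1 + O(x⁻²))` as `x → ∞`, `|arg x - θ₀| < π/4`, uniformly in closed subsectors.
Here `θ₀` is the Stokes ray in the middle of the sector, `μ` and `E` are functions of `θ` and of
`(r, θ)`, and the algebraic background `B` is `Bm` for `θ < θ₀`, `Bp` for `θ > θ₀`, and the half-sum
of the two for `θ = θ₀`. On the ray itself the error is `O(x⁻²) E` (for `μ ≠ 0` this is the same
thing; for `μ = 0` squares of `E` remain there). -/
def Perturbed (y Bm Bp : ℂ → ℂ) (μ : ℝ → ℂ) (E : ℝ → ℝ → ℂ) (θ₀ : ℝ) : Prop :=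
  ∀ δ : ℝ, 0 < δ → ∃ R C : ℝ, 0 < R ∧ ∀ r θ : ℝ, R ≤ r → |θ - θ₀| ≤ Real.pi / 4 - δ →
    (θ < θ₀ →
      ‖y (pt r θ) - Bm (pt r θ) - μ θ * E r θ‖ ≤ C / r ^ 2 * ‖μ θ * E r θ‖) ∧
    (θ = θ₀ →
      ‖y (pt r θ) - (Bm (pt r θ) + Bp (pt r θ)) / 2 - μ θ * E r θ‖ ≤ C / r ^ 2 * ‖E r θ‖) ∧
    (θ₀ < θ →
      ‖y (pt r θ) - Bp (pt r θ) - μ θ * E r θ‖ ≤ C / r ^ 2 * ‖μ θ * E r θ‖)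

/-- The algebraic behaviour `-β/(2x)`. -/
def decaying (β : ℂ) : ℂ → ℂ := fun x => -β / (2 * x)

/-- The algebraic behaviour `-2x`. -/
def growing : ℂ → ℂ := fun x => -2 * x

/-- `x^{2n+β} e^{-x²}`. -/
def EMinus (n : ℕ) (β : ℂ) (r θ : ℝ) : ℂ := bpow r θ (2 * n + β) * exp (-(pt r θ) ^ 2)

/-- `x^{4n+2-β} e^{x²}`. -/
def EPlus (n : ℕ) (β : ℂ) (r θ : ℝ) : ℂ := bpow r θ (4 * n + 2 - β) * exp ((pt r θ) ^ 2)

/-- `i √π`. -/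
def iSqrtPi : ℂ := I * (Real.sqrt Real.pi : ℂ)

/-- The multiplier in the sector `(-π/4, π/4)`. -/
def mu1 (n : ℕ) (β c : ℂ) (θ : ℝ) : ℂ :=
  -2 * (c + iSqrtPi * Theta θ) *
    ((2 : ℂ) ^ (n + β / 2) / (n.factorial * Gamma (β / 2)))

/-- The multiplier in the sector `(π/4, 3π/4)`; `κ = i√π / ((c + i√π)(e^{iπβ} - 1))`. -/
def mu2 (n : ℕ) (β κ : ℂ) (θ : ℝ) : ℂ :=
  2 * (Real.sqrt Real.pi : ℂ) * (κ + Theta (θ - Real.pi / 2)) * exp (I * Real.pi * β / 2) *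
    ((2 : ℂ) ^ (2 * n + 1 - β / 2) / (n.factorial * Gamma (n + 1 - β / 2)))

/-- The multiplier in the sector `(3π/4, 5π/4)`; `κ = (c + i√π) / (c (1 - e^{-iπβ}) + i√π)`. -/
def mu3 (n : ℕ) (β κ : ℂ) (θ : ℝ) : ℂ :=
  -2 * iSqrtPi * (κ - Theta (θ - Real.pi)) * exp (-(I * Real.pi * β)) *
    ((2 : ℂ) ^ (n + β / 2) / (n.factorial * Gamma (β / 2)))

/-- The multiplier in the sector `(5π/4, 7π/4)`; `κ = i√π / (c (1 - e^{-iπβ}))`. -/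
def mu4 (n : ℕ) (β κ : ℂ) (θ : ℝ) : ℂ :=
  2 * (Real.sqrt Real.pi : ℂ) * (κ + Theta (3 * Real.pi / 2 - θ)) * exp (I * (3 * Real.pi * β / 2)) *
    ((2 : ℂ) ^ (2 * n + 1 - β / 2) / (n.factorial * Gamma (n + 1 - β / 2)))

/-- The four algebraic backgrounds `B k`, `k = 0, 1, 2, 3`: solutions of the same Painlevé equation
which are free of exponential terms in the sector of opening `3π/2` about the ray `arg x = kπ/2`,
where they behave like `-2x` (`k` even) or `-β/(2x)` (`k` odd). Deviations from the algebraic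
behaviour are of the types `e^{x²}` and `e^{-x²}`, and each of them is large in a part of such a
sector, so each `B k` is determined by these conditions. -/
def AreBackgrounds (n : ℕ) (β : ℂ) (B : Fin 4 → ℂ → ℂ) : Prop :=
  (∀ k, IsSolution (1 / 2 + n) β (B k)) ∧
  Algebraic (B 0) growing 0 (3 * Real.pi / 4) ∧
  Algebraic (B 1) (decaying β) (Real.pi / 2) (3 * Real.pi / 4) ∧
  Algebraic (B 2) growing Real.pi (3 * Real.pi / 4) ∧
  Algebraic (B 3) (decaying β) (3 * Real.pi / 2) (3 * Real.pi / 4)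

end P4

end

noncomputable section

open Topology Asymptotics Set

namespace P4

/-! ### The Hamiltonian system and its Bäcklund transformation -/

/-! With the partner `q = R_∞^+[y]` the Painlevé equation becomes a first order polynomial system,
and a ladder step becomes rational, free of derivatives: `R = y - (β-2-2n)/q`, `Y = q - (2n+2)/R`,
`Q = -2x - Y - R`. Wherever none of these quantities vanishes or is singular, `(Y, Q)` solves the
system of the next level. A zero common to a whole neighbourhood is impossible, because at a zero
each of them has a nonzero constant as derivative; this is where `β/2 ∉ ℤ` enters
(`IsSeed.ladder_aux`).

Two algebraic behaviours survive the ladder: `y ~ -β/(2x)`, `q ~ -2x`, and `y ~ -2x`, `q ~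
(n+1-β/2)/x` (`ladder_decaying`, `ladder_growing`). The exponential terms are obtained from the
difference of two members, never from a single one. At level zero Abel's formula gives the exact
difference `W(0) e^{-x²}/(z₁ z₂)` of two logarithmic derivatives. Each step multiplies the
difference by `2x²/(n+1)` in the first case and by `4x⁴/((n+1)(n+1-β/2))` in the second, up to `1 +
O(x⁻²)`. The induction needs only `Δq = -Δy (1 + O(x⁻²))` besides the leading terms
(`ladder_sub_decaying`, `ladder_sub_growing`). A multiplier is therefore an elementary factor times
a Wronskian divided by two leading coefficients.

What remains is linear. The cylinder functions, built as Laplace-type integrals along rotated rays,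
give a basis `d`, `e` of `z'' + 2xz' + βz = 0` with pure behaviour in sectors of opening `3π/2`; the
connection formulas are checked on initial values at `0` by the reflection and duplication formulas
for Γ (`exists_isBasis`). The solution `y_c` starts from `d + b e` with `b` proportional to `c`, and
`y_∞` from `e`. The backgrounds start from the four combinations that are pure in a large sector, so
a Stokes jump is simply the difference of the two Wronskians with the neighbouring backgrounds. -/

/-- The first order system satisfied by `(y, R_∞^+[y])` at the parameters `(1/2 + n, β)`. -/
structure IsSystemAt (n : ℕ) (β : ℂ) (y q : ℂ → ℂ) (x : ℂ) : Prop where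
  y_ne : y x ≠ 0
  q_ne : q x ≠ 0
  deriv_y : HasDerivAt y (y x * (2 * q x + 2 * x + y x) - β) x
  deriv_q : HasDerivAt q (-(q x) ^ 2 - 2 * x * q x - 2 * y x * q x + (β - 2 - 2 * n)) x

/-- The intermediate function of one step of the ladder. -/
def stepR (n : ℕ) (β : ℂ) (y q : ℂ → ℂ) (x : ℂ) : ℂ := y x - (β - 2 - 2 * n) / q x

/-- One step of the ladder in terms of `(y, q)`. -/
def stepY (n : ℕ) (β : ℂ) (y q : ℂ → ℂ) (x : ℂ) : ℂ := q x - (2 * n + 2) / stepR n β y q x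

/-- The partner `R_∞^+[Y]` of `Y = stepY`. -/
def stepQ (n : ℕ) (β : ℂ) (y q : ℂ → ℂ) (x : ℂ) : ℂ :=
  -2 * x - stepY n β y q x - stepR n β y q x

/-- The members of the ladder. -/
def ladderQ (β : ℂ) (y₀ : ℂ → ℂ) (n : ℕ) : ℂ → ℂ := RInfPlus β (ladder β y₀ n)

variable {n : ℕ} {β : ℂ} {y q : ℂ → ℂ} {x : ℂ}

/-- The substitution keeps `q` and turns the first equation of the system into the same equation
with `2n+2` in place of `β`. It is the half-way point of a step. -/
lemma IsSystemAt.hasDerivAt_stepR (h : IsSystemAt n β y q x) :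
    HasDerivAt (stepR n β y q)
      (stepR n β y q x * (2 * q x + 2 * x + stepR n β y q x) - (2 * n + 2)) x := by
  have hq := h.q_ne
  have := h.deriv_y.sub ((hasDerivAt_const x (β - 2 - 2 * n : ℂ)).div h.deriv_q hq)
  refine this.congr_deriv ?_
  simp only [stepR]
  field_simp
  ring

lemma IsSystemAt.hasDerivAt_stepY (h : IsSystemAt n β y q x) (hR : stepR n β y q x ≠ 0) :
    HasDerivAt (stepY n β y q)
      (stepY n β y q x * (2 * stepQ n β y q x + 2 * x + stepY n β y q x) - β) x := by
  have hq := h.q_ne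
  have := h.deriv_q.sub ((hasDerivAt_const x (2 * n + 2 : ℂ)).div h.hasDerivAt_stepR hR)
  refine this.congr_deriv ?_
  have hy : y x = stepR n β y q x + (β - 2 - 2 * n) / q x := by simp [stepR]
  simp only [stepQ, stepY, hy]
  field_simp
  ring

lemma IsSystemAt.hasDerivAt_stepQ (h : IsSystemAt n β y q x) (hR : stepR n β y q x ≠ 0) :
    HasDerivAt (stepQ n β y q)
      (-(stepQ n β y q x) ^ 2 - 2 * x * stepQ n β y q x
        - 2 * stepY n β y q x * stepQ n β y q x + (β - 2 - 2 * (n + 1 : ℕ))) x := by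
  have hq := h.q_ne
  have := (((hasDerivAt_id x).const_mul (-2 : ℂ)).sub (h.hasDerivAt_stepY hR)).sub
    h.hasDerivAt_stepR
  refine this.congr_deriv ?_
  simp only [stepQ, stepY]
  push_cast
  field_simp
  ring

/-- The first equation of the system is linear in the partner and hence determines it: knowing the
derivative in this form identifies `R_∞^+` without further computation. -/
lemma RInfPlus_eq_of_hasDerivAt {p : ℂ} (hy : y x ≠ 0)
    (h : HasDerivAt y (y x * (2 * p + 2 * x + y x) - β) x) : RInfPlus β y x = p := by
  rw [RInfPlus, h.deriv]
  field_simp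
  ring

/-- By the equation for `q'`, the denominator in `RZeroMinus` collapses to `-2qR`. -/
lemma IsSystemAt.ladder_succ {y₀ : ℂ → ℂ}
    (h : IsSystemAt n β (ladder β y₀ n) (ladderQ β y₀ n) x)
    (hR : stepR n β (ladder β y₀ n) (ladderQ β y₀ n) x ≠ 0) :
    ladder β y₀ (n + 1) x = stepY n β (ladder β y₀ n) (ladderQ β y₀ n) x := by
  have hq := h.q_ne
  have h1 : ladder β y₀ (n + 1) x = RZeroMinus (-(1 / 2 + n)) (-2 * (1 / 2 + n) + β - 1)
      (ladderQ β y₀ n) x := rfl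
  rw [h1, RZeroMinus, h.deriv_q.deriv, stepY]
  set Q := ladderQ β y₀ n x
  set R := stepR n β (ladder β y₀ n) (ladderQ β y₀ n) x with hRdef
  have hy : ladder β y₀ n x = R + (β - 2 - 2 * n) / Q := by simp [hRdef, stepR, Q]
  have : -Q ^ 2 - 2 * x * Q - 2 * ladder β y₀ n x * Q + (β - 2 - 2 * n) + Q ^ 2 + 2 * x * Q
      + (-2 * (1 / 2 + n) + β - 1) = -2 * (Q * R) := by
    rw [hy]; field_simp; ring
  rw [this]
  field_simp
  ring

/-- The nondegeneracy needed for one step of the ladder at a point. -/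
structure StepNe (n : ℕ) (β : ℂ) (y q : ℂ → ℂ) (x : ℂ) : Prop where
  sys : IsSystemAt n β y q x
  R_ne : stepR n β y q x ≠ 0
  Y_ne : stepY n β y q x ≠ 0
  Q_ne : stepQ n β y q x ≠ 0

/-- The conclusion of one step of the ladder at a point. -/
structure StepEq (β : ℂ) (y₀ : ℂ → ℂ) (n : ℕ) (x : ℂ) : Prop where
  sys : IsSystemAt (n + 1) β (ladder β y₀ (n + 1)) (ladderQ β y₀ (n + 1)) x
  y_eq : ladder β y₀ (n + 1) x = stepY n β (ladder β y₀ n) (ladderQ β y₀ n) x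
  q_eq : ladderQ β y₀ (n + 1) x = stepQ n β (ladder β y₀ n) (ladderQ β y₀ n) x

/-- Neighbourhoods are needed because `RInfPlus` differentiates: the formula for `Y` must hold near
a point before its partner can be found there, and the one for `Q` before `Q'` can. -/
lemma StepNe.stepEq {y₀ : ℂ → ℂ}
    (h : ∀ᶠ t in 𝓝 x, StepNe n β (ladder β y₀ n) (ladderQ β y₀ n) t) :
    ∀ᶠ t in 𝓝 x, StepEq β y₀ n t := by
  have hY : ∀ᶠ t in 𝓝 x, ladder β y₀ (n + 1) t = stepY n β (ladder β y₀ n) (ladderQ β y₀ n) t :=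
    h.mono fun t ht => ht.sys.ladder_succ ht.R_ne
  have hQ : ∀ᶠ t in 𝓝 x,
      ladderQ β y₀ (n + 1) t = stepQ n β (ladder β y₀ n) (ladderQ β y₀ n) t := by
    filter_upwards [h, hY, eventually_eventually_nhds.2 hY] with t ht h1 h2
    refine RInfPlus_eq_of_hasDerivAt (by rw [h1]; exact ht.Y_ne) ?_
    rw [h1]
    exact (ht.sys.hasDerivAt_stepY ht.R_ne).congr_of_eventuallyEq h2
  filter_upwards [h, hY, eventually_eventually_nhds.2 hY, hQ, eventually_eventually_nhds.2 hQ]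
    with t ht h1 h2 h3 h4
  refine ⟨⟨by rw [h1]; exact ht.Y_ne, by rw [h3]; exact ht.Q_ne, ?_, ?_⟩, h1, h3⟩
  · rw [h1, h3]
    exact (ht.sys.hasDerivAt_stepY ht.R_ne).congr_of_eventuallyEq h2
  · rw [h1, h3]
    exact (ht.sys.hasDerivAt_stepQ ht.R_ne).congr_of_eventuallyEq h4

/-! ### Meromorphy and the Painlevé equation -/

/-- A meromorphic function satisfying a differential equation that excludes its zeros of infinite
order does not vanish near any point. -/
lemma eventually_ne_of_hasDerivAt {f : ℂ → ℂ} (hf : MeromorphicAt f x)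
    (h : ∀ᶠ t in 𝓝[≠] x, f t = 0 → ¬ HasDerivAt f 0 t) : ∀ᶠ t in 𝓝[≠] x, f t ≠ 0 := by
  rcases hf.eventually_eq_zero_or_eventually_ne_zero with h0 | h0
  · exfalso
    have h1 := eventually_nhdsNE_eventually_nhds_iff.2 h0
    obtain ⟨t, ht0, ht1, ht2⟩ := (h0.and (h1.and h)).exists
    exact ht2 ht0 ((hasDerivAt_const t (0 : ℂ)).congr_of_eventuallyEq ht1)
  · exact h0

lemma eventually_ne_of_eventually_hasDerivAt {f g : ℂ → ℂ} (hf : MeromorphicAt f x)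
    (h : ∀ᶠ t in 𝓝[≠] x, HasDerivAt f (g t) t) (hg : ∀ t, f t = 0 → g t ≠ 0) :
    ∀ᶠ t in 𝓝[≠] x, f t ≠ 0 :=
  eventually_ne_of_hasDerivAt hf <| h.mono fun t ht h0 h1 => hg t h0 (ht.unique h1)

lemma meromorphicAt_RInfPlus (hy : MeromorphicAt y x) : MeromorphicAt (RInfPlus β y) x := by
  have h2 : MeromorphicAt (fun t => 2 * y t) x := (MeromorphicAt.const 2 x).mul hy
  have h3 : MeromorphicAt (fun t : ℂ => t) x := MeromorphicAt.id x
  exact (((hy.deriv.div h2).sub (hy.div (MeromorphicAt.const 2 x))).sub h3).add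
    ((MeromorphicAt.const β x).div h2)

lemma meromorphicAt_stepR (hy : MeromorphicAt y x) (hq : MeromorphicAt q x) :
    MeromorphicAt (stepR n β y q) x :=
  hy.sub ((MeromorphicAt.const _ x).div hq)

lemma meromorphicAt_stepY (hy : MeromorphicAt y x) (hq : MeromorphicAt q x) :
    MeromorphicAt (stepY n β y q) x :=
  hq.sub ((MeromorphicAt.const _ x).div (meromorphicAt_stepR hy hq))

lemma meromorphicAt_stepQ (hy : MeromorphicAt y x) (hq : MeromorphicAt q x) :
    MeromorphicAt (stepQ n β y q) x :=
  (((MeromorphicAt.const (-2) x).mul (MeromorphicAt.id x)).sub (meromorphicAt_stepY hy hq)).sub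
    (meromorphicAt_stepR hy hq)

/-! ### Logarithmic derivatives as seeds, and nonvanishing along the ladder -/

/-- A nontrivial entire solution of `z'' + 2 x z' + β z = 0`. -/
structure IsSeed (β : ℂ) (z : ℂ → ℂ) : Prop where
  diff : Differentiable ℂ z
  nontrivial : ∃ x, z x ≠ 0
  ode : ∀ x, deriv (deriv z) x + 2 * x * deriv z x + β * z x = 0

/-- The logarithmic derivative of `z`. -/
def riccati (z : ℂ → ℂ) : ℂ → ℂ := fun x => deriv z x / z x

variable {z : ℂ → ℂ}

lemma IsSeed.eventually_ne (h : IsSeed β z) (x : ℂ) : ∀ᶠ t in 𝓝[≠] x, z t ≠ 0 := by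
  by_contra hc
  obtain ⟨t, ht⟩ := h.nontrivial
  refine ht (AnalyticOnNhd.eqOn_zero_of_preconnected_of_frequently_eq_zero
    (h.diff.differentiableOn.analyticOnNhd isOpen_univ) isPreconnected_univ (mem_univ x) ?_
    (mem_univ t))
  exact (not_eventually.1 hc).mono fun t ht => not_not.1 ht

lemma IsSeed.hasDerivAt_riccati (h : IsSeed β z) (hz : z x ≠ 0) :
    HasDerivAt (riccati z) (-(riccati z x) ^ 2 - 2 * x * riccati z x - β) x := by
  have hd : Differentiable ℂ (deriv z) := by
    have := h.diff.contDiff (n := 2)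
    exact (this.iterate_deriv' 1 1).differentiable (by norm_num)
  have := (hd x).hasDerivAt.div (h.diff x).hasDerivAt hz
  refine this.congr_deriv ?_
  have e : deriv (deriv z) x = -(2 * x * deriv z x) - β * z x := by
    linear_combination h.ode x
  rw [e, riccati]
  field_simp
  ring

lemma IsSeed.ladderQ_zero (h : IsSeed β z) (hz : z x ≠ 0) (hy : riccati z x ≠ 0) :
    ladderQ β (riccati z) 0 x = -riccati z x - 2 * x := by
  refine RInfPlus_eq_of_hasDerivAt (y := riccati z) hy ?_
  refine (h.hasDerivAt_riccati hz).congr_deriv ?_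
  ring

lemma IsSeed.isSystemAt_zero (h : IsSeed β z) (hz : ∀ᶠ t in 𝓝 x, z t ≠ 0 ∧ riccati z t ≠ 0)
    (hq : riccati z x + 2 * x ≠ 0) :
    IsSystemAt 0 β (ladder β (riccati z) 0) (ladderQ β (riccati z) 0) x := by
  have e : ∀ᶠ t in 𝓝 x, ladderQ β (riccati z) 0 t = -riccati z t - 2 * t :=
    hz.mono fun t ht => h.ladderQ_zero ht.1 ht.2
  have hR := h.hasDerivAt_riccati hz.self_of_nhds.1
  refine ⟨hz.self_of_nhds.2, ?_, ?_, ?_⟩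
  · rw [e.self_of_nhds]
    intro h0
    apply hq
    linear_combination -h0
  · rw [e.self_of_nhds]
    exact hR.congr_deriv (by simp only [ladder]; ring)
  · rw [e.self_of_nhds]
    have := (hR.neg.sub ((hasDerivAt_id x).const_mul (2 : ℂ))).congr_of_eventuallyEq e
    exact this.congr_deriv (by simp only [ladder]; push_cast; ring)

variable (hβ : ∀ m : ℤ, β / 2 ≠ m)
include hβ in
lemma beta_ne (m : ℤ) : β - 2 * m ≠ 0 := by
  intro h
  exact hβ m (by linear_combination h / 2)

lemma IsSeed.meromorphicAt_riccati (h : IsSeed β z) (x : ℂ) : MeromorphicAt (riccati z) x :=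
  (h.diff.analyticAt x).meromorphicAt.deriv.div (h.diff.analyticAt x).meromorphicAt

include hβ in
-- Each of the quantities that must not vanish is meromorphic and satisfies a first order equation
-- whose right-hand side, at a zero of the quantity, is a nonzero constant. Zeros are therefore
-- isolated and the step is legitimate off a discrete set.
lemma IsSeed.ladder_aux (h : IsSeed β z) (n : ℕ) :
    (∀ x, MeromorphicAt (ladder β (riccati z) n) x) ∧
    ∀ x, ∀ᶠ t in 𝓝[≠] x,
      IsSystemAt n β (ladder β (riccati z) n) (ladderQ β (riccati z) n) t := by
  induction n with
  | zero =>
    refine ⟨h.meromorphicAt_riccati, fun x => ?_⟩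
    have hz := h.eventually_ne x
    have hm := h.meromorphicAt_riccati x
    have hu : ∀ᶠ t in 𝓝[≠] x, riccati z t ≠ 0 := by
      refine eventually_ne_of_eventually_hasDerivAt hm
        (hz.mono fun t ht => h.hasDerivAt_riccati ht) fun t ht => ?_
      have := beta_ne hβ 0
      simpa [ht] using this
    -- At a zero, `riccati z t = -2t`, and the derivative of the sum is `2 - β`.
    have hq : ∀ᶠ t in 𝓝[≠] x, riccati z t + 2 * t ≠ 0 := by
      have hm2 : MeromorphicAt (fun t => riccati z t + 2 * t) x :=
        hm.add ((MeromorphicAt.const 2 x).mul (MeromorphicAt.id x))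
      refine eventually_ne_of_eventually_hasDerivAt hm2
        (hz.mono fun t ht => (h.hasDerivAt_riccati ht).add
          ((hasDerivAt_id t).const_mul (2 : ℂ))) fun t ht h0 => ?_
      apply beta_ne hβ 1
      have : riccati z t = -2 * t := by linear_combination ht
      rw [this] at h0
      push_cast
      linear_combination -h0
    have hzu := eventually_nhdsNE_eventually_nhds_iff.2 (hz.and hu)
    filter_upwards [hzu, hq] with t h1 h2
    exact h.isSystemAt_zero h1 h2
  | succ n ih =>
    obtain ⟨hm, hs⟩ := ih
    set y := ladder β (riccati z) n with hy
    set q := ladderQ β (riccati z) n with hqd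
    have hmq : ∀ x, MeromorphicAt q x := fun x => meromorphicAt_RInfPlus (hm x)
    have hn : (2 * n + 2 : ℂ) ≠ 0 := by exact_mod_cast (by omega : 2 * n + 2 ≠ 0)
    have hR : ∀ x, ∀ᶠ t in 𝓝[≠] x, stepR n β y q t ≠ 0 := fun x => by
      refine eventually_ne_of_eventually_hasDerivAt (meromorphicAt_stepR (hm x) (hmq x))
        ((hs x).mono fun t ht => ht.hasDerivAt_stepR) fun t ht => ?_
      rw [ht]
      intro h0
      exact hn (by linear_combination -h0)
    have hY : ∀ x, ∀ᶠ t in 𝓝[≠] x, stepY n β y q t ≠ 0 := fun x => by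
      refine eventually_ne_of_eventually_hasDerivAt (meromorphicAt_stepY (hm x) (hmq x))
        (((hs x).and (hR x)).mono fun t ht => ht.1.hasDerivAt_stepY ht.2) fun t ht => ?_
      rw [ht]
      have := beta_ne hβ 0
      simpa using this
    have hQ : ∀ x, ∀ᶠ t in 𝓝[≠] x, stepQ n β y q t ≠ 0 := fun x => by
      refine eventually_ne_of_eventually_hasDerivAt (meromorphicAt_stepQ (hm x) (hmq x))
        (((hs x).and (hR x)).mono fun t ht => ht.1.hasDerivAt_stepQ ht.2) fun t ht => ?_
      rw [ht]
      -- At a zero of `Q` the derivative is `β - 2 - 2(n+1) = β - 2(n+2)`.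
      have := beta_ne hβ (n + 2)
      intro h0
      apply this
      push_cast at h0 ⊢
      linear_combination h0
    have hall : ∀ x, ∀ᶠ t in 𝓝[≠] x, StepEq β (riccati z) n t := fun x => by
      have : ∀ᶠ t in 𝓝[≠] x, StepNe n β y q t := by
        filter_upwards [hs x, hR x, hY x, hQ x] with t h1 h2 h3 h4
        exact ⟨h1, h2, h3, h4⟩
      exact (eventually_nhdsNE_eventually_nhds_iff.2 this).mono fun t ht =>
        (StepNe.stepEq ht).self_of_nhds
    refine ⟨fun x => ?_, fun x => (hall x).mono fun t ht => ht.sys⟩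
    refine (meromorphicAt_stepY (n := n) (β := β) (hm x) (hmq x)).congr ?_
    exact (hall x).mono fun t ht => ht.y_eq.symm

include hβ in
/-- The members of the ladder solve the fourth Painlevé equation. -/
theorem IsSeed.isSolution (h : IsSeed β z) (n : ℕ) :
    IsSolution (1 / 2 + n) β (ladder β (riccati z) n) := by
  obtain ⟨hm, hs⟩ := h.ladder_aux hβ n
  refine ⟨hm, ?_⟩
  set y := ladder β (riccati z) n with hy
  set q := ladderQ β (riccati z) n with hqd
  have key : ∀ x, ∀ᶠ t in 𝓝[≠] x, y t ≠ 0 ∧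
    deriv (deriv y) t =
      (deriv y t) ^ 2 / (2 * y t) + 3 / 2 * (y t) ^ 3 + 4 * t * (y t) ^ 2
        + 2 * (t ^ 2 - (2 * (1 / 2 + n) - β / 2)) * y t - β ^ 2 / (2 * y t) := fun x => by
    filter_upwards [eventually_nhdsNE_eventually_nhds_iff.2 (hs x)] with t ht
    have h0 := ht.self_of_nhds
    refine ⟨h0.y_ne, ?_⟩
    have hy0 := h0.y_ne
    have e : deriv y =ᶠ[𝓝 t] fun t => y t * (2 * q t + 2 * t + y t) - β :=
      ht.mono fun t h => h.deriv_y.deriv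
    rw [e.deriv_eq, h0.deriv_y.deriv]
    have : HasDerivAt (fun t => y t * (2 * q t + 2 * t + y t) - β) _ t :=
      (h0.deriv_y.mul (((h0.deriv_q.const_mul (2 : ℂ)).add
        ((hasDerivAt_id t).const_mul (2 : ℂ))).add h0.deriv_y)).sub_const β
    rw [this.deriv]
    simp only [Pi.add_apply, id]
    field_simp
    ring
  rw [Filter.Eventually, mem_codiscrete]
  intro x
  rw [disjoint_principal_right, compl_compl]
  exact key x

end P4

end

noncomputable section

open Topology Asymptotics Set

namespace P4

/-! ### Leading behaviour in powers of `x` -/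

section Lead

variable {ι : Type*} {l : Filter ι} {x f g h f' g' : ι → ℂ} {a b : ℂ} {k m : ℤ}

/-- `f = O(x^k)`. -/
def PowO (l : Filter ι) (x f : ι → ℂ) (k : ℤ) : Prop := f =O[l] fun i => x i ^ k

/-- `f = a x^k + O(x^{k-2})`. -/
def Lead (l : Filter ι) (x f : ι → ℂ) (a : ℂ) (k : ℤ) : Prop :=
  PowO l x (fun i => f i - a * x i ^ k) (k - 2)

/-- `f = g (1 + O(x⁻²))`. -/
def Rel (l : Filter ι) (x f g : ι → ℂ) : Prop :=
  (fun i => f i - g i) =O[l] fun i => x i ^ (-2 : ℤ) * g i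

lemma eventually_ne_zero_of_norm_atTop (hx : Tendsto (fun i => ‖x i‖) l atTop) :
    ∀ᶠ i in l, x i ≠ 0 :=
  (hx.eventually_gt_atTop 0).mono fun _ hi => norm_pos_iff.1 hi

lemma PowO.mono (hx : Tendsto (fun i => ‖x i‖) l atTop) (hf : PowO l x f k) (hkm : k ≤ m) :
    PowO l x f m := by
  refine hf.trans (IsBigO.of_bound 1 ?_)
  filter_upwards [hx.eventually_ge_atTop 1] with i hi
  rw [norm_zpow, norm_zpow, one_mul]
  exact zpow_le_zpow_right₀ hi hkm

lemma PowO.mul (hx : Tendsto (fun i => ‖x i‖) l atTop) (hf : PowO l x f k) (hg : PowO l x g m) :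
    PowO l x (fun i => f i * g i) (k + m) := by
  refine (IsBigO.mul hf hg).congr' EventuallyEq.rfl ?_
  filter_upwards [eventually_ne_zero_of_norm_atTop hx] with i hi
  rw [zpow_add₀ hi]

lemma PowO.add (hf : PowO l x f k) (hg : PowO l x g k) : PowO l x (fun i => f i + g i) k :=
  IsBigO.add hf hg

lemma PowO.sub (hf : PowO l x f k) (hg : PowO l x g k) : PowO l x (fun i => f i - g i) k :=
  IsBigO.sub hf hg

lemma PowO.const_mul (c : ℂ) (hf : PowO l x f k) : PowO l x (fun i => c * f i) k :=
  IsBigO.const_mul_left hf c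

lemma PowO.congr (hf : PowO l x f k) (h : f =ᶠ[l] g) : PowO l x g k :=
  IsBigO.congr' hf h EventuallyEq.rfl

lemma powO_zpow (k : ℤ) : PowO l x (fun i => x i ^ k) k := isBigO_refl _ _

lemma powO_self : PowO l x x 1 := by simpa [PowO] using isBigO_refl x l

lemma Lead.congr (hf : Lead l x f a k) (h : f =ᶠ[l] g) : Lead l x g a k :=
  PowO.congr hf (h.mono fun i hi => by simp [hi])

lemma Lead.powO (hx : Tendsto (fun i => ‖x i‖) l atTop) (hf : Lead l x f a k) : PowO l x f k := by
  have := (PowO.mono hx hf (by omega : k - 2 ≤ k)).add ((powO_zpow k).const_mul a)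
  exact this.congr (Eventually.of_forall fun i => by ring)

/-- Cancelled leading coefficients are recorded as `Lead` with coefficient zero, which says exactly
that two powers have been gained. -/
lemma lead_zero_iff : Lead l x f 0 k ↔ PowO l x f (k - 2) := by simp [Lead]

lemma lead_zero (hf : PowO l x f m) (h : m = k - 2) : Lead l x f 0 k := by
  rw [lead_zero_iff, ← h]; exact hf

lemma Lead.add (hf : Lead l x f a k) (hg : Lead l x g b k) :
    Lead l x (fun i => f i + g i) (a + b) k :=
  (PowO.add hf hg).congr (Eventually.of_forall fun i => by ring)

lemma Lead.sub (hf : Lead l x f a k) (hg : Lead l x g b k) :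
    Lead l x (fun i => f i - g i) (a - b) k :=
  (PowO.sub hf hg).congr (Eventually.of_forall fun i => by ring)

lemma Lead.const_mul (c : ℂ) (hf : Lead l x f a k) : Lead l x (fun i => c * f i) (c * a) k :=
  (PowO.const_mul c hf).congr (Eventually.of_forall fun i => by ring)

lemma lead_zpow (k : ℤ) : Lead l x (fun i => x i ^ k) 1 k := by
  simpa [Lead, PowO] using isBigO_zero _ _

lemma lead_self : Lead l x x 1 1 := by simpa using lead_zpow (l := l) (x := x) 1

lemma lead_const (c : ℂ) : Lead l x (fun _ => c) c 0 := by
  simpa [Lead, PowO] using isBigO_zero _ _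

lemma Lead.mul (hx : Tendsto (fun i => ‖x i‖) l atTop) (hf : Lead l x f a k)
    (hg : Lead l x g b m) : Lead l x (fun i => f i * g i) (a * b) (k + m) := by
  have h1 : PowO l x (fun i => (f i - a * x i ^ k) * g i) (k + m - 2) := by
    convert PowO.mul hx hf (hg.powO hx) using 1; ring
  have h2 : PowO l x (fun i => a * x i ^ k * (g i - b * x i ^ m)) (k + m - 2) := by
    convert PowO.mul hx ((powO_zpow k).const_mul a) hg using 1; ring
  refine (h1.add h2).congr ?_
  filter_upwards [eventually_ne_zero_of_norm_atTop hx] with i hi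
  rw [zpow_add₀ hi]
  ring

lemma Lead.eventually_norm_ge (hx : Tendsto (fun i => ‖x i‖) l atTop) (ha : a ≠ 0)
    (hf : Lead l x f a k) : ∀ᶠ i in l, ‖a‖ / 2 * ‖x i ^ k‖ ≤ ‖f i‖ := by
  obtain ⟨C, hC⟩ := IsBigO.bound hf
  have ha' : 0 < ‖a‖ := norm_pos_iff.2 ha
  filter_upwards [hC, hx.eventually_ge_atTop 1, hx.eventually_ge_atTop (2 * C / ‖a‖)]
    with i h1 h2 h3
  have hx0 : x i ≠ 0 := norm_pos_iff.1 (by linarith)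
  have h4 : ‖x i ^ (k - 2)‖ * ‖x i‖ ^ 2 = ‖x i ^ k‖ := by
    rw [← norm_pow, ← norm_mul, ← zpow_natCast, ← zpow_add₀ hx0]
    congr 2
    push_cast
    ring
  -- From `|x| ≥ 2C/|a|` and `|x| ≥ 1` follows `C ≤ |a||x|²/2`, so the error takes at most half of
  -- the main term.
  have h5 : C * ‖x i ^ (k - 2)‖ ≤ ‖a‖ / 2 * ‖x i ^ k‖ := by
    rw [← h4, mul_comm ‖x i ^ (k - 2)‖, ← mul_assoc]
    refine mul_le_mul_of_nonneg_right ?_ (norm_nonneg _)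
    rw [div_le_iff₀ ha'] at h3
    have h7 : ‖x i‖ * ‖a‖ * 1 ≤ ‖x i‖ * ‖a‖ * ‖x i‖ :=
      mul_le_mul_of_nonneg_left h2 (by positivity)
    nlinarith
  have h6 : ‖a * x i ^ k‖ ≤ ‖f i‖ + ‖f i - a * x i ^ k‖ := by
    have := norm_sub_le (f i) (f i - a * x i ^ k)
    simpa using this
  rw [norm_mul] at h6
  linarith

lemma Lead.eventually_ne (hx : Tendsto (fun i => ‖x i‖) l atTop) (ha : a ≠ 0)
    (hf : Lead l x f a k) : ∀ᶠ i in l, f i ≠ 0 := by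
  filter_upwards [hf.eventually_norm_ge hx ha, eventually_ne_zero_of_norm_atTop hx] with i hi h0
  have : 0 < ‖a‖ / 2 * ‖x i ^ k‖ :=
    mul_pos (half_pos (norm_pos_iff.2 ha)) (norm_pos_iff.2 (zpow_ne_zero _ h0))
  exact norm_pos_iff.1 (this.trans_le hi)

lemma Lead.inv (hx : Tendsto (fun i => ‖x i‖) l atTop) (ha : a ≠ 0) (hf : Lead l x f a k) :
    Lead l x (fun i => (f i)⁻¹) a⁻¹ (-k) := by
  have h1 : PowO l x (fun i => (f i)⁻¹) (-k) := by
    refine IsBigO.of_bound (‖a‖ / 2)⁻¹ ?_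
    filter_upwards [hf.eventually_norm_ge hx ha, eventually_ne_zero_of_norm_atTop hx] with i hi h0
    have : 0 < ‖a‖ / 2 * ‖x i ^ k‖ :=
      mul_pos (half_pos (norm_pos_iff.2 ha)) (norm_pos_iff.2 (zpow_ne_zero _ h0))
    rw [norm_inv, zpow_neg, norm_inv, ← mul_inv]
    exact inv_anti₀ this hi
  have h2 : PowO l x (fun i => (f i - a * x i ^ k) * (f i)⁻¹ * (-a⁻¹ * x i ^ (-k))) (-k - 2) := by
    convert PowO.mul hx (PowO.mul hx hf h1) ((powO_zpow (-k)).const_mul (-a⁻¹)) using 1; ring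
  refine h2.congr ?_
  filter_upwards [hf.eventually_ne hx ha, eventually_ne_zero_of_norm_atTop hx] with i hi h0
  have := zpow_ne_zero k h0
  rw [zpow_neg]
  field_simp
  ring

lemma Lead.div (hx : Tendsto (fun i => ‖x i‖) l atTop) (hb : b ≠ 0) (hf : Lead l x f a k)
    (hg : Lead l x g b m) : Lead l x (fun i => f i / g i) (a / b) (k - m) := by
  simpa [div_eq_mul_inv, sub_eq_add_neg] using hf.mul hx (hg.inv hx hb)

/-- Division of a leading behaviour by `x`. -/
lemma Lead.of_self_mul (hx : Tendsto (fun i => ‖x i‖) l atTop)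
    (hf : Lead l x (fun i => x i * f i) a k) : Lead l x f a (k - 1) := by
  have := (lead_zpow (l := l) (x := x) (-1)).mul hx hf
  rw [one_mul, show (-1 + k : ℤ) = k - 1 by ring] at this
  refine this.congr ?_
  filter_upwards [eventually_ne_zero_of_norm_atTop hx] with i h0
  rw [zpow_neg_one]
  field_simp

/-! #### Relative errors -/

lemma Lead.rel (hx : Tendsto (fun i => ‖x i‖) l atTop) (ha : a ≠ 0) (hf : Lead l x f a k) :
    Rel l x f (fun i => a * x i ^ k) := by
  refine IsBigO.trans hf ?_
  refine IsBigO.of_bound ‖a‖⁻¹ ?_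
  filter_upwards [eventually_ne_zero_of_norm_atTop hx] with i h0
  have ha' : ‖a‖ ≠ 0 := norm_ne_zero_iff.2 ha
  rw [show x i ^ (-2 : ℤ) * (a * x i ^ k) = a * x i ^ (k - 2) by
    rw [show k - 2 = -2 + k by ring, zpow_add₀ h0]; ring, norm_mul]
  field_simp
  exact le_rfl

lemma zpow_neg_two_isBigO_one (hx : Tendsto (fun i => ‖x i‖) l atTop) :
    (fun i => x i ^ (-2 : ℤ)) =O[l] fun _ => (1 : ℂ) := by
  simpa [PowO] using PowO.mono (m := 0) hx (powO_zpow (l := l) (x := x) (-2)) (by norm_num)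

lemma zpow_neg_two_mul_isBigO (hx : Tendsto (fun i => ‖x i‖) l atTop) (g : ι → ℂ) :
    (fun i => x i ^ (-2 : ℤ) * g i) =O[l] g := by
  simpa using (zpow_neg_two_isBigO_one hx).mul (isBigO_refl g l)

lemma Rel.refl (f : ι → ℂ) : Rel l x f f := by simpa [Rel] using isBigO_zero _ _

lemma Rel.isBigO (hx : Tendsto (fun i => ‖x i‖) l atTop) (h : Rel l x f g) : f =O[l] g := by
  have := (h.trans (zpow_neg_two_mul_isBigO hx g)).add (isBigO_refl g l)
  simpa using this

lemma Rel.congr (h : Rel l x f g) (hf : f =ᶠ[l] f') (hg : g =ᶠ[l] g') : Rel l x f' g' :=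
  IsBigO.congr' h (hf.sub hg) (hg.mono fun i hi => by simp [hi])

lemma Rel.congr_left (h : Rel l x f g) (hf : f =ᶠ[l] f') : Rel l x f' g :=
  h.congr hf EventuallyEq.rfl

lemma Rel.congr_right (h : Rel l x f g) (hg : g =ᶠ[l] g') : Rel l x f g' :=
  h.congr EventuallyEq.rfl hg

lemma Rel.trans (hx : Tendsto (fun i => ‖x i‖) l atTop) (h1 : Rel l x f g) (h2 : Rel l x g h) :
    Rel l x f h := by
  have : (fun i => x i ^ (-2 : ℤ) * g i) =O[l] fun i => x i ^ (-2 : ℤ) * h i :=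
    (isBigO_refl _ l).mul (h2.isBigO hx)
  simpa [Rel] using (IsBigO.trans h1 this).add h2

lemma Rel.mul (hx : Tendsto (fun i => ‖x i‖) l atTop) (h1 : Rel l x f g) (h2 : Rel l x f' g') :
    Rel l x (fun i => f i * f' i) (fun i => g i * g' i) := by
  have e1 : (fun i => (f i - g i) * f' i) =O[l] fun i => x i ^ (-2 : ℤ) * (g i * g' i) := by
    refine (IsBigO.mul h1 (h2.isBigO hx)).congr_right fun i => by ring
  have e2 : (fun i => g i * (f' i - g' i)) =O[l] fun i => x i ^ (-2 : ℤ) * (g i * g' i) := by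
    refine ((isBigO_refl g l).mul h2).congr_right fun i => by ring
  exact (e1.add e2).congr_left fun i => by ring

lemma Rel.const_mul (c : ℂ) (h : Rel l x f g) :
    Rel l x (fun i => c * f i) (fun i => c * g i) := by
  have := (isBigO_refl (fun _ => c) l).mul h
  exact this.congr (fun i => by ring) fun i => by ring

/-- Once `|x|² ≥ 2|C|`, the error is at most half of `g`, so `‖g‖ ≤ 2‖f‖` and the error may be
measured by `f` instead. -/
lemma Rel.symm (hx : Tendsto (fun i => ‖x i‖) l atTop) (h : Rel l x f g) : Rel l x g f := by
  obtain ⟨C, hC⟩ := h.bound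
  refine IsBigO.of_bound (2 * |C|) ?_
  filter_upwards [hC, hx.eventually_ge_atTop 1, hx.eventually_ge_atTop (2 * |C|)] with i h1 h2 h3
  have hxp : 0 < ‖x i‖ := by linarith
  have e : ‖x i ^ (-2 : ℤ)‖ = (‖x i‖ ^ 2)⁻¹ := by rw [zpow_neg, norm_inv]; norm_cast; simp
  rw [norm_mul, e] at h1
  rw [norm_mul, e, norm_sub_rev]
  have h4 : C * ((‖x i‖ ^ 2)⁻¹ * ‖g i‖) ≤ |C| * ((‖x i‖ ^ 2)⁻¹ * ‖g i‖) :=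
    mul_le_mul_of_nonneg_right (le_abs_self C) (by positivity)
  have h5 : |C| * (‖x i‖ ^ 2)⁻¹ ≤ 1 / 2 := by
    rw [← div_eq_mul_inv, div_le_iff₀ (by positivity)]
    nlinarith [abs_nonneg C]
  have h6 : ‖g i‖ ≤ ‖f i‖ + ‖f i - g i‖ := by
    have := norm_sub_le (f i) (f i - g i)
    simpa using this
  have h7 : ‖f i - g i‖ ≤ 1 / 2 * ‖g i‖ := by
    calc _ ≤ _ := h1.trans h4
      _ = (|C| * (‖x i‖ ^ 2)⁻¹) * ‖g i‖ := by ring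
      _ ≤ _ := mul_le_mul_of_nonneg_right h5 (norm_nonneg _)
  have h8 : ‖g i‖ ≤ 2 * ‖f i‖ := by linarith
  calc _ ≤ _ := h1.trans h4
    _ ≤ |C| * ((‖x i‖ ^ 2)⁻¹ * (2 * ‖f i‖)) := by gcongr
    _ = _ := by ring

/-- Terms that are smaller by a factor `x⁻²` do not matter. -/
lemma Rel.add_isBigO (h1 : Rel l x f g) (h2 : f' =O[l] fun i => x i ^ (-2 : ℤ) * g i) :
    Rel l x (fun i => f' i + f i) g :=
  (h2.add h1).congr_left fun i => by ring

/-- A term of the size of `g` is only a relative `O(x⁻²)` beside `c x² g`. In this way the direct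
contributions in a step drop out next to the amplified ones. -/
lemma isBigO_zpow_neg_two_mul (hx : Tendsto (fun i => ‖x i‖) l atTop) (c : ℂ) (hc : c ≠ 0)
    (h : f =O[l] g) : f =O[l] fun i => x i ^ (-2 : ℤ) * (c * x i ^ 2 * g i) := by
  refine h.trans (IsBigO.of_bound ‖c‖⁻¹ ?_)
  filter_upwards [eventually_ne_zero_of_norm_atTop hx] with i h0
  have hc' : ‖c‖ ≠ 0 := norm_ne_zero_iff.2 hc
  rw [show x i ^ (-2 : ℤ) * (c * x i ^ 2 * g i) = c * g i by
    rw [zpow_neg]; norm_cast; field_simp, norm_mul]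
  field_simp
  exact le_rfl

end Lead

end P4

end

noncomputable section

open Topology Asymptotics Set

namespace P4

/-! ### Sectors -/

/-- The point with polar coordinates `p`. -/
def polar (p : ℝ × ℝ) : ℂ := pt p.1 p.2

/-- The ends at infinity of the sector `|θ - θ₀| ≤ w - δ`. -/
def sector (θ₀ w δ : ℝ) : Filter (ℝ × ℝ) := atTop ×ˢ 𝓟 {θ | |θ - θ₀| ≤ w - δ}

lemma norm_pt {r θ : ℝ} (hr : 0 ≤ r) : ‖pt r θ‖ = r := by
  rw [pt, norm_mul, norm_exp_ofReal_mul_I, mul_one, norm_real, Real.norm_of_nonneg hr]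

lemma eventually_sector {θ₀ w δ : ℝ} {P : ℝ × ℝ → Prop} :
    (∀ᶠ p in sector θ₀ w δ, P p) ↔
      ∃ R : ℝ, 0 < R ∧ ∀ r θ : ℝ, R ≤ r → |θ - θ₀| ≤ w - δ → P (r, θ) := by
  rw [sector, eventually_prod_principal_iff, eventually_atTop]
  constructor
  · rintro ⟨R, hR⟩
    exact ⟨max R 1, by positivity, fun r θ hr hθ => hR r ((le_max_left _ _).trans hr) θ hθ⟩
  · rintro ⟨R, _, hR⟩
    exact ⟨R, fun r hr θ hθ => hR r θ hr hθ⟩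

lemma eventually_pos_sector {θ₀ w δ : ℝ} : ∀ᶠ p in sector θ₀ w δ, 0 < p.1 :=
  eventually_sector.2 ⟨1, one_pos, fun _ _ hr _ => by simpa using one_pos.trans_le hr⟩

lemma eventually_mem_sector {θ₀ w δ : ℝ} : ∀ᶠ p in sector θ₀ w δ, |p.2 - θ₀| ≤ w - δ :=
  eventually_sector.2 ⟨1, one_pos, fun _ _ _ h => h⟩

lemma tendsto_norm_polar {θ₀ w δ : ℝ} :
    Tendsto (fun p => ‖polar p‖) (sector θ₀ w δ) atTop := by
  have h : Tendsto (fun p : ℝ × ℝ => p.1) (sector θ₀ w δ) atTop := tendsto_fst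
  refine h.congr' ?_
  filter_upwards [eventually_pos_sector] with p hp
  exact (norm_pt hp.le).symm

lemma sector_mono {θ₀ θ₁ w w' δ δ' : ℝ} (h : |θ₁ - θ₀| + (w' - δ') ≤ w - δ) :
    sector θ₁ w' δ' ≤ sector θ₀ w δ := by
  refine prod_mono le_rfl (principal_mono.2 fun θ hθ => ?_)
  have : |θ - θ₀| ≤ |θ - θ₁| + |θ₁ - θ₀| := abs_sub_le _ _ _
  simp only [mem_ofPred_eq] at hθ ⊢
  linarith

/-- A disc about `x` of radius proportional to `|x|` lies in a slightly larger sector. -/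
lemma exists_polar_of_near {δ : ℝ} (hδ : 0 < δ) : ∃ ε : ℝ, 0 < ε ∧ ∀ (r θ : ℝ) (t : ℂ), 0 < r →
    ‖t - pt r θ‖ ≤ ε * r → ∃ r' θ' : ℝ, t = pt r' θ' ∧ r / 2 ≤ r' ∧ |θ' - θ| ≤ δ := by
  obtain ⟨ε, hε, h⟩ := Metric.continuousAt_iff.1
    (continuousAt_arg (x := 1) (by simp [slitPlane])) δ hδ
  refine ⟨min (ε / 2) (1 / 2), by positivity, fun r θ t hr ht => ?_⟩
  have hp : pt r θ ≠ 0 := norm_pos_iff.1 (by rw [norm_pt hr.le]; exact hr)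
  set u := t / pt r θ with hu
  have htu : t = pt r θ * u := by rw [hu]; field_simp
  have hu1 : ‖u - 1‖ ≤ min (ε / 2) (1 / 2) := by
    rw [htu, show pt r θ * u - pt r θ = pt r θ * (u - 1) by ring, norm_mul, norm_pt hr.le,
      mul_comm] at ht
    exact le_of_mul_le_mul_right ht hr
  have h1 : ‖u - 1‖ ≤ 1 / 2 := hu1.trans (min_le_right _ _)
  have h2 : 1 / 2 ≤ ‖u‖ := by
    have := norm_sub_le u (u - 1)
    simp only [sub_sub_cancel, norm_one] at this
    linarith
  refine ⟨r * ‖u‖, θ + arg u, ?_, by nlinarith, ?_⟩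
  · rw [htu]
    conv_lhs => rw [← norm_mul_exp_arg_mul_I u]
    simp only [pt]
    push_cast
    rw [add_mul, Complex.exp_add]
    ring
  · rw [add_sub_cancel_left]
    have := h (x := u) (by
      rw [dist_eq_norm]
      exact (hu1.trans (min_le_left _ _)).trans_lt (by linarith))
    rw [dist_eq_norm, arg_one, sub_zero] at this
    exact this.le

variable {θ₀ w : ℝ}

/-- A point of the `δ`-subsector far out has a disc around it inside the `δ/2`-subsector, so
properties valid in all closed subsectors are automatically open there. -/
lemma eventually_nhds_of_sector {P : ℂ → Prop}
    (h : ∀ δ > 0, ∀ᶠ p in sector θ₀ w δ, P (polar p)) {δ : ℝ} (hδ : 0 < δ) :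
    ∀ᶠ p in sector θ₀ w δ, ∀ᶠ t in 𝓝 (polar p), P t := by
  obtain ⟨R, hR, h⟩ := eventually_sector.1 (h (δ / 2) (by positivity))
  obtain ⟨ε, hε, hn⟩ := exists_polar_of_near (half_pos hδ)
  refine eventually_sector.2 ⟨2 * R, by positivity, fun r θ hr hθ => ?_⟩
  have hr0 : 0 < r := by linarith
  filter_upwards [Metric.closedBall_mem_nhds (polar (r, θ)) (mul_pos hε hr0)] with t ht
  obtain ⟨r', θ', rfl, h1, h2⟩ := hn r θ t hr0 (by rwa [Metric.mem_closedBall, dist_eq_norm] at ht)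
  refine h r' θ' (by linarith) ?_
  have := abs_sub_le θ' θ θ₀
  linarith

/-- Cauchy's estimate in sectors. -/
lemma powO_deriv {f f' : ℂ → ℂ}
    (hd : ∀ δ > 0, ∀ᶠ p in sector θ₀ w δ, HasDerivAt f (f' (polar p)) (polar p))
    (hf : ∀ δ > 0, PowO (sector θ₀ w δ) polar (fun p => f (polar p)) (-1)) {δ : ℝ} (hδ : 0 < δ) :
    PowO (sector θ₀ w δ) polar (fun p => f' (polar p)) (-2) := by
  obtain ⟨C, hC⟩ := (hf (δ / 2) (by positivity)).bound
  obtain ⟨R, hR, h⟩ := eventually_sector.1 ((hd (δ / 2) (by positivity)).and hC)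
  obtain ⟨ε, hε, hn⟩ := exists_polar_of_near (half_pos hδ)
  -- On the disc of radius `εr` every point has modulus at least `r/2`, so the function is at most
  -- `2|C|/r`; Cauchy's estimate divides by `εr`.
  refine IsBigO.of_bound (2 * |C| / ε) (eventually_sector.2
    ⟨2 * R, by positivity, fun r θ hr hθ => ?_⟩)
  have hr0 : 0 < r := by linarith
  have key : ∀ t : ℂ, ‖t - pt r θ‖ ≤ ε * r →
      DifferentiableAt ℂ f t ∧ ‖f t‖ ≤ 2 * |C| / r := fun t ht => by
    obtain ⟨r', θ', rfl, h1, h2⟩ := hn r θ t hr0 ht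
    have h3 := h r' θ' (by linarith) (by have := abs_sub_le θ' θ θ₀; linarith)
    refine ⟨h3.1.differentiableAt, h3.2.trans ?_⟩
    have hr' : 0 < r' := by linarith
    rw [zpow_neg_one, norm_inv, polar, norm_pt hr'.le, ← div_eq_mul_inv]
    calc C / r' ≤ |C| / r' := by gcongr; exact le_abs_self C
      _ ≤ |C| / (r / 2) := by gcongr
      _ = _ := by field_simp
  have h0 := (h r θ (by linarith) (by linarith)).1
  rw [← h0.deriv]
  have hdc : DiffContOnCl ℂ f (Metric.ball (pt r θ) (ε * r)) := by
    refine DifferentiableOn.diffContOnCl fun t ht => ?_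
    refine (key t ?_).1.differentiableWithinAt
    have := Metric.closure_ball_subset_closedBall ht
    simpa [dist_eq_norm] using this
  refine (Complex.norm_deriv_le_of_forall_mem_sphere_norm_le (mul_pos hε hr0) hdc
    (fun t ht => (key t ?_).2)).trans (le_of_eq ?_)
  · rw [mem_sphere_iff_norm] at ht
    exact ht.le
  · rw [zpow_neg, norm_inv, show ‖polar (r, θ) ^ (2 : ℤ)‖ = r ^ 2 by
      rw [norm_zpow, polar, norm_pt hr0.le]; norm_cast]
    field_simp

/-! ### Algebraic behaviour along the ladder -/

section Steps

variable {n : ℕ} {β : ℂ} {y q : ℂ → ℂ}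

/-- The pair `(y, q)` at level `n` with `y = a x^k + …`, `q = b x^m + …` in the sector. -/
structure LeadPair (n : ℕ) (β : ℂ) (y q : ℂ → ℂ) (θ₀ w : ℝ) (a : ℂ) (k : ℤ) (b : ℂ) (m : ℤ) :
    Prop where
  sys : ∀ δ > 0, ∀ᶠ p in sector θ₀ w δ, IsSystemAt n β y q (polar p)
  lead_y : ∀ δ > 0, Lead (sector θ₀ w δ) polar (fun p => y (polar p)) a k
  lead_q : ∀ δ > 0, Lead (sector θ₀ w δ) polar (fun p => q (polar p)) b m

/-- Nonzero leading coefficients make `R`, `Y`, `Q` nonzero far out in each subsector, hence near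
each such point, and the pointwise step applies. -/
lemma LeadPair.next {y₀ : ℂ → ℂ} {a b a' b' c : ℂ} {k m k' m' i : ℤ}
    (h : LeadPair n β (ladder β y₀ n) (ladderQ β y₀ n) θ₀ w a k b m)
    (hY : ∀ δ > 0, Lead (sector θ₀ w δ) polar
      (fun p => stepY n β (ladder β y₀ n) (ladderQ β y₀ n) (polar p)) a' k')
    (hQ : ∀ δ > 0, Lead (sector θ₀ w δ) polar
      (fun p => stepQ n β (ladder β y₀ n) (ladderQ β y₀ n) (polar p)) b' m')
    (hR : ∀ δ > 0, Lead (sector θ₀ w δ) polar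
      (fun p => stepR n β (ladder β y₀ n) (ladderQ β y₀ n) (polar p)) c i)
    (ha' : a' ≠ 0) (hb' : b' ≠ 0) (hc : c ≠ 0) :
    LeadPair (n + 1) β (ladder β y₀ (n + 1)) (ladderQ β y₀ (n + 1)) θ₀ w a' k' b' m' ∧
      ∀ δ > 0, ∀ᶠ p in sector θ₀ w δ, StepEq β y₀ n (polar p) := by
  have hne : ∀ δ > 0, ∀ᶠ p in sector θ₀ w δ,
      StepNe n β (ladder β y₀ n) (ladderQ β y₀ n) (polar p) := fun δ hδ => by
    filter_upwards [h.sys δ hδ, (hY δ hδ).eventually_ne tendsto_norm_polar ha',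
      (hQ δ hδ).eventually_ne tendsto_norm_polar hb',
      (hR δ hδ).eventually_ne tendsto_norm_polar hc] with p h1 h2 h3 h4
    exact ⟨h1, h4, h2, h3⟩
  have heq : ∀ δ > 0, ∀ᶠ p in sector θ₀ w δ, StepEq β y₀ n (polar p) := fun δ hδ =>
    (eventually_nhds_of_sector hne hδ).mono fun p hp => (StepNe.stepEq hp).self_of_nhds
  refine ⟨⟨fun δ hδ => (heq δ hδ).mono fun p hp => hp.sys, fun δ hδ => ?_, fun δ hδ => ?_⟩, heq⟩
  · exact (hY δ hδ).congr ((heq δ hδ).mono fun p hp => hp.y_eq.symm)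
  · exact (hQ δ hδ).congr ((heq δ hδ).mono fun p hp => hp.q_eq.symm)

/-- `R` in the decaying case. -/
lemma lead_stepR_decaying {l : Filter (ℝ × ℝ)} (hx : Tendsto (fun p => ‖polar p‖) l atTop)
    (hy : Lead l polar (fun p => y (polar p)) (-(β / 2)) (-1))
    (hq : Lead l polar (fun p => q (polar p)) (-2) 1) :
    Lead l polar (fun p => stepR n β y q (polar p)) (-(n + 1)) (-1) := by
  have := hy.sub ((hq.inv hx (by norm_num)).const_mul (β - 2 - 2 * n))
  rw [show (-(β / 2) - (β - 2 - 2 * n) * (-2)⁻¹) = -(n + 1) by ring] at this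
  exact this

/-- `y ~ -β/(2x)` is preserved along the ladder. -/
lemma LeadPair.decaying_step (h : LeadPair n β y q θ₀ w (-(β / 2)) (-1) (-2) 1) :
    (∀ δ > 0, Lead (sector θ₀ w δ) polar (fun p => stepY n β y q (polar p)) (-(β / 2)) (-1)) ∧
    (∀ δ > 0, Lead (sector θ₀ w δ) polar (fun p => stepQ n β y q (polar p)) (-2) 1) ∧
    (∀ δ > 0, Lead (sector θ₀ w δ) polar (fun p => stepR n β y q (polar p)) (-(n + 1)) (-1)) := by
  have hn : (n + 1 : ℂ) ≠ 0 := by exact_mod_cast n.succ_ne_zero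
  have hR : ∀ δ > 0, Lead (sector θ₀ w δ) polar
      (fun p => stepR n β y q (polar p)) (-(n + 1)) (-1) := fun δ hδ =>
    lead_stepR_decaying tendsto_norm_polar (h.lead_y δ hδ) (h.lead_q δ hδ)
  -- Both `q` and `(2n+2)/R` have leading term `-2x`, so they cancel and only the order `x⁻¹` of `Y`
  -- is visible; its coefficient has to come from the differential equation.
  have hY : ∀ δ > 0, PowO (sector θ₀ w δ) polar (fun p => stepY n β y q (polar p)) (-1) :=
    fun δ hδ => by
      have := (h.lead_q δ hδ).sub
        (((hR δ hδ).inv tendsto_norm_polar (neg_ne_zero.2 hn)).const_mul (2 * n + 2))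
      rw [show (-2 - (2 * n + 2) * (-(n + 1 : ℂ))⁻¹) = 0 by field_simp; ring] at this
      exact lead_zero_iff.1 this
  have hd : ∀ δ > 0, ∀ᶠ p in sector θ₀ w δ, HasDerivAt (stepY n β y q)
      (stepY n β y q (polar p) * (2 * stepQ n β y q (polar p) + 2 * polar p
        + stepY n β y q (polar p)) - β) (polar p) := fun δ hδ => by
    filter_upwards [h.sys δ hδ, (hR δ hδ).eventually_ne tendsto_norm_polar (neg_ne_zero.2 hn)]
      with p h1 h2
    exact h1.hasDerivAt_stepY h2
  refine ⟨fun δ hδ => ?_, fun δ hδ => ?_, hR⟩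
  · have hx := tendsto_norm_polar (θ₀ := θ₀) (w := w) (δ := δ)
    have hD := powO_deriv (f' := fun t => stepY n β y q t * (2 * stepQ n β y q t + 2 * t
      + stepY n β y q t) - β) hd hY hδ
    -- Eliminating `Q`, the equation reads `xY = -β/2 - (Y' + Y² + 2YR)/2`, and by Cauchy's estimate
    -- the bracket is `O(x⁻²)`.
    have hRO := (hR δ hδ).powO hx
    have e := (lead_zero ((hD.add ((hY δ hδ).mul hx (hY δ hδ))).add
      (((hY δ hδ).mul hx hRO).const_mul 2)) (k := 0) (by norm_num)).const_mul (-(1 / 2))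
    have e2 := e.add (lead_const (-(β / 2)))
    rw [show (-(1 / 2) * 0 + -(β / 2)) = -(β / 2) by ring] at e2
    exact Lead.of_self_mul hx (e2.congr (Eventually.of_forall fun p => by simp only [stepQ]; ring))
  · have := ((lead_self (l := sector θ₀ w δ) (x := polar)).const_mul (-2)).sub
      (lead_zero ((hY δ hδ).add ((hR δ hδ).powO tendsto_norm_polar)) (k := 1) (by norm_num))
    rw [show (-2 * 1 - 0 : ℂ) = -2 by ring] at this
    exact this.congr (Eventually.of_forall fun p => by simp only [stepQ]; ring)

/-- `R` in the growing case. -/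
lemma LeadPair.growing_stepR (hβ : ∀ m : ℤ, β / 2 ≠ m)
    (h : LeadPair n β y q θ₀ w (-2) 1 (n + 1 - β / 2) (-1)) {δ : ℝ} (hδ : 0 < δ) :
    Lead (sector θ₀ w δ) polar (fun p => stepR n β y q (polar p)) (n + 1) (-1) := by
  have hs : (n + 1 - β / 2 : ℂ) ≠ 0 := fun h0 => hβ (n + 1) (by push_cast; linear_combination -h0)
  -- The terms of order `x` cancel again, as `β - 2 - 2n = -2(n+1-β/2)`. The coefficient of `x⁻¹` is
  -- then read off `xR = n+1 + (R' - R² - 2qR)/2`.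
  have hRO : ∀ δ > 0, PowO (sector θ₀ w δ) polar (fun p => stepR n β y q (polar p)) (-1) :=
    fun δ hδ => by
      have := (h.lead_y δ hδ).sub
        (((h.lead_q δ hδ).inv tendsto_norm_polar hs).const_mul (β - 2 - 2 * n))
      rw [show (-2 - (β - 2 - 2 * n) * (n + 1 - β / 2 : ℂ)⁻¹) = 0 by
        linear_combination 2 * mul_inv_cancel₀ hs] at this
      exact lead_zero_iff.1 this
  have hqO := (h.lead_q δ hδ).powO tendsto_norm_polar
  have hRd : ∀ δ > 0, ∀ᶠ p in sector θ₀ w δ, HasDerivAt (stepR n β y q)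
      (stepR n β y q (polar p) * (2 * q (polar p) + 2 * polar p
        + stepR n β y q (polar p)) - (2 * n + 2)) (polar p) := fun δ hδ =>
    (h.sys δ hδ).mono fun p hp => hp.hasDerivAt_stepR
  have hx := tendsto_norm_polar (θ₀ := θ₀) (w := w) (δ := δ)
  have hD := powO_deriv (f' := fun t => stepR n β y q t * (2 * q t + 2 * t
    + stepR n β y q t) - (2 * n + 2)) hRd hRO hδ
  have h1 := (hRO δ hδ).mul hx (hRO δ hδ)
  have h2 := ((hRO δ hδ).mul hx hqO).const_mul 2
  have e := (lead_zero ((hD.sub h1).sub h2) (k := 0) (by norm_num)).const_mul (1 / 2)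
  have e2 := e.add (lead_const (n + 1))
  rw [show (1 / 2 * 0 + (n + 1) : ℂ) = n + 1 by ring] at e2
  exact Lead.of_self_mul hx (e2.congr (Eventually.of_forall fun p => by ring))

lemma LeadPair.growing_stepY (hβ : ∀ m : ℤ, β / 2 ≠ m)
    (h : LeadPair n β y q θ₀ w (-2) 1 (n + 1 - β / 2) (-1)) {δ : ℝ} (hδ : 0 < δ) :
    Lead (sector θ₀ w δ) polar (fun p => stepY n β y q (polar p)) (-2) 1 := by
  have hn : (n + 1 : ℂ) ≠ 0 := by exact_mod_cast n.succ_ne_zero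
  have hqO := (h.lead_q δ hδ).powO tendsto_norm_polar
  have := (lead_zero hqO (k := 1) (by norm_num)).sub
    (((h.growing_stepR hβ hδ).inv tendsto_norm_polar hn).const_mul (2 * n + 2))
  rw [show (0 - (2 * n + 2) * (n + 1 : ℂ)⁻¹) = -2 by
    linear_combination -2 * mul_inv_cancel₀ hn] at this
  exact this

lemma LeadPair.growing_stepQ (hβ : ∀ m : ℤ, β / 2 ≠ m)
    (h : LeadPair n β y q θ₀ w (-2) 1 (n + 1 - β / 2) (-1)) {δ : ℝ} (hδ : 0 < δ) :
    Lead (sector θ₀ w δ) polar (fun p => stepQ n β y q (polar p))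
      ((n + 1 : ℕ) + 1 - β / 2) (-1) := by
  have hn : (n + 1 : ℂ) ≠ 0 := by exact_mod_cast n.succ_ne_zero
  have hRO : ∀ δ > 0, PowO (sector θ₀ w δ) polar (fun p => stepR n β y q (polar p)) (-1) :=
    fun δ hδ => (h.growing_stepR hβ hδ).powO tendsto_norm_polar
  have hQO : ∀ δ > 0, PowO (sector θ₀ w δ) polar (fun p => stepQ n β y q (polar p)) (-1) :=
    fun δ hδ => by
      have := (((lead_self (l := sector θ₀ w δ) (x := polar)).const_mul (-2)).sub
        (h.growing_stepY hβ hδ)).sub (lead_zero (hRO δ hδ) (k := 1) (by norm_num))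
      rw [show (-2 * 1 - -2 - 0 : ℂ) = 0 by ring] at this
      exact lead_zero_iff.1 this
  have hQd : ∀ δ > 0, ∀ᶠ p in sector θ₀ w δ, HasDerivAt (stepQ n β y q)
      (-(stepQ n β y q (polar p)) ^ 2 - 2 * polar p * stepQ n β y q (polar p)
        - 2 * stepY n β y q (polar p) * stepQ n β y q (polar p) + (β - 2 - 2 * (n + 1 : ℕ)))
      (polar p) := fun δ hδ => by
    filter_upwards [h.sys δ hδ, (h.growing_stepR hβ hδ).eventually_ne tendsto_norm_polar hn]
      with p h1 h2
    exact h1.hasDerivAt_stepQ h2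
  have hx := tendsto_norm_polar (θ₀ := θ₀) (w := w) (δ := δ)
  have hD := powO_deriv (f' := fun t => -(stepQ n β y q t) ^ 2 - 2 * t * stepQ n β y q t
    - 2 * stepY n β y q t * stepQ n β y q t + (β - 2 - 2 * (n + 1 : ℕ))) hQd hQO hδ
  have h1 := (hQO δ hδ).mul hx (hQO δ hδ)
  have h2 := ((hRO δ hδ).mul hx (hQO δ hδ)).const_mul 2
  -- With `Y = -2x - Q - R` the equation for `Q'` becomes `xQ = n+2-β/2 + (Q' - Q² - 2QR)/2`.
  have e := (lead_zero ((hD.sub h1).sub h2) (k := 0) (by norm_num)).const_mul (1 / 2)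
  have e2 := e.add (lead_const ((n + 1 : ℕ) + 1 - β / 2))
  rw [show (1 / 2 * 0 + ((n + 1 : ℕ) + 1 - β / 2) : ℂ) = (n + 1 : ℕ) + 1 - β / 2 by ring] at e2
  refine Lead.of_self_mul hx (e2.congr (Eventually.of_forall fun p => ?_))
  have hYe : stepY n β y q (polar p) = -2 * polar p - stepQ n β y q (polar p)
    - stepR n β y q (polar p) := by simp only [stepQ]; ring
  simp only [hYe]
  push_cast
  ring

variable {y₀ : ℂ → ℂ}

lemma ladder_decaying (hβ : ∀ m : ℤ, β / 2 ≠ m)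
    (h : LeadPair 0 β (ladder β y₀ 0) (ladderQ β y₀ 0) θ₀ w (-(β / 2)) (-1) (-2) 1) (n : ℕ) :
    LeadPair n β (ladder β y₀ n) (ladderQ β y₀ n) θ₀ w (-(β / 2)) (-1) (-2) 1 ∧
      ∀ δ > 0, ∀ᶠ p in sector θ₀ w δ, StepEq β y₀ n (polar p) := by
  have hs : -(β / 2) ≠ 0 := neg_ne_zero.2 (by simpa using hβ 0)
  have step : ∀ n, LeadPair n β (ladder β y₀ n) (ladderQ β y₀ n) θ₀ w (-(β / 2)) (-1) (-2) 1 →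
      LeadPair (n + 1) β (ladder β y₀ (n + 1)) (ladderQ β y₀ (n + 1)) θ₀ w
        (-(β / 2)) (-1) (-2) 1 ∧ ∀ δ > 0, ∀ᶠ p in sector θ₀ w δ, StepEq β y₀ n (polar p) :=
    fun n ih => by
      obtain ⟨hY, hQ, hR⟩ := ih.decaying_step
      exact ih.next hY hQ hR hs (by norm_num)
        (neg_ne_zero.2 (by exact_mod_cast n.succ_ne_zero))
  have all : ∀ n, LeadPair n β (ladder β y₀ n) (ladderQ β y₀ n) θ₀ w (-(β / 2)) (-1) (-2) 1 :=
    fun n => by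
      induction n with
      | zero => exact h
      | succ n ih => exact (step n ih).1
  exact ⟨all n, (step n (all n)).2⟩

lemma ladder_growing (hβ : ∀ m : ℤ, β / 2 ≠ m)
    (h : LeadPair 0 β (ladder β y₀ 0) (ladderQ β y₀ 0) θ₀ w (-2) 1 (1 - β / 2) (-1)) (n : ℕ) :
    LeadPair n β (ladder β y₀ n) (ladderQ β y₀ n) θ₀ w (-2) 1 (n + 1 - β / 2) (-1) ∧
      ∀ δ > 0, ∀ᶠ p in sector θ₀ w δ, StepEq β y₀ n (polar p) := by
  have step : ∀ n : ℕ, LeadPair n β (ladder β y₀ n) (ladderQ β y₀ n) θ₀ w (-2) 1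
        (n + 1 - β / 2) (-1) →
      LeadPair (n + 1) β (ladder β y₀ (n + 1)) (ladderQ β y₀ (n + 1)) θ₀ w
        (-2) 1 ((n + 1 : ℕ) + 1 - β / 2) (-1) ∧
        ∀ δ > 0, ∀ᶠ p in sector θ₀ w δ, StepEq β y₀ n (polar p) :=
    fun n ih => by
      refine ih.next (fun δ hδ => ih.growing_stepY hβ hδ) (fun δ hδ => ih.growing_stepQ hβ hδ)
        (fun δ hδ => ih.growing_stepR hβ hδ) (by norm_num) (fun h0 => hβ (n + 2) ?_)
        (by exact_mod_cast n.succ_ne_zero)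
      push_cast at h0 ⊢
      linear_combination -h0
  have all : ∀ n : ℕ, LeadPair n β (ladder β y₀ n) (ladderQ β y₀ n) θ₀ w (-2) 1
      (n + 1 - β / 2) (-1) := fun n => by
    induction n with
    | zero => simpa using h
    | succ n ih => exact (step n ih).1
  exact ⟨all n, (step n (all n)).2⟩

end Steps

end P4

end

noncomputable section

open Topology Asymptotics Set

namespace P4

/-! ### Differences of two solutions along the ladder -/

section Differences

variable {n : ℕ} {β : ℂ} {l : Filter (ℝ × ℝ)} {y₁ q₁ y₂ q₂ : ℂ → ℂ}

/-- `Δq = -Δy (1 + O(x⁻²))` -/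
def Locked (l : Filter (ℝ × ℝ)) (y₁ q₁ y₂ q₂ : ℂ → ℂ) : Prop :=
  (fun p => (q₂ (polar p) - q₁ (polar p)) + (y₂ (polar p) - y₁ (polar p))) =O[l]
    fun p => polar p ^ (-2 : ℤ) * (y₂ (polar p) - y₁ (polar p))

lemma Locked.rel (h : Locked l y₁ q₁ y₂ q₂) :
    Rel l polar (fun p => q₂ (polar p) - q₁ (polar p))
      (fun p => (-1) * (y₂ (polar p) - y₁ (polar p))) := by
  refine (IsBigO.neg_right h).congr (fun p => by ring) fun p => by ring

lemma Locked.isBigO (hx : Tendsto (fun p => ‖polar p‖) l atTop) (h : Locked l y₁ q₁ y₂ q₂) :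
    (fun p => q₂ (polar p) - q₁ (polar p)) =O[l] fun p => y₂ (polar p) - y₁ (polar p) :=
  (h.rel.isBigO hx).trans ((isBigO_refl _ l).const_mul_left (-1))

lemma stepR_sub {p : ℂ} (h₁ : q₁ p ≠ 0) (h₂ : q₂ p ≠ 0) :
    stepR n β y₂ q₂ p - stepR n β y₁ q₁ p = (y₂ p - y₁ p) +
      (β - 2 - 2 * n) * ((q₂ p - q₁ p) * ((q₁ p)⁻¹ * (q₂ p)⁻¹)) := by
  simp only [stepR]
  field_simp
  ring

lemma stepY_sub {p : ℂ} (h₁ : stepR n β y₁ q₁ p ≠ 0) (h₂ : stepR n β y₂ q₂ p ≠ 0) :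
    stepY n β y₂ q₂ p - stepY n β y₁ q₁ p = (q₂ p - q₁ p) +
      (2 * n + 2) * ((stepR n β y₂ q₂ p - stepR n β y₁ q₁ p) *
        ((stepR n β y₁ q₁ p)⁻¹ * (stepR n β y₂ q₂ p)⁻¹)) := by
  simp only [stepY]
  field_simp
  ring

/-- The defect in `ΔQ = -ΔY` is exactly `-ΔR`. Since `ΔY` exceeds `ΔR` by a factor of order `x²`,
the relation between the differences renews itself at every step. -/
lemma stepQ_add_stepY {p : ℂ} :
    (stepQ n β y₂ q₂ p - stepQ n β y₁ q₁ p) + (stepY n β y₂ q₂ p - stepY n β y₁ q₁ p) =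
      -(stepR n β y₂ q₂ p - stepR n β y₁ q₁ p) := by
  simp only [stepQ]
  ring

/-- The part of a step that is common to both kinds of behaviour. -/
lemma stepY_sub_rel (hx : Tendsto (fun p => ‖polar p‖) l atTop) {a b : ℂ} {k : ℕ} (ha : a ≠ 0)
    (ha2 : a ^ 2 = (n + 1) ^ 2) (hb : b ≠ 0)
    (hR₁ : Lead l polar (fun p => stepR n β y₁ q₁ (polar p)) a (-1))
    (hR₂ : Lead l polar (fun p => stepR n β y₂ q₂ (polar p)) a (-1))
    (h : Locked l y₁ q₁ y₂ q₂)
    (hR : Rel l polar (fun p => stepR n β y₂ q₂ (polar p) - stepR n β y₁ q₁ (polar p))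
      (fun p => b * polar p ^ k * (y₂ (polar p) - y₁ (polar p)))) :
    Rel l polar (fun p => stepY n β y₂ q₂ (polar p) - stepY n β y₁ q₁ (polar p))
      (fun p => 2 / (n + 1) * polar p ^ 2 * (b * polar p ^ k * (y₂ (polar p) - y₁ (polar p)))) ∧
    Locked l (stepY n β y₁ q₁) (stepQ n β y₁ q₁) (stepY n β y₂ q₂) (stepQ n β y₂ q₂) := by
  have hn : (n + 1 : ℂ) ≠ 0 := by exact_mod_cast n.succ_ne_zero
  have h2n : (2 / (n + 1) : ℂ) ≠ 0 := div_ne_zero two_ne_zero hn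
  -- Only `1/(R₁R₂)` enters, hence only `a² = (n+1)²`: the two signs of `a` give the same factor
  -- `(2n+2)x²/(n+1)² = 2x²/(n+1)`.
  have hRR := (((hR₁.inv hx ha).mul hx (hR₂.inv hx ha)).rel hx
    (mul_ne_zero (inv_ne_zero ha) (inv_ne_zero ha)))
  have h1 : Rel l polar _ (fun p =>
      2 / (n + 1) * polar p ^ 2 * (b * polar p ^ k * (y₂ (polar p) - y₁ (polar p)))) :=
    ((hR.mul hx hRR).const_mul (2 * n + 2)).congr_right (Eventually.of_forall fun p => by
      simp only [Int.reduceNeg, neg_neg, Int.reduceAdd]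
      rw [show a⁻¹ * a⁻¹ = ((n + 1 : ℂ) ^ 2)⁻¹ by rw [← ha2]; ring, zpow_ofNat]
      field_simp)
  have hbase : (fun p => y₂ (polar p) - y₁ (polar p)) =O[l]
      fun p => b * polar p ^ k * (y₂ (polar p) - y₁ (polar p)) := by
    refine IsBigO.of_bound ‖b‖⁻¹ ?_
    filter_upwards [hx.eventually_ge_atTop 1] with p hp
    rw [norm_mul, norm_mul, norm_pow, ← mul_assoc, ← mul_assoc,
      inv_mul_cancel₀ (norm_ne_zero_iff.2 hb), one_mul]
    exact le_mul_of_one_le_left (norm_nonneg _) (one_le_pow₀ hp)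
  have hYrel := h1.add_isBigO (f' := fun p => q₂ (polar p) - q₁ (polar p))
    (isBigO_zpow_neg_two_mul hx _ h2n ((h.isBigO hx).trans hbase))
  have hY : Rel l polar (fun p => stepY n β y₂ q₂ (polar p) - stepY n β y₁ q₁ (polar p)) _ :=
    hYrel.congr_left (by
      filter_upwards [hR₁.eventually_ne hx ha, hR₂.eventually_ne hx ha] with p h1 h2
      exact (stepY_sub h1 h2).symm)
  refine ⟨hY, ?_⟩
  have h3 := (isBigO_zpow_neg_two_mul hx _ h2n (hR.isBigO hx)).neg_left
  have h4 : (fun p => polar p ^ (-2 : ℤ) * (2 / (n + 1 : ℂ) * polar p ^ 2 *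
      (b * polar p ^ k * (y₂ (polar p) - y₁ (polar p))))) =O[l] fun p => polar p ^ (-2 : ℤ) *
        (stepY n β y₂ q₂ (polar p) - stepY n β y₁ q₁ (polar p)) :=
    (isBigO_refl _ l).mul ((hY.symm hx).isBigO hx)
  exact (h3.trans h4).congr_left fun p => stepQ_add_stepY.symm

/-- Here `1/(q₁q₂) = O(x⁻²)`, so the first half of the step leaves the difference unchanged to
leading order (`b = 1`, `k = 0`) and all growth comes from the second half. -/
lemma decaying_sub_step (hx : Tendsto (fun p => ‖polar p‖) l atTop)
    (hq₁ : Lead l polar (fun p => q₁ (polar p)) (-2) 1)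
    (hq₂ : Lead l polar (fun p => q₂ (polar p)) (-2) 1)
    (hR₁ : Lead l polar (fun p => stepR n β y₁ q₁ (polar p)) (-(n + 1)) (-1))
    (hR₂ : Lead l polar (fun p => stepR n β y₂ q₂ (polar p)) (-(n + 1)) (-1))
    (h : Locked l y₁ q₁ y₂ q₂) :
    Rel l polar (fun p => stepY n β y₂ q₂ (polar p) - stepY n β y₁ q₁ (polar p))
      (fun p => 2 / (n + 1) * polar p ^ 2 * (1 * polar p ^ 0 * (y₂ (polar p) - y₁ (polar p)))) ∧
    Locked l (stepY n β y₁ q₁) (stepQ n β y₁ q₁) (stepY n β y₂ q₂) (stepQ n β y₂ q₂) := by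
  have hn : (n + 1 : ℂ) ≠ 0 := by exact_mod_cast n.succ_ne_zero
  refine stepY_sub_rel hx (neg_ne_zero.2 hn) (by ring) one_ne_zero hR₁ hR₂ h ?_
  have hqq : PowO l polar (fun p => (q₁ (polar p))⁻¹ * (q₂ (polar p))⁻¹) (-2) :=
    ((hq₁.inv hx (by norm_num)).mul hx (hq₂.inv hx (by norm_num))).powO hx
  have h1 : (fun p => (β - 2 - 2 * n) * ((q₂ (polar p) - q₁ (polar p)) *
      ((q₁ (polar p))⁻¹ * (q₂ (polar p))⁻¹))) =O[l]
      fun p => polar p ^ (-2 : ℤ) * (y₂ (polar p) - y₁ (polar p)) :=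
    (((h.isBigO hx).mul hqq).const_mul_left (β - 2 - 2 * n)).congr_right fun p => by ring
  have := ((Rel.refl (x := polar) (l := l) fun p => y₂ (polar p) - y₁ (polar p)).add_isBigO h1)
  refine this.congr ?_ (Eventually.of_forall fun p => by simp)
  filter_upwards [hq₁.eventually_ne hx (by norm_num), hq₂.eventually_ne hx (by norm_num)]
    with p h1 h2
  rw [stepR_sub h1 h2, add_comm]

/-- Here `1/(q₁q₂) ~ x²/κ²`, while `β - 2 - 2n = -2κ` and `Δq ~ -Δy`. Hence `ΔR ~ (2/κ)x²Δy`, with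
`Δy` itself negligible: both halves of the step gain `x²`. -/
lemma growing_sub_step (hx : Tendsto (fun p => ‖polar p‖) l atTop) {κ : ℂ} (hκ : κ ≠ 0)
    (hκn : κ = n + 1 - β / 2)
    (hq₁ : Lead l polar (fun p => q₁ (polar p)) κ (-1))
    (hq₂ : Lead l polar (fun p => q₂ (polar p)) κ (-1))
    (hR₁ : Lead l polar (fun p => stepR n β y₁ q₁ (polar p)) (n + 1) (-1))
    (hR₂ : Lead l polar (fun p => stepR n β y₂ q₂ (polar p)) (n + 1) (-1))
    (h : Locked l y₁ q₁ y₂ q₂) :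
    Rel l polar (fun p => stepY n β y₂ q₂ (polar p) - stepY n β y₁ q₁ (polar p))
      (fun p => 2 / (n + 1) * polar p ^ 2 *
        (2 / κ * polar p ^ 2 * (y₂ (polar p) - y₁ (polar p)))) ∧
    Locked l (stepY n β y₁ q₁) (stepQ n β y₁ q₁) (stepY n β y₂ q₂) (stepQ n β y₂ q₂) := by
  have hn : (n + 1 : ℂ) ≠ 0 := by exact_mod_cast n.succ_ne_zero
  have h2κ : 2 / κ ≠ 0 := div_ne_zero two_ne_zero hκ
  refine stepY_sub_rel hx hn rfl h2κ hR₁ hR₂ h ?_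
  have hqq := ((hq₁.inv hx hκ).mul hx (hq₂.inv hx hκ)).rel hx
    (mul_ne_zero (inv_ne_zero hκ) (inv_ne_zero hκ))
  have h1 : Rel l polar _ (fun p => 2 / κ * polar p ^ 2 * (y₂ (polar p) - y₁ (polar p))) :=
    ((h.rel.mul hx hqq).const_mul (β - 2 - 2 * n)).congr_right (Eventually.of_forall fun p => by
      simp only [Int.reduceNeg, neg_neg, Int.reduceAdd]
      rw [show β - 2 - 2 * n = -2 * κ by rw [hκn]; ring, zpow_ofNat]
      field_simp)
  refine (h1.add_isBigO (isBigO_zpow_neg_two_mul hx _ h2κ (isBigO_refl _ l))).congr_left ?_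
  filter_upwards [hq₁.eventually_ne hx hκ, hq₂.eventually_ne hx hκ] with p h1 h2
  rw [stepR_sub h1 h2]

variable {θ₀ w : ℝ} {u₁ u₂ : ℂ → ℂ}

lemma Locked.congr {Y₁ Q₁ Y₂ Q₂ : ℂ → ℂ} (h : Locked l y₁ q₁ y₂ q₂)
    (e : ∀ᶠ p in l, Y₁ (polar p) = y₁ (polar p) ∧ Q₁ (polar p) = q₁ (polar p) ∧
      Y₂ (polar p) = y₂ (polar p) ∧ Q₂ (polar p) = q₂ (polar p)) : Locked l Y₁ Q₁ Y₂ Q₂ := by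
  refine IsBigO.congr' h ?_ ?_
  all_goals
    filter_upwards [e] with p ⟨h1, h2, h3, h4⟩
    simp only [h1, h2, h3, h4]

/-- Growth of the difference of two solutions with `y ~ -β/(2x)` along the ladder. -/
lemma ladder_sub_decaying (hβ : ∀ m : ℤ, β / 2 ≠ m)
    (h₁ : LeadPair 0 β (ladder β u₁ 0) (ladderQ β u₁ 0) θ₀ w (-(β / 2)) (-1) (-2) 1)
    (h₂ : LeadPair 0 β (ladder β u₂ 0) (ladderQ β u₂ 0) θ₀ w (-(β / 2)) (-1) (-2) 1)
    {δ : ℝ} (hδ : 0 < δ)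
    (h : Locked (sector θ₀ w δ) (ladder β u₁ 0) (ladderQ β u₁ 0) (ladder β u₂ 0) (ladderQ β u₂ 0))
    (n : ℕ) :
    Rel (sector θ₀ w δ) polar (fun p => ladder β u₂ n (polar p) - ladder β u₁ n (polar p))
      (fun p => 2 ^ n / n.factorial * polar p ^ (2 * n) * (u₂ (polar p) - u₁ (polar p))) ∧
    Locked (sector θ₀ w δ) (ladder β u₁ n) (ladderQ β u₁ n) (ladder β u₂ n) (ladderQ β u₂ n) := by
  induction n with
  | zero => exact ⟨by simpa [ladder] using Rel.refl _, h⟩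
  | succ n ih =>
    have hx := tendsto_norm_polar (θ₀ := θ₀) (w := w) (δ := δ)
    obtain ⟨ih1, ih2⟩ := ih
    obtain ⟨a₁, b₁⟩ := ladder_decaying hβ h₁ n
    obtain ⟨a₂, b₂⟩ := ladder_decaying hβ h₂ n
    obtain ⟨c1, c2⟩ := decaying_sub_step hx (a₁.lead_q δ hδ) (a₂.lead_q δ hδ)
      (a₁.decaying_step.2.2 δ hδ) (a₂.decaying_step.2.2 δ hδ) ih2
    constructor
    · have e := c1.trans hx (((Rel.refl (x := polar)
        fun p => 2 / (n + 1) * polar p ^ 2).mul hx ih1).congr_left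
        (Eventually.of_forall fun p => by ring))
      refine e.congr ?_ (Eventually.of_forall fun p => ?_)
      · filter_upwards [b₁ δ hδ, b₂ δ hδ] with p e1 e2
        rw [e1.y_eq, e2.y_eq]
      · have hn : (n + 1 : ℂ) ≠ 0 := by exact_mod_cast n.succ_ne_zero
        have hf : (n.factorial : ℂ) ≠ 0 := by exact_mod_cast n.factorial_ne_zero
        rw [Nat.factorial_succ]
        push_cast
        field_simp
        ring
    · refine c2.congr ?_
      filter_upwards [b₁ δ hδ, b₂ δ hδ] with p e1 e2
      exact ⟨e1.y_eq, e1.q_eq, e2.y_eq, e2.q_eq⟩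

/-- Growth of the difference of two solutions with `y ~ -2x` along the ladder. -/
lemma ladder_sub_growing (hβ : ∀ m : ℤ, β / 2 ≠ m)
    (h₁ : LeadPair 0 β (ladder β u₁ 0) (ladderQ β u₁ 0) θ₀ w (-2) 1 (1 - β / 2) (-1))
    (h₂ : LeadPair 0 β (ladder β u₂ 0) (ladderQ β u₂ 0) θ₀ w (-2) 1 (1 - β / 2) (-1))
    {δ : ℝ} (hδ : 0 < δ)
    (h : Locked (sector θ₀ w δ) (ladder β u₁ 0) (ladderQ β u₁ 0) (ladder β u₂ 0) (ladderQ β u₂ 0))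
    (n : ℕ) :
    Rel (sector θ₀ w δ) polar (fun p => ladder β u₂ n (polar p) - ladder β u₁ n (polar p))
      (fun p => 4 ^ n * Gamma (1 - β / 2) / (n.factorial * Gamma (n + 1 - β / 2)) *
        polar p ^ (4 * n) * (u₂ (polar p) - u₁ (polar p))) ∧
    Locked (sector θ₀ w δ) (ladder β u₁ n) (ladderQ β u₁ n) (ladder β u₂ n) (ladderQ β u₂ n) := by
  have hκ : ∀ n : ℕ, (n + 1 - β / 2 : ℂ) ≠ 0 := fun n h0 =>
    hβ (n + 1) (by push_cast; linear_combination -h0)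
  have hΓ : ∀ n : ℕ, Gamma (n + 1 - β / 2) ≠ 0 := fun n => Gamma_ne_zero fun m h0 =>
    hβ (n + 1 + m) (by push_cast; linear_combination -h0)
  induction n with
  | zero =>
    have := hΓ 0
    simp only [CharP.cast_eq_zero, zero_add] at this
    exact ⟨by simpa [ladder, this] using Rel.refl _, h⟩
  | succ n ih =>
    have hx := tendsto_norm_polar (θ₀ := θ₀) (w := w) (δ := δ)
    obtain ⟨ih1, ih2⟩ := ih
    obtain ⟨a₁, b₁⟩ := ladder_growing hβ h₁ n
    obtain ⟨a₂, b₂⟩ := ladder_growing hβ h₂ n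
    obtain ⟨c1, c2⟩ := growing_sub_step hx (hκ n) rfl (a₁.lead_q δ hδ) (a₂.lead_q δ hδ)
      (a₁.growing_stepR hβ hδ) (a₂.growing_stepR hβ hδ) ih2
    constructor
    · have e := c1.trans hx (((Rel.refl (x := polar)
        fun p => 2 / (n + 1) * polar p ^ 2 * (2 / (n + 1 - β / 2) * polar p ^ 2)).mul hx
        ih1).congr_left (Eventually.of_forall fun p => by ring))
      refine e.congr ?_ (Eventually.of_forall fun p => ?_)
      · filter_upwards [b₁ δ hδ, b₂ δ hδ] with p e1 e2
        rw [e1.y_eq, e2.y_eq]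
      · have hn : (n + 1 : ℂ) ≠ 0 := by exact_mod_cast n.succ_ne_zero
        have hf : (n.factorial : ℂ) ≠ 0 := by exact_mod_cast n.factorial_ne_zero
        -- The factors `n+1-β/2` collected along the ladder telescope to a quotient of Gamma values.
        have hG : Gamma ((n + 1 : ℕ) + 1 - β / 2) = (n + 1 - β / 2) * Gamma (n + 1 - β / 2) := by
          rw [← Gamma_add_one _ (hκ n)]
          congr 1
          push_cast
          ring
        have h1 := hκ n
        have h2 := hΓ n
        rw [Nat.factorial_succ, hG]
        push_cast
        set κ := (n + 1 - β / 2 : ℂ)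
        field_simp
        ring
    · refine c2.congr ?_
      filter_upwards [b₁ δ hδ, b₂ δ hδ] with p e1 e2
      exact ⟨e1.y_eq, e1.q_eq, e2.y_eq, e2.q_eq⟩

end Differences

end P4

end

noncomputable section

open Topology Asymptotics Set MeasureTheory

namespace P4

/-! ### The integrals `∫₀^∞ t^{s-1} e^{-b t² - c t} dt` -/

/-- The integrand `t^{s-1} e^{-b t² - c t}`. -/
def cylKernel (s b c : ℂ) (t : ℝ) : ℂ := (t : ℂ) ^ (s - 1) * exp (-(b * t ^ 2) - c * t)

/-- `∫₀^∞ t^{s-1} e^{-b t² - c t} dt` -/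
def cylInt (s b c : ℂ) : ℂ := ∫ t in Ioi (0 : ℝ), cylKernel s b c t

/-- The condition for convergence at infinity. -/
def Decays (B γ : ℝ) : Prop := 0 < B ∨ (0 ≤ B ∧ 0 < γ)

lemma integrableOn_rpow_mul_exp_quadratic {σ B γ : ℝ} (hσ : 0 < σ) (h : Decays B γ) :
    IntegrableOn (fun t : ℝ => t ^ (σ - 1) * Real.exp (-(B * t ^ 2) - γ * t)) (Ioi 0) := by
  have hm : AEStronglyMeasurable (fun t : ℝ => t ^ (σ - 1) * Real.exp (-(B * t ^ 2) - γ * t))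
      (volume.restrict (Ioi 0)) := by
    refine ContinuousOn.aestronglyMeasurable (fun t ht => ?_) measurableSet_Ioi
    exact ((Real.continuousAt_rpow_const t _ (Or.inl (ne_of_gt ht))).mul
      (by fun_prop)).continuousWithinAt
  rcases h with hB | ⟨hB, hγ⟩
  · have h1 := (integrableOn_rpow_mul_exp_neg_mul_sq (half_pos hB)
      (show -1 < σ - 1 by linarith)).const_mul (Real.exp (γ ^ 2 / (2 * B)))
    refine Integrable.mono' h1 hm ?_
    filter_upwards [ae_restrict_mem measurableSet_Ioi] with t ht
    have ht0 : 0 < t := ht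
    rw [Real.norm_of_nonneg (by positivity), mul_left_comm]
    refine mul_le_mul_of_nonneg_left ?_ (by positivity)
    rw [← Real.exp_add, Real.exp_le_exp]
    -- Completing the square: half of the Gaussian is spent on absorbing `e^{-γt}`, whatever the
    -- sign of `γ`.
    have : γ ^ 2 / (2 * B) + -(B / 2) * t ^ 2 - (-(B * t ^ 2) - γ * t)
        = B / 2 * (t + γ / B) ^ 2 := by field_simp; ring
    have h2 : 0 ≤ B / 2 * (t + γ / B) ^ 2 := by positivity
    linarith
  · have h1 := integrableOn_rpow_mul_exp_neg_mul_rpow (show -1 < σ - 1 by linarith) one_pos hγ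
    refine Integrable.mono' h1 hm ?_
    filter_upwards [ae_restrict_mem measurableSet_Ioi] with t ht
    have ht0 : 0 < t := ht
    rw [Real.norm_of_nonneg (by positivity)]
    refine mul_le_mul_of_nonneg_left ?_ (by positivity)
    rw [Real.exp_le_exp, Real.rpow_one]
    nlinarith [mul_nonneg hB (sq_nonneg t)]

variable {s b c : ℂ}

lemma norm_cylKernel {t : ℝ} (ht : 0 < t) :
    ‖cylKernel s b c t‖ = t ^ (s.re - 1) * Real.exp (-(b.re * t ^ 2) - c.re * t) := by
  rw [cylKernel, norm_mul, norm_cpow_eq_rpow_re_of_pos ht, norm_exp, ← ofReal_pow, sub_re, one_re,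
    sub_re, neg_re, re_mul_ofReal, re_mul_ofReal]

lemma continuousOn_cylKernel : ContinuousOn (cylKernel s b c) (Ioi 0) := fun t ht =>
  ((Complex.continuousAt_ofReal_cpow_const t _ (Or.inr (ne_of_gt ht))).mul
    (by fun_prop)).continuousWithinAt

lemma aestronglyMeasurable_cylKernel :
    AEStronglyMeasurable (cylKernel s b c) (volume.restrict (Ioi 0)) :=
  continuousOn_cylKernel.aestronglyMeasurable measurableSet_Ioi

lemma integrableOn_cylKernel (hs : 0 < s.re) (h : Decays b.re c.re) :
    IntegrableOn (cylKernel s b c) (Ioi 0) := by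
  refine Integrable.mono' (integrableOn_rpow_mul_exp_quadratic hs h)
    aestronglyMeasurable_cylKernel ?_
  filter_upwards [ae_restrict_mem measurableSet_Ioi] with t ht
  exact (norm_cylKernel ht).le

lemma cylKernel_add_one {t : ℝ} (ht : 0 < t) :
    cylKernel (s + 1) b c t = t * cylKernel s b c t := by
  have : (t : ℂ) ≠ 0 := by exact_mod_cast ht.ne'
  rw [cylKernel, cylKernel, show s + 1 - 1 = (s - 1) + 1 by ring, cpow_add _ _ this, cpow_one]
  ring

lemma hasDerivAt_cylInt (hs : 0 < s.re) (h : Decays b.re c.re) :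
    HasDerivAt (cylInt s b) (-cylInt (s + 1) b c) c := by
  -- Room for a majorant valid on a disc about `c`: any radius if the Gaussian decays, otherwise
  -- half of `Re c`.
  obtain ⟨ε, hε, hd⟩ : ∃ ε > 0, Decays b.re (c.re - ε) := by
    rcases h with h | ⟨h, hc⟩
    · exact ⟨1, one_pos, Or.inl h⟩
    · exact ⟨c.re / 2, half_pos hc, Or.inr ⟨h, by linarith⟩⟩
  have hs1 : 0 < (s + 1).re := by simpa using by linarith
  have key := hasDerivAt_integral_of_dominated_loc_of_deriv_le (μ := volume.restrict (Ioi (0 : ℝ)))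
    (F := fun c t => cylKernel s b c t) (F' := fun c t => -cylKernel (s + 1) b c t) (x₀ := c)
    (bound := fun t => t ^ ((s + 1).re - 1) * Real.exp (-(b.re * t ^ 2) - (c.re - ε) * t))
    (Metric.ball_mem_nhds c hε)
    (Eventually.of_forall fun _ => aestronglyMeasurable_cylKernel)
    (integrableOn_cylKernel hs h)
    aestronglyMeasurable_cylKernel.neg ?_
    (integrableOn_rpow_mul_exp_quadratic hs1 hd) ?_
  · have := key.2
    rw [integral_neg] at this
    exact this
  · filter_upwards [ae_restrict_mem measurableSet_Ioi] with t ht c' hc'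
    have ht0 : 0 < t := ht
    rw [norm_neg, norm_cylKernel ht]
    refine mul_le_mul_of_nonneg_left ?_ (by positivity)
    rw [Real.exp_le_exp]
    have h1 : |c'.re - c.re| < ε := by
      refine (Complex.abs_re_le_norm (c' - c)).trans_lt ?_
      rwa [← dist_eq_norm]
    have := (abs_lt.1 h1).1
    nlinarith
  · filter_upwards [ae_restrict_mem measurableSet_Ioi] with t ht c' _
    rw [cylKernel_add_one ht]
    have := (((hasDerivAt_id c').mul_const (t : ℂ)).const_sub (-(b * t ^ 2))).cexp.const_mul
      ((t : ℂ) ^ (s - 1))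
    refine this.congr_deriv ?_
    simp only [cylKernel, id]
    ring

/-- Integration by parts. -/
lemma mul_cylInt (hs : 0 < s.re) (h : Decays b.re c.re) :
    s * cylInt s b c = 2 * b * cylInt (s + 2) b c + c * cylInt (s + 1) b c := by
  have hs1 : 0 < (s + 1).re := by simpa using by linarith
  have hs2 : 0 < (s + 2).re := by simpa using by linarith
  have hs0 : s ≠ 0 := fun h0 => by simp [h0] at hs
  have i0 := (integrableOn_cylKernel hs h).const_mul s
  have i1 := (integrableOn_cylKernel hs1 h).const_mul c
  have i2 := (integrableOn_cylKernel hs2 h).const_mul (2 * b)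
  have hd : ∀ t ∈ Ioi (0 : ℝ), HasDerivAt (cylKernel (s + 1) b c)
      (s * cylKernel s b c t - 2 * b * cylKernel (s + 2) b c t - c * cylKernel (s + 1) b c t) t := by
    intro t ht
    have ht0 : (t : ℂ) ≠ 0 := by exact_mod_cast (ne_of_gt ht)
    have h1 : HasDerivAt (fun t : ℝ => (t : ℂ)) 1 t := ofRealCLM.hasDerivAt
    have h2 := (((h1.pow 2).const_mul b).neg.sub (h1.const_mul c)).cexp
    have h3 := (hasDerivAt_ofReal_cpow_const (ne_of_gt ht) hs0).mul h2
    have e : cylKernel (s + 1) b c = fun t : ℝ => (t : ℂ) ^ s * exp (-(b * t ^ 2) - c * t) := by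
      funext t
      rw [cylKernel, add_sub_cancel_right]
    rw [e]
    refine h3.congr_deriv ?_
    rw [show s + 2 = s + 1 + 1 by ring, cylKernel_add_one ht, cylKernel_add_one ht, cylKernel]
    have : (t : ℂ) ^ s = t ^ (s - 1) * t := by
      rw [cpow_sub _ _ ht0, cpow_one]; field_simp
    simp only [Pi.sub_apply, Pi.neg_apply, Pi.pow_apply]
    rw [this]
    push_cast
    ring
  have hi := (i0.sub i2).sub i1
  have hz := tendsto_zero_of_hasDerivAt_of_integrableOn_Ioi hd hi (integrableOn_cylKernel hs1 h)
  have hc : ContinuousWithinAt (cylKernel (s + 1) b c) (Ici 0) 0 :=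
    ((Complex.continuousAt_ofReal_cpow_const 0 _ (Or.inl (by simpa using hs))).mul
      (by fun_prop)).continuousWithinAt
  have := integral_Ioi_of_hasDerivAt_of_tendsto hc hd hi hz
  have e := integral_sub (i0.sub i2) i1
  simp only [Pi.sub_apply] at e
  rw [e, integral_sub i0 i2, integral_const_mul, integral_const_mul,
    integral_const_mul] at this
  have h0 : cylKernel (s + 1) b c 0 = 0 := by simp [cylKernel, hs0]
  rw [h0] at this
  simp only [cylInt]
  linear_combination this

/-- The Laplace transform of a power. -/
lemma cylInt_zero_left (hs : 0 < s.re) (hc : 0 < c.re) : cylInt s 0 c = c ^ (-s) * Gamma s := by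
  have hD : ∀ c : ℂ, 0 < c.re → Decays (0 : ℂ).re c.re := fun c hc => Or.inr ⟨by simp, hc⟩
  have hslit : ∀ c : ℂ, 0 < c.re → c ∈ slitPlane := fun c hc => Or.inl hc
  -- Integration by parts with `b = 0` makes `c^s` times the integral locally constant on the half
  -- plane, and at `c = 1` it is Euler's integral for `Γ(s)`.
  have hd : ∀ c ∈ {c : ℂ | 0 < c.re}, HasDerivAt (fun c => c ^ s * cylInt s 0 c) 0 c := by
    intro c hc
    have h1 := ((hasDerivAt_id c).cpow_const (c := s) (hslit c hc)).mul
      (hasDerivAt_cylInt hs (hD c hc))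
    refine h1.congr_deriv ?_
    have h2 := mul_cylInt (b := 0) hs (hD c hc)
    have hc0 : c ≠ 0 := slitPlane_ne_zero (hslit c hc)
    have h3 : c ^ s = c ^ (s - 1) * c := by
      rw [cpow_sub _ _ hc0, cpow_one]; field_simp
    simp only [id, h3]
    linear_combination c ^ (s - 1) * h2
  have hop : IsOpen {c : ℂ | 0 < c.re} := isOpen_lt continuous_const continuous_re
  have hcv : Convex ℝ {c : ℂ | 0 < c.re} := convex_halfSpace_re_gt 0
  have h1 := hop.is_const_of_deriv_eq_zero hcv.isPreconnected
    (fun c hc => (hd c hc).differentiableAt.differentiableWithinAt)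
    (fun c hc => (hd c hc).deriv) (x := c) (y := 1) hc (by simp)
  have h2 : cylInt s 0 1 = Gamma s := by
    rw [Gamma_eq_integral hs, GammaIntegral, cylInt]
    refine setIntegral_congr_fun measurableSet_Ioi fun t _ => ?_
    simp only [cylKernel]
    push_cast
    ring_nf
  simp only [one_cpow, one_mul, h2] at h1
  rw [← h1, ← mul_assoc, ← cpow_add _ _ (slitPlane_ne_zero (hslit c hc))]
  simp

/-- The Gaussian moments. -/
lemma cylInt_zero_right (hs : 0 < s.re) (hb : 0 < b.re) :
    cylInt s b 0 = 1 / 2 * (b ^ (-(s / 2)) * Gamma (s / 2)) := by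
  have h2 : 0 < (s / 2).re := by simpa using hs
  -- The substitution `t ↦ t²` reduces the Gaussian moment to the Laplace transform of a power.
  rw [← cylInt_zero_left h2 hb, cylInt, cylInt,
    ← integral_comp_rpow_Ioi (fun t => cylKernel (s / 2) 0 b t) two_ne_zero, ← integral_const_mul]
  refine setIntegral_congr_fun measurableSet_Ioi fun t ht => ?_
  have ht0 : 0 < t := ht
  have ht1 : (t : ℂ) ≠ 0 := by exact_mod_cast ht0.ne'
  simp only [cylKernel, real_smul]
  rw [show (2 : ℝ) - 1 = 1 by norm_num, Real.rpow_one, Real.rpow_two, sq t, ofReal_mul, ofReal_mul,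
    mul_cpow_ofReal_nonneg ht0.le ht0.le, ← cpow_add _ _ ht1,
    show (s / 2 - 1) + (s / 2 - 1) = s - 1 - 1 by ring, cpow_sub (s - 1) 1 ht1, cpow_one]
  rw [abs_of_pos two_pos, ofReal_ofNat]
  field_simp
  ring_nf

/-- Mean value inequality on the right half plane, where the derivative of `e^{-z}` has modulus at
most one. -/
lemma norm_exp_neg_sub_one_le {ζ : ℂ} (h : 0 ≤ ζ.re) : ‖exp (-ζ) - 1‖ ≤ ‖ζ‖ := by
  have := Convex.norm_image_sub_le_of_norm_hasDerivWithin_le (𝕜 := ℂ) (f := fun z => exp (-z))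
    (f' := fun z => exp (-z) * -1) (s := {z : ℂ | 0 ≤ z.re}) (x := 0) (y := ζ) (C := 1)
    (fun z _ => ((hasDerivAt_id z).neg.cexp).hasDerivWithinAt)
    (fun z hz => by
      have hz' : 0 ≤ z.re := hz
      rw [mul_neg_one, norm_neg, norm_exp]; simpa using hz')
    (convex_halfSpace_re_ge 0) (by simp) h
  simpa using this

/-- Watson's lemma for the parabolic cylinder integral. -/
lemma norm_cylInt_sub_le (hs : 0 < s.re) (hb : 0 ≤ b.re) (hc : 0 < c.re) :
    ‖cylInt s b c - Gamma s * c ^ (-s)‖ ≤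
      ‖b‖ * (Real.Gamma (s.re + 2) * c.re ^ (-(s.re + 2))) := by
  have h0 := integrableOn_cylKernel (b := 0) (c := c) hs (Or.inr ⟨by simp, hc⟩)
  have hb' := integrableOn_cylKernel (b := b) hs (Or.inr ⟨hb, hc⟩)
  rw [mul_comm (Gamma s), ← cylInt_zero_left hs hc, cylInt, cylInt, ← integral_sub hb' h0]
  have hr := integrableOn_rpow_mul_exp_quadratic (σ := s.re + 2) (B := 0) (γ := c.re) (by linarith)
    (Or.inr ⟨le_rfl, hc⟩)
  have e : ∫ t in Ioi (0 : ℝ), t ^ (s.re + 2 - 1) * Real.exp (-(0 * t ^ 2) - c.re * t) =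
      Real.Gamma (s.re + 2) * c.re ^ (-(s.re + 2)) := by
    rw [mul_comm, Real.rpow_neg hc.le, ← Real.inv_rpow hc.le, ← one_div,
      ← Real.integral_rpow_mul_exp_neg_mul_Ioi (by linarith) hc]
    simp
  rw [← e, ← integral_const_mul]
  refine norm_integral_le_of_norm_le (hr.const_mul ‖b‖) ?_
  filter_upwards [ae_restrict_mem measurableSet_Ioi] with t ht
  have ht0 : 0 < t := ht
  -- Dropping the Gaussian costs `|e^{-bt²} - 1| ≤ |b|t²`, which raises the power of `t` by two:
  -- this is the relative error `O(x⁻²)`.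
  have e1 : cylKernel s b c t - cylKernel s 0 c t =
      cylKernel s 0 c t * (exp (-(b * t ^ 2)) - 1) := by
    simp only [cylKernel]
    rw [sub_eq_add_neg (-(b * (t : ℂ) ^ 2)), Complex.exp_add]
    simp
    ring
  have hre : 0 ≤ (b * (t : ℂ) ^ 2).re := by
    norm_cast
    rw [re_mul_ofReal]
    positivity
  have h3 := norm_exp_neg_sub_one_le hre
  rw [e1, norm_mul, norm_cylKernel ht0]
  calc _ ≤ t ^ (s.re - 1) * Real.exp (-((0 : ℂ).re * t ^ 2) - c.re * t) * ‖b * (t : ℂ) ^ 2‖ := by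
        gcongr
    _ = _ := by
      rw [norm_mul, norm_pow, norm_real, Real.norm_of_nonneg ht0.le,
        show s.re + 2 - 1 = (s.re - 1) + 2 by ring, Real.rpow_add ht0, Real.rpow_two, zero_re]
      ring

end P4

end

noncomputable section

open Topology Asymptotics Set MeasureTheory

namespace P4

/-! ### Powers in polar coordinates -/

lemma bpow_add (r θ : ℝ) (a b : ℂ) : bpow r θ (a + b) = bpow r θ a * bpow r θ b := by
  simp only [bpow, ← Complex.exp_add]
  ring_nf

lemma bpow_zero (r θ : ℝ) : bpow r θ 0 = 1 := by simp [bpow]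

lemma bpow_ne_zero (r θ : ℝ) (a : ℂ) : bpow r θ a ≠ 0 := Complex.exp_ne_zero _

lemma bpow_neg (r θ : ℝ) (a : ℂ) : bpow r θ (-a) = (bpow r θ a)⁻¹ := by
  simp only [bpow, ← Complex.exp_neg]
  ring_nf

lemma bpow_one {r : ℝ} (hr : 0 < r) (θ : ℝ) : bpow r θ 1 = pt r θ := by
  rw [bpow, one_mul, Complex.exp_add, ← ofReal_exp, Real.exp_log hr, pt]

lemma bpow_natCast {r : ℝ} (hr : 0 < r) (θ : ℝ) (n : ℕ) : bpow r θ n = pt r θ ^ n := by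
  induction n with
  | zero => simp [bpow_zero]
  | succ n ih => push_cast; rw [bpow_add, ih, bpow_one hr, pow_succ]

lemma bpow_add_angle (r θ φ : ℝ) (a : ℂ) :
    bpow r (θ + φ) a = bpow r θ a * exp (φ * a * I) := by
  simp only [bpow, ← Complex.exp_add]
  push_cast
  ring_nf

lemma norm_bpow {r : ℝ} (hr : 0 < r) (θ : ℝ) (a : ℂ) :
    ‖bpow r θ a‖ = r ^ a.re * Real.exp (-(a.im * θ)) := by
  rw [bpow, norm_exp, Real.rpow_def_of_pos hr, ← Real.exp_add]
  congr 1
  simp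
  ring

lemma pt_cpow {r θ : ℝ} (hr : 0 < r) (h1 : -Real.pi < θ) (h2 : θ ≤ Real.pi) (a : ℂ) :
    pt r θ ^ a = bpow r θ a := by
  have hp : pt r θ ≠ 0 := norm_pos_iff.1 (by rw [norm_pt hr.le]; exact hr)
  have : pt r θ = exp (Real.log r + θ * I) := by
    rw [Complex.exp_add, ← ofReal_exp, Real.exp_log hr, pt]
  rw [cpow_def_of_ne_zero hp, bpow, mul_comm]
  congr 2
  rw [this, log_exp] <;> simpa

lemma pt_add_angle (r θ φ : ℝ) : pt r (θ + φ) = pt r θ * exp (φ * I) := by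
  simp only [pt]
  push_cast
  rw [add_mul, Complex.exp_add]
  ring

lemma pt_re (r θ : ℝ) : (pt r θ).re = r * Real.cos θ := by
  rw [pt, re_ofReal_mul, exp_ofReal_mul_I_re]

/-! ### Parabolic cylinder functions -/

/-- `z = K x^{-s} (1 + O(x⁻²))` together with the derivative, for `K ≠ 0`; the condition is linear
in `(z, K)`. -/
structure AlgAsymp (s : ℂ) (z z' : ℂ → ℂ) (K : ℂ) (θ₀ w : ℝ) : Prop where
  lead : ∀ δ > 0, Lead (sector θ₀ w δ) polar (fun p => bpow p.1 p.2 s * z (polar p)) K 0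
  lead' : ∀ δ > 0, Lead (sector θ₀ w δ) polar (fun p => bpow p.1 p.2 s * z' (polar p)) (-s * K) (-1)

/-- The solution `F` of `F'' = 2wF' + 2sF` that is `Γ(s) w^{-s}` in a sector of opening `3π/2`. -/
structure IsCylinder (s : ℂ) (F F' : ℂ → ℂ) : Prop where
  hasDerivAt : ∀ w, HasDerivAt F (F' w) w
  hasDerivAt' : ∀ w, HasDerivAt F' (2 * w * F' w + 2 * s * F w) w
  at_zero : F 0 = 2 ^ (s - 1) * Gamma (s / 2)
  at_zero' : F' 0 = -(2 ^ s * Gamma ((s + 1) / 2))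
  asymp : AlgAsymp s F F' (Gamma s) 0 (3 * Real.pi / 4)

/-- Uniqueness for the initial value problem. -/
lemma eq_of_initial {p q : ℂ} {F F' G G' : ℂ → ℂ}
    (hF : ∀ w, HasDerivAt F (F' w) w)
    (hF' : ∀ w, HasDerivAt F' (p * w * F' w + q * F w) w)
    (hG : ∀ w, HasDerivAt G (G' w) w)
    (hG' : ∀ w, HasDerivAt G' (p * w * G' w + q * G w) w)
    (h0 : F 0 = G 0) (h0' : F' 0 = G' 0) : F = G := by
  have hD : Differentiable ℂ (F - G) := fun w => ((hF w).sub (hG w)).differentiableAt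
  have hit : ∀ n, ∀ w, HasDerivAt (iteratedDeriv n (F - G)) (iteratedDeriv (n + 1) (F - G) w) w :=
    fun n w => by
      rw [iteratedDeriv_succ]
      exact ((hD.contDiff (n := ⊤)).differentiable_iteratedDeriv n (by simp) w).hasDerivAt
  have e1 : iteratedDeriv 1 (F - G) = F' - G' := by
    rw [iteratedDeriv_one]
    exact funext fun w => ((hF w).sub (hG w)).deriv
  -- Differentiating the equation `n` times gives a two-term recursion for the derivatives, so all
  -- Taylor coefficients of the entire difference at `0` vanish.
  have hrec : ∀ n : ℕ, ∀ w, iteratedDeriv (n + 2) (F - G) w =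
      p * w * iteratedDeriv (n + 1) (F - G) w + (q + n * p) * iteratedDeriv n (F - G) w := by
    intro n
    induction n with
    | zero =>
      intro w
      have := hit 1 w
      rw [e1] at this
      rw [zero_add, zero_add, e1, this.unique ((hF' w).sub (hG' w))]
      simp only [iteratedDeriv_zero, Pi.sub_apply]
      push_cast
      ring
    | succ n ih =>
      intro w
      have h1 := hit (n + 2) w
      rw [funext ih] at h1
      have h2 := (((hasDerivAt_id w).const_mul p).mul (hit (n + 1) w)).add
        ((hit n w).const_mul (q + n * p))
      rw [show n + 1 + 2 = n + 2 + 1 by ring, h1.unique h2]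
      simp only [id]
      push_cast
      ring
  have hz : ∀ n : ℕ, iteratedDeriv n (F - G) 0 = 0 ∧ iteratedDeriv (n + 1) (F - G) 0 = 0 := by
    intro n
    induction n with
    | zero => exact ⟨by simp [h0], by rw [zero_add, e1]; simp [h0']⟩
    | succ n ih => exact ⟨ih.2, by rw [hrec, ih.1, ih.2]; simp⟩
  funext w
  have := (Complex.hasSum_taylorSeries_of_entire hD 0 w)
  simp only [(hz _).1, smul_zero] at this
  have h1 := this.unique hasSum_zero
  exact sub_eq_zero.1 h1

/-- The cylinder integral along the ray of direction `e^{iφ}`. -/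
def rotInt (φ : ℝ) (s w : ℂ) : ℂ :=
  exp (φ * s * I) * cylInt s (exp (φ * I) ^ 2 / 4) (exp (φ * I) * w)

lemma re_exp_sq_div_four {φ : ℝ} (hφ : |φ| < Real.pi / 4) : 0 < (exp (φ * I) ^ 2 / 4).re := by
  rw [← Complex.exp_nat_mul]
  have : exp ((2 : ℕ) * (φ * I)) / 4 = ((1 / 4 : ℝ) : ℂ) * exp ((2 * φ : ℝ) * I) := by
    push_cast; ring_nf
  rw [this, re_ofReal_mul, exp_ofReal_mul_I_re]
  have h := abs_lt.1 hφ
  have := Real.cos_pos_of_mem_Ioo (x := 2 * φ) ⟨by linarith [h.1], by linarith [h.2]⟩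
  positivity

variable {φ : ℝ} {s : ℂ}

lemma hasDerivAt_rotInt (hφ : |φ| < Real.pi / 4) (hs : 0 < s.re) (w : ℂ) :
    HasDerivAt (rotInt φ s) (-rotInt φ (s + 1) w) w := by
  have h1 : HasDerivAt (fun w => exp (φ * I) * w) (exp (φ * I)) w := by
    simpa using (hasDerivAt_id w).const_mul (exp (φ * I))
  have := ((hasDerivAt_cylInt (b := exp (φ * I) ^ 2 / 4) (c := exp (φ * I) * w) hs
    (Or.inl (re_exp_sq_div_four hφ))).comp w h1).const_mul (exp (φ * s * I))
  refine this.congr_deriv ?_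
  rw [rotInt, show (φ : ℂ) * (s + 1) * I = φ * s * I + φ * I by ring, Complex.exp_add]
  ring

lemma rotInt_add_two (hφ : |φ| < Real.pi / 4) (hs : 0 < s.re) (w : ℂ) :
    rotInt φ (s + 2) w = -(2 * w * rotInt φ (s + 1) w) + 2 * s * rotInt φ s w := by
  have := mul_cylInt (b := exp (φ * I) ^ 2 / 4) (c := exp (φ * I) * w) hs
    (Or.inl (re_exp_sq_div_four hφ))
  simp only [rotInt]
  rw [show (φ : ℂ) * (s + 1) * I = φ * s * I + φ * I by ring,
    show (φ : ℂ) * (s + 2) * I = φ * s * I + (φ * I + φ * I) by ring, Complex.exp_add,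
    Complex.exp_add, Complex.exp_add]
  linear_combination (-2 * exp (φ * s * I)) * this

/-- The factor `e^{iφs}` in `rotInt` cancels the power of `e^{iφ}` produced by the Gaussian moment;
`|φ| < π/4` keeps the principal branch valid. The value is thus independent of `φ`. -/
lemma rotInt_zero (hφ : |φ| < Real.pi / 4) (hs : 0 < s.re) :
    rotInt φ s 0 = 2 ^ (s - 1) * Gamma (s / 2) := by
  have h := abs_lt.1 hφ
  have hpi := Real.pi_pos
  have e : exp (φ * I) ^ 2 / 4 = exp ((2 * φ : ℝ) * I - 2 * log 2) := by
    have h2 : exp (2 * log 2) = 4 := by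
      rw [two_mul, Complex.exp_add, Complex.exp_log two_ne_zero]; norm_num
    rw [Complex.exp_sub, h2, ← Complex.exp_nat_mul]
    push_cast
    ring_nf
  have hl : (log (2 : ℂ)).im = 0 := by
    rw [log_im, ← ofReal_ofNat]; exact arg_ofReal_of_nonneg zero_le_two
  rw [rotInt, mul_zero, cylInt_zero_right hs (re_exp_sq_div_four hφ), e,
    cpow_def_of_ne_zero (Complex.exp_ne_zero _), log_exp]
  · rw [cpow_sub _ _ two_ne_zero, cpow_one, cpow_def_of_ne_zero two_ne_zero]
    have : exp (((2 * φ : ℝ) * I - 2 * log 2) * -(s / 2)) =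
        exp (log 2 * s) * exp (-(φ * s * I)) := by
      rw [← Complex.exp_add]; push_cast; ring_nf
    rw [this, Complex.exp_neg]
    have := Complex.exp_ne_zero (φ * s * I)
    field_simp
  · simp [hl]; linarith
  · simp [hl]; linarith

/-- All directions of integration give the same function. -/
lemma rotInt_eq (hφ : |φ| < Real.pi / 4) (hs : 0 < s.re) : rotInt φ s = rotInt 0 s := by
  have h0 : |(0 : ℝ)| < Real.pi / 4 := by simpa using by positivity
  have hs1 : 0 < (s + 1).re := by simpa using by linarith
  have hd : ∀ ψ : ℝ, |ψ| < Real.pi / 4 → ∀ w, HasDerivAt (fun w => -rotInt ψ (s + 1) w)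
      (2 * w * (-rotInt ψ (s + 1) w) + 2 * s * rotInt ψ s w) w := fun ψ hψ w => by
    refine (hasDerivAt_rotInt hψ hs1 w).neg.congr_deriv ?_
    rw [neg_neg, show s + 1 + 1 = s + 2 by ring, rotInt_add_two hψ hs]
    ring
  -- The differential equation and the initial values do not depend on the direction; uniqueness
  -- replaces a rotation of the contour.
  refine eq_of_initial (hasDerivAt_rotInt hφ hs) (hd φ hφ) (hasDerivAt_rotInt h0 hs) (hd 0 h0)
    ?_ ?_
  · rw [rotInt_zero hφ hs, rotInt_zero h0 hs]
  · rw [rotInt_zero hφ hs1, rotInt_zero h0 hs1]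

/-- Integration in direction `e^{iφ}` makes Watson's lemma available where `Re(e^{iφ}x) > 0`, a half
plane centred at `-φ`. In a closed subsector this real part is at least `m|x|`. -/
lemma lead_rotInt (hφ : |φ| < Real.pi / 4) (hs : 0 < s.re) {δ : ℝ} (hδ : 0 < δ) :
    Lead (sector (-φ) (Real.pi / 2) δ) polar (fun p => bpow p.1 p.2 s * rotInt φ s (polar p))
      (Gamma s) 0 := by
  by_cases hδ2 : Real.pi / 2 < δ
  · refine IsBigO.of_bound 1 ?_
    filter_upwards [eventually_mem_sector] with p hp
    exact absurd ((abs_nonneg _).trans hp) (by linarith)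
  have hpi := Real.pi_pos
  set b := exp (φ * I) ^ 2 / 4 with hb
  set M := Real.exp (|s.im| * Real.pi)
  set m := Real.cos (Real.pi / 2 - δ)
  have hm : 0 < m := Real.cos_pos_of_mem_Ioo ⟨by linarith, by linarith⟩
  refine IsBigO.of_bound (M * (‖b‖ * (Real.Gamma (s.re + 2) * m ^ (-(s.re + 2))))) ?_
  filter_upwards [eventually_mem_sector, eventually_pos_sector] with p hp hr
  obtain ⟨r, θ⟩ := p
  simp only [sub_neg_eq_add] at hp hr
  have hc := abs_le.1 hp
  have hcos : m ≤ Real.cos (θ + φ) := by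
    rw [← Real.cos_abs (θ + φ)]
    exact Real.cos_le_cos_of_nonneg_of_le_pi (abs_nonneg _) (by linarith) hp
  have ec : exp (φ * I) * polar (r, θ) = pt r (θ + φ) := by
    rw [pt_add_angle, polar, mul_comm]
  have hre : r * m ≤ (pt r (θ + φ)).re := by
    rw [pt_re]
    exact mul_le_mul_of_nonneg_left hcos hr.le
  have hre0 : 0 < (pt r (θ + φ)).re := (mul_pos hr hm).trans_le hre
  have key := norm_cylInt_sub_le hs (re_exp_sq_div_four hφ).le hre0
  have e : bpow r θ s * rotInt φ s (polar (r, θ)) - Gamma s * polar (r, θ) ^ (0 : ℤ) =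
      bpow r (θ + φ) s * (cylInt s b (pt r (θ + φ)) - Gamma s * pt r (θ + φ) ^ (-s)) := by
    rw [pt_cpow hr (by linarith) (by linarith), bpow_neg, rotInt, ec, ← hb, mul_sub,
      bpow_add_angle r θ φ s]
    have h1 := bpow_ne_zero r θ s
    have h2 := Complex.exp_ne_zero (φ * s * I)
    rw [zpow_zero]
    field_simp
  rw [e, norm_mul, norm_bpow hr]
  have h1 : Real.exp (-(s.im * (θ + φ))) ≤ M := by
    rw [Real.exp_le_exp]
    have h3 : |s.im * (θ + φ)| ≤ |s.im| * Real.pi := by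
      rw [abs_mul]
      exact mul_le_mul_of_nonneg_left (by linarith) (abs_nonneg _)
    linarith [(abs_le.1 h3).1]
  have h2 : (pt r (θ + φ)).re ^ (-(s.re + 2)) ≤ (r * m) ^ (-(s.re + 2)) :=
    Real.rpow_le_rpow_of_nonpos (mul_pos hr hm) hre (by linarith)
  have hG : 0 < Real.Gamma (s.re + 2) := Real.Gamma_pos_of_pos (by linarith)
  calc _ ≤ r ^ s.re * M * (‖b‖ * (Real.Gamma (s.re + 2) * (r * m) ^ (-(s.re + 2)))) := by
        gcongr
        exact key.trans (by gcongr)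
    _ = _ := by
      rw [Real.mul_rpow hr.le hm.le, norm_zpow, polar, norm_pt hr.le,
        show (0 - 2 : ℤ) = -2 by norm_num, ← Real.rpow_intCast r (-2),
        show ((-2 : ℤ) : ℝ) = s.re + -(s.re + 2) by push_cast; ring, Real.rpow_add hr]
      ring

/-- Two half planes tilted by `±(π/4 - δ/2)` cover `|arg x| ≤ 3π/4 - δ`, and both tilts stay below
`π/4`, where the Gaussian still converges. -/
lemma sector_le_sup {δ : ℝ} :
    sector 0 (3 * Real.pi / 4) δ ≤
      sector (-(Real.pi / 4 - δ / 2)) (Real.pi / 2) (δ / 2) ⊔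
      sector (-(-(Real.pi / 4 - δ / 2))) (Real.pi / 2) (δ / 2) := by
  have hpi := Real.pi_pos
  simp only [sector]
  rw [← prod_sup, sup_principal]
  refine prod_mono le_rfl (principal_mono.2 fun θ hθ => ?_)
  simp only [mem_ofPred_eq, mem_union, sub_zero] at hθ ⊢
  have := abs_le.1 hθ
  rcases le_total θ 0 with h | h
  · left
    exact abs_le.2 ⟨by linarith, by linarith⟩
  · right
    exact abs_le.2 ⟨by linarith, by linarith⟩

lemma lead_rotInt_zero (hs : 0 < s.re) {δ : ℝ} (hδ : 0 < δ) :
    Lead (sector 0 (3 * Real.pi / 4) δ) polar (fun p => bpow p.1 p.2 s * rotInt 0 s (polar p))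
      (Gamma s) 0 := by
  have hpi := Real.pi_pos
  have main : ∀ δ : ℝ, 0 < δ → δ ≤ Real.pi / 4 → Lead (sector 0 (3 * Real.pi / 4) δ) polar
      (fun p => bpow p.1 p.2 s * rotInt 0 s (polar p)) (Gamma s) 0 := fun δ hδ hδ2 => by
    have h1 : |Real.pi / 4 - δ / 2| < Real.pi / 4 := abs_lt.2 ⟨by linarith, by linarith⟩
    have h2 : |-(Real.pi / 4 - δ / 2)| < Real.pi / 4 := by rwa [abs_neg]
    have l1 := lead_rotInt h1 hs (half_pos hδ)
    have l2 := lead_rotInt h2 hs (half_pos hδ)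
    rw [rotInt_eq h1 hs] at l1
    rw [rotInt_eq h2 hs] at l2
    exact IsBigO.mono (IsBigO.sup l1 l2) sector_le_sup
  refine IsBigO.mono (main (min δ (Real.pi / 4)) (by positivity) (min_le_right _ _))
    (sector_mono ?_)
  have := min_le_left δ (Real.pi / 4)
  simp only [sub_self, abs_zero]
  linarith

lemma isCylinder_rotInt (hs : 0 < s.re) :
    IsCylinder s (rotInt 0 s) (fun w => -rotInt 0 (s + 1) w) := by
  have h0 : |(0 : ℝ)| < Real.pi / 4 := by simpa using by positivity
  have hs1 : 0 < (s + 1).re := by simpa using by linarith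
  have hs0 : s ≠ 0 := fun h => by simp [h] at hs
  refine ⟨hasDerivAt_rotInt h0 hs, fun w => ?_, rotInt_zero h0 hs, ?_, fun δ hδ =>
    lead_rotInt_zero hs hδ, fun δ hδ => ?_⟩
  · refine (hasDerivAt_rotInt h0 hs1 w).neg.congr_deriv ?_
    rw [neg_neg, show s + 1 + 1 = s + 2 by ring, rotInt_add_two h0 hs]
    ring
  · rw [rotInt_zero h0 hs1, add_sub_cancel_right]
  · have := ((lead_zpow (-1)).mul tendsto_norm_polar
      (lead_rotInt_zero hs1 hδ)).const_mul (-1)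
    rw [Gamma_add_one s hs0] at this
    rw [show -s * Gamma s = -1 * (1 * (s * Gamma s)) by ring]
    refine this.congr ?_
    filter_upwards [eventually_pos_sector] with p hp
    have h2 : polar p ≠ 0 := norm_pos_iff.1 (by rw [polar, norm_pt hp.le]; exact hp)
    rw [bpow_add, bpow_one hp, zpow_neg_one, ← polar]
    field_simp

/-- In the integrals, `F_s' = -F_{s+1}` and `F_{s+2} = -2wF_{s+1} + 2sF_s`. Solved for `F_s`, this
continues the family in `s` to the left. -/
lemma IsCylinder.down {F F' : ℂ → ℂ} (hs0 : s ≠ 0) (h : IsCylinder (s + 1) F F') :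
    IsCylinder s (fun w => (-F' w + 2 * w * F w) / (2 * s)) (fun w => -F w) := by
  have hpol : ∀ δ > 0, ∀ᶠ p in sector 0 (3 * Real.pi / 4) δ, 0 < p.1 ∧ polar p ≠ 0 :=
    fun δ _ => eventually_pos_sector.mono fun p hp =>
      ⟨hp, norm_pos_iff.1 (by rw [polar, norm_pt hp.le]; exact hp)⟩
  refine ⟨fun w => ?_, fun w => ?_, ?_, ?_, fun δ hδ => ?_, fun δ hδ => ?_⟩
  · have := ((h.hasDerivAt' w).neg.add (((hasDerivAt_id w).const_mul 2).mul
      (h.hasDerivAt w))).div_const (2 * s)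
    refine this.congr_deriv ?_
    simp only [id]
    field_simp
    ring
  · refine (h.hasDerivAt w).neg.congr_deriv ?_
    field_simp
    ring
  · rw [h.at_zero', show (s + 1 + 1) / 2 = s / 2 + 1 by ring,
      Gamma_add_one _ (div_ne_zero hs0 two_ne_zero), cpow_add _ _ two_ne_zero,
      cpow_sub _ _ two_ne_zero, cpow_one]
    field_simp
    ring
  · rw [h.at_zero, add_sub_cancel_right]
  · have l1 := (lead_zpow (-1)).mul tendsto_norm_polar (h.asymp.lead' δ hδ)
    have l2 := (lead_zero (l1.powO tendsto_norm_polar) (k := 0) (by norm_num))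
    have := ((h.asymp.lead δ hδ).sub (l2.const_mul (1 / 2))).const_mul s⁻¹
    rw [Gamma_add_one s hs0, show s⁻¹ * (s * Gamma s - 1 / 2 * 0) = Gamma s by field_simp; ring]
      at this
    refine this.congr ?_
    filter_upwards [hpol δ hδ] with p ⟨hp, h2⟩
    rw [bpow_add, bpow_one hp, zpow_neg_one, ← polar]
    field_simp
    ring
  · have := ((lead_zpow (-1)).mul tendsto_norm_polar (h.asymp.lead δ hδ)).const_mul (-1)
    rw [Gamma_add_one s hs0] at this
    rw [show -s * Gamma s = -1 * (1 * (s * Gamma s)) by ring]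
    refine this.congr ?_
    filter_upwards [hpol δ hδ] with p ⟨hp, h2⟩
    rw [bpow_add, bpow_one hp, zpow_neg_one, ← polar]
    field_simp

/-- Existence of the parabolic cylinder functions for all admissible parameters. -/
theorem exists_isCylinder (hs : ∀ m : ℕ, s ≠ -m) : ∃ F F', IsCylinder s F F' := by
  -- Induction on a bound for how far `Re s` lies to the left of zero; the integral itself serves
  -- for `Re s > 0`.
  have main : ∀ N : ℕ, ∀ s : ℂ, -(N : ℝ) < s.re → (∀ m : ℕ, s ≠ -m) →
      ∃ F F', IsCylinder s F F' := by
    intro N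
    induction N with
    | zero => exact fun s h _ => ⟨_, _, isCylinder_rotInt (by simpa using h)⟩
    | succ N ih =>
      intro s h hs
      have hs0 : s ≠ 0 := by simpa using hs 0
      obtain ⟨F, F', hF⟩ := ih (s + 1) (by push_cast at h; simp; linarith) fun m hm =>
        hs (m + 1) (by push_cast; linear_combination hm)
      exact ⟨_, _, hF.down hs0⟩
  obtain ⟨N, hN⟩ := exists_nat_gt (-s.re)
  exact main N s (by linarith) hs

end P4

end

noncomputable section

open Topology Asymptotics Set MeasureTheory

namespace P4

/-! ### Solutions of `z'' + 2 x z' + β z = 0` -/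

/-- `z` solves `z'' + 2 x z' + β z = 0` and `z'` is its derivative. -/
structure IsWeber (β : ℂ) (z z' : ℂ → ℂ) : Prop where
  hasDerivAt : ∀ x, HasDerivAt z (z' x) x
  hasDerivAt' : ∀ x, HasDerivAt z' (-2 * x * z' x + -β * z x) x

variable {β s : ℂ} {z z' z₁ z₁' z₂ z₂' : ℂ → ℂ}

lemma IsWeber.comb (h₁ : IsWeber β z₁ z₁') (h₂ : IsWeber β z₂ z₂') (a b : ℂ) :
    IsWeber β (fun x => a * z₁ x + b * z₂ x) (fun x => a * z₁' x + b * z₂' x) where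
  hasDerivAt x := ((h₁.hasDerivAt x).const_mul a).add ((h₂.hasDerivAt x).const_mul b)
  hasDerivAt' x := by
    refine (((h₁.hasDerivAt' x).const_mul a).add ((h₂.hasDerivAt' x).const_mul b)).congr_deriv ?_
    ring

lemma IsWeber.eq (h₁ : IsWeber β z₁ z₁') (h₂ : IsWeber β z₂ z₂') (h0 : z₁ 0 = z₂ 0)
    (h0' : z₁' 0 = z₂' 0) : z₁ = z₂ ∧ z₁' = z₂' := by
  have := eq_of_initial h₁.hasDerivAt h₁.hasDerivAt' h₂.hasDerivAt h₂.hasDerivAt' h0 h0'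
  refine ⟨this, funext fun x => ?_⟩
  have h := h₁.hasDerivAt x
  rw [this] at h
  exact h.unique (h₂.hasDerivAt x)

lemma IsWeber.deriv_eq (h : IsWeber β z z') : deriv z = z' :=
  funext fun x => (h.hasDerivAt x).deriv

lemma IsWeber.isSeed (h : IsWeber β z z') (h0 : z 0 ≠ 0 ∨ z' 0 ≠ 0) : IsSeed β z where
  diff x := (h.hasDerivAt x).differentiableAt
  nontrivial := by
    by_contra! hc
    have : z = fun _ => 0 := funext hc
    rcases h0 with h0 | h0
    · exact h0 (hc 0)
    · apply h0
      have h1 := h.hasDerivAt 0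
      rw [this] at h1
      exact h1.unique (hasDerivAt_const _ _)
  ode x := by
    rw [h.deriv_eq, (h.hasDerivAt' x).deriv]
    ring

/-- Abel's formula. -/
lemma IsWeber.wronskian (h₁ : IsWeber β z₁ z₁') (h₂ : IsWeber β z₂ z₂') (x : ℂ) :
    z₁ x * z₂' x - z₁' x * z₂ x = (z₁ 0 * z₂' 0 - z₁' 0 * z₂ 0) * exp (-x ^ 2) := by
  have hd : ∀ x, HasDerivAt (fun x => (z₁ x * z₂' x - z₁' x * z₂ x) * exp (x ^ 2)) 0 x := by
    intro x
    have := (((h₁.hasDerivAt x).mul (h₂.hasDerivAt' x)).sub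
      ((h₁.hasDerivAt' x).mul (h₂.hasDerivAt x))).mul ((hasDerivAt_pow 2 x).cexp)
    refine this.congr_deriv ?_
    simp only [Pi.sub_apply, Pi.mul_apply]
    push_cast
    ring
  have := is_const_of_deriv_eq_zero (fun x => (hd x).differentiableAt) (fun x => (hd x).deriv) x 0
  simp only [ne_eq, OfNat.ofNat_ne_zero, not_false_eq_true, zero_pow, Complex.exp_zero,
    mul_one] at this
  rw [← this, mul_assoc, ← Complex.exp_add]
  simp

/-- Substituting `w = ±ix` changes the sign of the first and zeroth order terms, which gives the
required equation with `β = 2s`. -/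
lemma IsCylinder.isWeber {F F' : ℂ → ℂ} (h : IsCylinder s F F') {c : ℂ} (hc : c ^ 2 = -1) (C : ℂ) :
    IsWeber (2 * s) (fun x => C * F (c * x)) (fun x => C * (c * F' (c * x))) where
  hasDerivAt x := by
    have h1 : HasDerivAt (fun x => c * x) c x := by simpa using (hasDerivAt_id x).const_mul c
    refine (((h.hasDerivAt (c * x)).comp x h1).const_mul C).congr_deriv ?_
    ring
  hasDerivAt' x := by
    have h1 : HasDerivAt (fun x => c * x) c x := by simpa using (hasDerivAt_id x).const_mul c
    refine ((((h.hasDerivAt' (c * x)).comp x h1).const_mul c).const_mul C).congr_deriv ?_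
    linear_combination (C * (2 * c * x * F' (c * x) + 2 * s * F (c * x))) * hc

/-- Removing a factor `e^{-x²}` from a solution exchanges `s` and `1 - s` and restores the cylinder
equation in `±x`. These are the exponential solutions. -/
lemma IsCylinder.isWeber_exp {F F' : ℂ → ℂ} (h : IsCylinder (1 - s) F F') {c : ℂ} (hc : c ^ 2 = 1)
    (C : ℂ) :
    IsWeber (2 * s) (fun x => exp (-x ^ 2) * (C * F (c * x)))
      (fun x => exp (-x ^ 2) * (C * (c * F' (c * x)) - 2 * x * (C * F (c * x)))) := by
  have h1 : ∀ x, HasDerivAt (fun x => c * x) c x := fun x => by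
    simpa using (hasDerivAt_id x).const_mul c
  have h2 : ∀ x : ℂ, HasDerivAt (fun x => exp (-x ^ 2)) (exp (-x ^ 2) * (-(2 * x))) x := fun x => by
    simpa using (hasDerivAt_pow 2 x).neg.cexp
  have h3 := fun x => ((h.hasDerivAt (c * x)).comp x (h1 x)).const_mul C
  have h4 := fun x => (((h.hasDerivAt' (c * x)).comp x (h1 x)).const_mul c).const_mul C
  refine ⟨fun x => ((h2 x).mul (h3 x)).congr_deriv ?_, fun x => ((h2 x).mul ((h4 x).sub
    (((hasDerivAt_id x).const_mul 2).mul (h3 x)))).congr_deriv ?_⟩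
  · simp only [Function.comp_apply]
    ring
  · simp only [Function.comp_apply, Pi.sub_apply, Pi.mul_apply, id]
    linear_combination (C * (exp (-x ^ 2) *
      (2 * c * x * F' (c * x) + 2 * (1 - s) * F (c * x)))) * hc

/-! ### Algebraic asymptotics of solutions -/

variable {K K₁ K₂ : ℂ} {θ₀ θ₁ w w' : ℝ}

lemma polar_ne_zero {δ : ℝ} : ∀ᶠ p in sector θ₀ w δ, 0 < p.1 ∧ polar p ≠ 0 :=
  eventually_pos_sector.mono fun p hp =>
    ⟨hp, norm_pos_iff.1 (by rw [polar, norm_pt hp.le]; exact hp)⟩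

lemma AlgAsymp.comb (h₁ : AlgAsymp s z₁ z₁' K₁ θ₀ w) (h₂ : AlgAsymp s z₂ z₂' K₂ θ₀ w) (a b : ℂ) :
    AlgAsymp s (fun x => a * z₁ x + b * z₂ x) (fun x => a * z₁' x + b * z₂' x)
      (a * K₁ + b * K₂) θ₀ w where
  lead δ hδ := (((h₁.lead δ hδ).const_mul a).add ((h₂.lead δ hδ).const_mul b)).congr
    (Eventually.of_forall fun p => by ring)
  lead' δ hδ := by
    have := (((h₁.lead' δ hδ).const_mul a).add ((h₂.lead' δ hδ).const_mul b))
    rw [show a * (-s * K₁) + b * (-s * K₂) = -s * (a * K₁ + b * K₂) by ring] at this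
    exact this.congr (Eventually.of_forall fun p => by ring)

lemma AlgAsymp.mono (h : AlgAsymp s z z' K θ₀ w) (hw : |θ₁ - θ₀| + w' ≤ w) :
    AlgAsymp s z z' K θ₁ w' where
  lead δ hδ := IsBigO.mono (h.lead δ hδ) (sector_mono (by linarith))
  lead' δ hδ := IsBigO.mono (h.lead' δ hδ) (sector_mono (by linarith))

lemma Lead.rescale {l : Filter (ℝ × ℝ)} {x f : ℝ × ℝ → ℂ} {a c : ℂ} {k : ℤ} (hc : ‖c‖ = 1)
    (h : Lead l (fun p => x p * c) f a k) : Lead l x f (a * c ^ k) k := by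
  refine IsBigO.congr' (IsBigO.trans h (IsBigO.of_bound 1 (Eventually.of_forall fun p => ?_)))
    (Eventually.of_forall fun p => ?_) EventuallyEq.rfl
  · rw [mul_zpow, norm_mul, norm_zpow c, hc, one_zpow, mul_one, one_mul]
  · simp only [mul_zpow]
    ring

/-- Rotation of the variable. -/
lemma AlgAsymp.rotate (h : AlgAsymp s z z' K 0 w) (ψ : ℝ) (C : ℂ) :
    AlgAsymp s (fun x => C * z (exp (ψ * I) * x)) (fun x => C * (exp (ψ * I) * z' (exp (ψ * I) * x)))
      (C * exp (-(ψ * s * I)) * K) (-ψ) w := by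
  have ht : ∀ δ, Tendsto (fun p : ℝ × ℝ => (p.1, p.2 + ψ)) (sector (-ψ) w δ) (sector 0 w δ) := by
    intro δ
    refine Tendsto.prodMk (tendsto_fst) (tendsto_principal.2 ?_)
    filter_upwards [eventually_mem_sector] with p hp
    simpa using hp
  have hp : ∀ p : ℝ × ℝ, polar (p.1, p.2 + ψ) = polar p * exp (ψ * I) := fun p => by
    rw [polar, pt_add_angle, polar]
  have hnorm : ‖exp (ψ * I)‖ = 1 := norm_exp_ofReal_mul_I ψ
  have key : ∀ {f : ℝ × ℝ → ℂ} {a : ℂ} {k : ℤ} {δ : ℝ}, Lead (sector 0 w δ) polar f a k →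
      Lead (sector (-ψ) w δ) polar (fun p => f (p.1, p.2 + ψ)) (a * exp (ψ * I) ^ k) k := by
    intro f a k δ hl
    refine Lead.rescale hnorm ?_
    have := IsBigO.comp_tendsto hl (ht δ)
    refine IsBigO.congr' this ?_ ?_
    · exact Eventually.of_forall fun p => by simp only [Function.comp, hp]
    · exact Eventually.of_forall fun p => by simp only [Function.comp, hp]
  have hb : ∀ p : ℝ × ℝ, bpow p.1 p.2 s = exp (-(ψ * s * I)) * bpow p.1 (p.2 + ψ) s := fun p => by
    rw [bpow_add_angle, mul_comm, mul_assoc, ← Complex.exp_add]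
    simp
  constructor
  · intro δ hδ
    have := (key (h.lead δ hδ)).const_mul (C * exp (-(ψ * s * I)))
    rw [zpow_zero, mul_one] at this
    refine this.congr (Eventually.of_forall fun p => ?_)
    simp only [hp]
    rw [hb, mul_comm (polar p)]
    ring
  · intro δ hδ
    have := (key (h.lead' δ hδ)).const_mul (C * exp (-(ψ * s * I)) * exp (ψ * I))
    rw [show C * exp (-(ψ * s * I)) * exp (ψ * I) * (-s * K * exp (ψ * I) ^ (-1 : ℤ)) =
      -s * (C * exp (-(ψ * s * I)) * K) by
        have := Complex.exp_ne_zero (ψ * I); rw [zpow_neg_one]; field_simp] at this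
    refine this.congr (Eventually.of_forall fun p => ?_)
    simp only [hp]
    rw [hb, mul_comm (polar p)]
    ring

/-- Gaussians are smaller than all powers around the directions in which they decay. -/
lemma powO_bpow_mul_gaussian {κ : ℂ} (hκ : κ = exp (-(2 * θ₀ * I))) (a : ℂ) (k : ℕ) {δ : ℝ}
    (hδ : 0 < δ) : PowO (sector θ₀ (Real.pi / 4) δ) polar
      (fun p => bpow p.1 p.2 a * exp (-(κ * polar p ^ 2))) (-k) := by
  by_cases hδ2 : Real.pi / 4 < δ
  · refine IsBigO.of_bound 1 ?_
    filter_upwards [eventually_mem_sector] with p hp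
    exact absurd ((abs_nonneg _).trans hp) (by linarith)
  have hpi := Real.pi_pos
  set m := Real.cos (2 * (Real.pi / 4 - δ))
  have hm : 0 < m := Real.cos_pos_of_mem_Ioo ⟨by linarith, by linarith⟩
  set M := Real.exp (|a.im| * (|θ₀| + Real.pi))
  have hlim : Tendsto (fun r : ℝ => r ^ (a.re + k) * Real.exp (-m * r)) atTop (𝓝 0) :=
    tendsto_rpow_mul_exp_neg_mul_atTop_nhds_zero _ _ hm
  have hfst : Tendsto (fun p : ℝ × ℝ => p.1) (sector θ₀ (Real.pi / 4) δ) atTop := tendsto_fst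
  have h1 := hfst.eventually (hlim.eventually (eventually_le_nhds one_pos))
  refine IsBigO.of_bound M ?_
  filter_upwards [h1, hfst.eventually_ge_atTop 1, eventually_mem_sector] with p h2 h3 h4
  obtain ⟨r, θ⟩ := p
  simp only at h2 h3 h4
  have hr : 0 < r := by linarith
  -- The choice of `κ` turns the ray `θ₀` to the real axis, so that `Re(κx²) = r² cos(2(θ - θ₀))`,
  -- which is at least `m r²` in the subsector.
  have e : κ * polar (r, θ) ^ 2 = ((r ^ 2 : ℝ) : ℂ) * exp ((2 * (θ - θ₀) : ℝ) * I) := by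
    rw [hκ, polar, pt, mul_pow, ← Complex.exp_nat_mul, mul_left_comm, ← Complex.exp_add]
    push_cast
    ring_nf
  have hcos : m ≤ Real.cos (2 * (θ - θ₀)) := by
    rw [← Real.cos_abs (2 * (θ - θ₀)), abs_mul, abs_two]
    exact Real.cos_le_cos_of_nonneg_of_le_pi (by positivity) (by linarith) (by linarith)
  rw [norm_mul, norm_bpow hr, norm_exp, neg_re, e, re_ofReal_mul, exp_ofReal_mul_I_re, norm_zpow,
    polar, norm_pt hr.le]
  have h5 : Real.exp (-(a.im * θ)) ≤ M := by
    rw [Real.exp_le_exp]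
    have h6 : |θ| ≤ |θ₀| + Real.pi := by
      have := abs_sub_le θ θ₀ 0
      simp only [sub_zero] at this
      linarith
    have h7 : |a.im * θ| ≤ |a.im| * (|θ₀| + Real.pi) := by
      rw [abs_mul]
      exact mul_le_mul_of_nonneg_left h6 (abs_nonneg _)
    linarith [(abs_le.1 h7).1]
  have h8 : Real.exp (-(r ^ 2 * Real.cos (2 * (θ - θ₀)))) ≤ Real.exp (-m * r) := by
    rw [Real.exp_le_exp]
    nlinarith [mul_le_mul_of_nonneg_left hcos (sq_nonneg r), mul_pos hm hr]
  calc _ ≤ r ^ a.re * M * Real.exp (-m * r) := by gcongr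
    _ = M * (r ^ (a.re + k) * Real.exp (-m * r)) * r ^ (-k : ℤ) := by
      rw [Real.rpow_add hr, Real.rpow_natCast, zpow_neg, zpow_natCast]
      field_simp
    _ ≤ M * 1 * r ^ (-k : ℤ) := by gcongr
    _ = _ := by ring

/-- Multiplication by a decaying Gaussian makes a solution negligible. -/
lemma AlgAsymp.recessive (h : AlgAsymp s z z' K θ₀ (Real.pi / 4)) {κ : ℂ}
    (hκ : κ = exp (-(2 * θ₀ * I))) (t c : ℂ) :
    AlgAsymp t (fun x => exp (-(κ * x ^ 2)) * z x)
      (fun x => exp (-(κ * x ^ 2)) * (z' x + c * x * z x)) 0 θ₀ (Real.pi / 4) := by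
  have e : ∀ p : ℝ × ℝ, bpow p.1 p.2 t = bpow p.1 p.2 (t - s) * bpow p.1 p.2 s := fun p => by
    rw [← bpow_add, sub_add_cancel]
  constructor
  · intro δ hδ
    have h1 := (powO_bpow_mul_gaussian hκ (t - s) 2 hδ).mul tendsto_norm_polar
      ((h.lead δ hδ).powO tendsto_norm_polar)
    exact lead_zero (h1.congr (Eventually.of_forall fun p => by beta_reduce; rw [e]; ring)) (by norm_num)
  · intro δ hδ
    have hz := (h.lead δ hδ).powO tendsto_norm_polar
    have hz' := ((h.lead' δ hδ).powO tendsto_norm_polar).mono tendsto_norm_polar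
      (show (-1 : ℤ) ≤ 1 by norm_num)
    have h2 := ((powO_self.mul tendsto_norm_polar hz).const_mul c)
    -- Zero coefficient at order `-1` means `O(x⁻³)`, and the term `c x z` costs one more power:
    -- hence four.
    have h1 := (powO_bpow_mul_gaussian hκ (t - s) 4 hδ).mul tendsto_norm_polar
      (hz'.add (h2.mono tendsto_norm_polar (show (1 + 0 : ℤ) ≤ 1 by norm_num)))
    rw [mul_zero]
    exact lead_zero (h1.congr (Eventually.of_forall fun p => by beta_reduce; rw [e]; ring)) (by norm_num)

/-- Asymptotics of exponential type: `z = K x^{s-1} e^{-x²} (1 + O(x⁻²))`. -/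
def ExpAsymp (s : ℂ) (z z' : ℂ → ℂ) (K : ℂ) (θ₀ w : ℝ) : Prop :=
  AlgAsymp (1 - s) (fun x => exp (x ^ 2) * z x) (fun x => exp (x ^ 2) * (z' x + 2 * x * z x)) K θ₀ w

/-! ### The lowest members of the ladder -/

lemma AlgAsymp.eventually_ne (h : AlgAsymp s z z' K θ₀ w) (hK : K ≠ 0) :
    ∀ δ > 0, ∀ᶠ p in sector θ₀ w δ, z (polar p) ≠ 0 := fun δ hδ =>
  ((h.lead δ hδ).eventually_ne tendsto_norm_polar hK).mono fun p hp h0 => hp (by rw [h0, mul_zero])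

lemma AlgAsymp.lead_div (h : AlgAsymp s z z' K θ₀ w) (hK : K ≠ 0) {δ : ℝ} (hδ : 0 < δ) :
    Lead (sector θ₀ w δ) polar (fun p => z' (polar p) / z (polar p)) (-s) (-1) := by
  have := (h.lead' δ hδ).div tendsto_norm_polar hK (h.lead δ hδ)
  rw [mul_div_cancel_right₀ _ hK, sub_zero] at this
  exact this.congr (Eventually.of_forall fun p => mul_div_mul_left _ _ (bpow_ne_zero _ _ _))

lemma leadPair_zero (hz : IsSeed β z) {a b : ℂ} {k m : ℤ} (ha : a ≠ 0) (hb : b ≠ 0)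
    (hne : ∀ δ > 0, ∀ᶠ p in sector θ₀ w δ, z (polar p) ≠ 0)
    (hu : ∀ δ > 0, Lead (sector θ₀ w δ) polar (fun p => riccati z (polar p)) a k)
    (hq : ∀ δ > 0, Lead (sector θ₀ w δ) polar (fun p => -riccati z (polar p) - 2 * polar p) b m) :
    LeadPair 0 β (ladder β (riccati z) 0) (ladderQ β (riccati z) 0) θ₀ w a k b m where
  sys δ hδ := by
    have h1 : ∀ δ > 0, ∀ᶠ p in sector θ₀ w δ, z (polar p) ≠ 0 ∧ riccati z (polar p) ≠ 0 :=
      fun δ hδ => (hne δ hδ).and ((hu δ hδ).eventually_ne tendsto_norm_polar ha)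
    filter_upwards [eventually_nhds_of_sector (P := fun x => z x ≠ 0 ∧ riccati z x ≠ 0) h1 hδ,
      (hq δ hδ).eventually_ne tendsto_norm_polar hb] with p h2 h3
    exact hz.isSystemAt_zero h2 fun h0 => h3 (by linear_combination -h0)
  lead_y := hu
  lead_q δ hδ := by
    refine (hq δ hδ).congr ?_
    filter_upwards [hne δ hδ, (hu δ hδ).eventually_ne tendsto_norm_polar ha] with p h1 h2
    exact (hz.ladderQ_zero h1 h2).symm

lemma AlgAsymp.leadPair (hβ : ∀ m : ℤ, β / 2 ≠ m) (hz : IsWeber β z z') (hs : IsSeed β z)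
    (h : AlgAsymp (β / 2) z z' K θ₀ w) (hK : K ≠ 0) :
    LeadPair 0 β (ladder β (riccati z) 0) (ladderQ β (riccati z) 0) θ₀ w (-(β / 2)) (-1) (-2) 1 := by
  have hu : ∀ δ > 0, Lead (sector θ₀ w δ) polar (fun p => riccati z (polar p)) (-(β / 2)) (-1) :=
    fun δ hδ => by
      simp only [riccati, hz.deriv_eq]
      exact h.lead_div hK hδ
  refine leadPair_zero hs (neg_ne_zero.2 (by simpa using hβ 0)) (by norm_num)
    (h.eventually_ne hK) hu fun δ hδ => ?_
  have := ((lead_zero ((hu δ hδ).powO tendsto_norm_polar) (k := 1) (by norm_num)).const_mul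
    (-1)).sub (lead_self.const_mul 2)
  rw [show (-1 * 0 - 2 * 1 : ℂ) = -2 by norm_num] at this
  exact this.congr (Eventually.of_forall fun p => by ring)

lemma ExpAsymp.riccati_eq (hz : IsWeber β z z') {x : ℂ} (hx : exp (x ^ 2) * z x ≠ 0) :
    riccati z x = exp (x ^ 2) * (z' x + 2 * x * z x) / (exp (x ^ 2) * z x) - 2 * x := by
  have h1 := left_ne_zero_of_mul hx
  have h2 := right_ne_zero_of_mul hx
  rw [riccati, hz.deriv_eq]
  field_simp
  ring

/-- The sum `z'/z + 2x` is the logarithmic derivative of `e^{x²}z`, which behaves like `x^{β/2-1}`;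
thus `q = -z'/z - 2x` is small with coefficient `1 - β/2`. -/
lemma ExpAsymp.leadPair (hβ : ∀ m : ℤ, β / 2 ≠ m) (hz : IsWeber β z z') (hs : IsSeed β z)
    (h : ExpAsymp (β / 2) z z' K θ₀ w) (hK : K ≠ 0) :
    LeadPair 0 β (ladder β (riccati z) 0) (ladderQ β (riccati z) 0) θ₀ w (-2) 1
      (1 - β / 2) (-1) := by
  have hs1 : 1 - β / 2 ≠ 0 := fun h0 => hβ 1 (by push_cast; linear_combination -h0)
  have hne := AlgAsymp.eventually_ne h hK
  have hq : ∀ δ > 0, Lead (sector θ₀ w δ) polar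
      (fun p => -riccati z (polar p) - 2 * polar p) (1 - β / 2) (-1) := fun δ hδ => by
    have := (AlgAsymp.lead_div h hK hδ).const_mul (-1)
    rw [show -1 * -(1 - β / 2) = 1 - β / 2 by ring] at this
    refine this.congr ?_
    filter_upwards [hne δ hδ] with p hp
    rw [ExpAsymp.riccati_eq hz hp]
    ring
  refine leadPair_zero hs (by norm_num) hs1
    (fun δ hδ => (hne δ hδ).mono fun p hp => right_ne_zero_of_mul hp) (fun δ hδ => ?_) hq
  have := ((lead_zero ((hq δ hδ).powO tendsto_norm_polar) (k := 1) (by norm_num)).const_mul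
    (-1)).sub (lead_self.const_mul 2)
  rw [show (-1 * 0 - 2 * 1 : ℂ) = -2 by norm_num] at this
  exact this.congr (Eventually.of_forall fun p => by ring)

/-- At level zero `q = -y - 2x`, so `Δq = -Δy` without any error; this starts the induction on
differences. -/
lemma locked_zero {a b : ℂ} {k m : ℤ} {δ : ℝ} (hs₁ : IsSeed β z₁) (hs₂ : IsSeed β z₂)
    (ha : a ≠ 0)
    (hz₁ : ∀ᶠ p in sector θ₀ w δ, z₁ (polar p) ≠ 0) (hz₂ : ∀ᶠ p in sector θ₀ w δ, z₂ (polar p) ≠ 0)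
    (h₁ : LeadPair 0 β (ladder β (riccati z₁) 0) (ladderQ β (riccati z₁) 0) θ₀ w a k b m)
    (h₂ : LeadPair 0 β (ladder β (riccati z₂) 0) (ladderQ β (riccati z₂) 0) θ₀ w a k b m)
    (hδ : 0 < δ) :
    Locked (sector θ₀ w δ) (ladder β (riccati z₁) 0) (ladderQ β (riccati z₁) 0)
      (ladder β (riccati z₂) 0) (ladderQ β (riccati z₂) 0) := by
  refine IsBigO.congr' (isBigO_zero _ _) ?_ EventuallyEq.rfl
  filter_upwards [hz₁, hz₂, (h₁.lead_y δ hδ).eventually_ne tendsto_norm_polar ha,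
    (h₂.lead_y δ hδ).eventually_ne tendsto_norm_polar ha] with p e1 e2 e3 e4
  rw [hs₁.ladderQ_zero e1 e3, hs₂.ladderQ_zero e2 e4]
  simp only [ladder]
  ring

/-- Abel's formula makes the difference at the bottom of the ladder exact. All exponential terms
have their source here. -/
lemma riccati_sub (hz₁ : IsWeber β z₁ z₁') (hz₂ : IsWeber β z₂ z₂') {x : ℂ} (h₁ : z₁ x ≠ 0)
    (h₂ : z₂ x ≠ 0) : riccati z₂ x - riccati z₁ x =
      (z₁ 0 * z₂' 0 - z₁' 0 * z₂ 0) * exp (-x ^ 2) / (z₁ x * z₂ x) := by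
  rw [← hz₁.wronskian hz₂, riccati, riccati, hz₁.deriv_eq, hz₂.deriv_eq]
  field_simp

/-- The difference of two members of the ladder with `y ~ -β/(2x)`. -/
theorem AlgAsymp.rel_ladder_sub (hβ : ∀ m : ℤ, β / 2 ≠ m) (hz₁ : IsWeber β z₁ z₁')
    (hz₂ : IsWeber β z₂ z₂') (hs₁ : IsSeed β z₁) (hs₂ : IsSeed β z₂)
    (h₁ : AlgAsymp (β / 2) z₁ z₁' K₁ θ₀ w) (h₂ : AlgAsymp (β / 2) z₂ z₂' K₂ θ₀ w)
    (hK₁ : K₁ ≠ 0) (hK₂ : K₂ ≠ 0) {δ : ℝ} (hδ : 0 < δ) (n : ℕ) :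
    Rel (sector θ₀ w δ) polar
      (fun p => ladder β (riccati z₂) n (polar p) - ladder β (riccati z₁) n (polar p))
      (fun p => 2 ^ n / n.factorial * ((z₁ 0 * z₂' 0 - z₁' 0 * z₂ 0) / (K₁ * K₂)) *
        EMinus n β p.1 p.2) := by
  have hx := tendsto_norm_polar (θ₀ := θ₀) (w := w) (δ := δ)
  have l₁ := h₁.leadPair hβ hz₁ hs₁ hK₁
  have l₂ := h₂.leadPair hβ hz₂ hs₂ hK₂
  have hlock := locked_zero hs₁ hs₂ (neg_ne_zero.2 (by simpa using hβ 0))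
    (h₁.eventually_ne hK₁ δ hδ) (h₂.eventually_ne hK₂ δ hδ) l₁ l₂ hδ
  have main := (ladder_sub_decaying hβ l₁ l₂ hδ hlock n).1
  have e := (((h₁.lead δ hδ).inv hx hK₁).rel hx (inv_ne_zero hK₁)).mul hx
    (((h₂.lead δ hδ).inv hx hK₂).rel hx (inv_ne_zero hK₂))
  have e2 := (Rel.refl (l := sector θ₀ w δ) (x := polar) fun p =>
    2 ^ n / n.factorial * polar p ^ (2 * n) * ((z₁ 0 * z₂' 0 - z₁' 0 * z₂ 0) *
      (exp (-polar p ^ 2) * bpow p.1 p.2 β))).mul hx e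
  refine main.trans hx (e2.congr ?_ ?_)
  · filter_upwards [h₁.eventually_ne hK₁ δ hδ, h₂.eventually_ne hK₂ δ hδ] with p e1 e2
    rw [riccati_sub hz₁ hz₂ e1 e2]
    have hb : bpow p.1 p.2 β = bpow p.1 p.2 (β / 2) * bpow p.1 p.2 (β / 2) := by
      rw [← bpow_add]; ring_nf
    have := bpow_ne_zero p.1 p.2 (β / 2)
    rw [hb]
    field_simp
  · filter_upwards [polar_ne_zero] with p hp
    have hb : bpow p.1 p.2 (2 * n + β) = polar p ^ (2 * n) * bpow p.1 p.2 β := by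
      rw [bpow_add, show (2 * n : ℂ) = (2 * n : ℕ) by push_cast; ring, bpow_natCast hp.1]
      rfl
    rw [EMinus, hb, ← polar, neg_zero, zpow_zero]
    field_simp

/-- The difference of two members of the ladder with `y ~ -2x`. -/
theorem ExpAsymp.rel_ladder_sub (hβ : ∀ m : ℤ, β / 2 ≠ m) (hz₁ : IsWeber β z₁ z₁')
    (hz₂ : IsWeber β z₂ z₂') (hs₁ : IsSeed β z₁) (hs₂ : IsSeed β z₂)
    (h₁ : ExpAsymp (β / 2) z₁ z₁' K₁ θ₀ w) (h₂ : ExpAsymp (β / 2) z₂ z₂' K₂ θ₀ w)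
    (hK₁ : K₁ ≠ 0) (hK₂ : K₂ ≠ 0) {δ : ℝ} (hδ : 0 < δ) (n : ℕ) :
    Rel (sector θ₀ w δ) polar
      (fun p => ladder β (riccati z₂) n (polar p) - ladder β (riccati z₁) n (polar p))
      (fun p => 4 ^ n * Gamma (1 - β / 2) / (n.factorial * Gamma (n + 1 - β / 2)) *
        ((z₁ 0 * z₂' 0 - z₁' 0 * z₂ 0) / (K₁ * K₂)) * EPlus n β p.1 p.2) := by
  have hx := tendsto_norm_polar (θ₀ := θ₀) (w := w) (δ := δ)
  have l₁ := h₁.leadPair hβ hz₁ hs₁ hK₁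
  have l₂ := h₂.leadPair hβ hz₂ hs₂ hK₂
  have n₁ := AlgAsymp.eventually_ne h₁ hK₁ δ hδ
  have n₂ := AlgAsymp.eventually_ne h₂ hK₂ δ hδ
  have hlock := locked_zero hs₁ hs₂ (by norm_num) (n₁.mono fun p hp => right_ne_zero_of_mul hp)
    (n₂.mono fun p hp => right_ne_zero_of_mul hp) l₁ l₂ hδ
  have main := (ladder_sub_growing hβ l₁ l₂ hδ hlock n).1
  have e := (((h₁.lead δ hδ).inv hx hK₁).rel hx (inv_ne_zero hK₁)).mul hx
    (((h₂.lead δ hδ).inv hx hK₂).rel hx (inv_ne_zero hK₂))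
  -- Each `z` carries a factor `e^{-x²}x^{β/2-1}`; dividing `e^{-x²}` by two of them leaves
  -- `e^{x²}x^{2-β}`.
  have e2 := (Rel.refl (l := sector θ₀ w δ) (x := polar) fun p =>
    4 ^ n * Gamma (1 - β / 2) / (n.factorial * Gamma (n + 1 - β / 2)) * polar p ^ (4 * n) *
      ((z₁ 0 * z₂' 0 - z₁' 0 * z₂ 0) * (exp (polar p ^ 2) * bpow p.1 p.2 (2 - β)))).mul hx e
  refine main.trans hx (e2.congr ?_ ?_)
  · filter_upwards [n₁, n₂] with p e1 e2
    rw [riccati_sub hz₁ hz₂ (right_ne_zero_of_mul e1) (right_ne_zero_of_mul e2)]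
    have hb : bpow p.1 p.2 (2 - β) = bpow p.1 p.2 (1 - β / 2) * bpow p.1 p.2 (1 - β / 2) := by
      rw [← bpow_add]; ring_nf
    have := bpow_ne_zero p.1 p.2 (1 - β / 2)
    have he := Complex.exp_ne_zero (polar p ^ 2)
    have h3 := right_ne_zero_of_mul e1
    have h4 := right_ne_zero_of_mul e2
    rw [hb, Complex.exp_neg]
    generalize bpow p.1 p.2 (1 - β / 2) = P at this ⊢
    field_simp
  · filter_upwards [polar_ne_zero] with p hp
    have hb : bpow p.1 p.2 (4 * n + 2 - β) = polar p ^ (4 * n) * bpow p.1 p.2 (2 - β) := by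
      rw [add_sub_assoc, bpow_add, show (4 * n : ℂ) = (4 * n : ℕ) by push_cast; ring,
        bpow_natCast hp.1]
      rfl
    rw [EPlus, hb, ← polar, neg_zero, zpow_zero]
    field_simp

/-! ### The predicates of the statement -/

lemma norm_zpow_neg_two_mul {r θ : ℝ} (hr : 0 < r) (g : ℂ) :
    ‖polar (r, θ) ^ (-2 : ℤ) * g‖ = ‖g‖ / r ^ 2 := by
  rw [norm_mul, zpow_neg, norm_inv, norm_zpow, polar, norm_pt hr.le, div_eq_inv_mul]
  norm_cast

lemma algebraic_of_rel {f L : ℂ → ℂ} (h : ∀ δ > 0, Rel (sector θ₀ w δ) polar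
    (fun p => f (polar p)) (fun p => L (polar p))) : Algebraic f L θ₀ w := by
  intro δ hδ
  obtain ⟨C, hC⟩ := (h δ hδ).bound
  obtain ⟨R, hR, hb⟩ := eventually_sector.1 hC
  refine ⟨R, C, hR, fun r θ hr hθ => ?_⟩
  have := hb r θ hr hθ
  rw [norm_zpow_neg_two_mul (hR.trans_le hr)] at this
  refine this.trans (le_of_eq ?_)
  simp only [polar]
  ring

lemma AlgAsymp.algebraic (hβ : ∀ m : ℤ, β / 2 ≠ m) (hz : IsWeber β z z') (hs : IsSeed β z)
    (h : AlgAsymp (β / 2) z z' K θ₀ w) (hK : K ≠ 0) (n : ℕ) :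
    Algebraic (ladder β (riccati z) n) (decaying β) θ₀ w := by
  refine algebraic_of_rel fun δ hδ => ?_
  have := (ladder_decaying hβ (h.leadPair hβ hz hs hK) n).1.lead_y δ hδ
  refine (this.rel tendsto_norm_polar (neg_ne_zero.2 (by simpa using hβ 0))).congr_right ?_
  filter_upwards [polar_ne_zero] with p hp
  have := hp.2
  rw [decaying, zpow_neg_one]
  field_simp

lemma ExpAsymp.algebraic (hβ : ∀ m : ℤ, β / 2 ≠ m) (hz : IsWeber β z z') (hs : IsSeed β z)
    (h : ExpAsymp (β / 2) z z' K θ₀ w) (hK : K ≠ 0) (n : ℕ) :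
    Algebraic (ladder β (riccati z) n) growing θ₀ w := by
  refine algebraic_of_rel fun δ hδ => ?_
  have := (ladder_growing hβ (h.leadPair hβ hz hs hK) n).1.lead_y δ hδ
  refine (this.rel tendsto_norm_polar (by norm_num)).congr_right
    (Eventually.of_forall fun p => by simp [growing])

/-- The comparison with either background holds in the whole sector, each with its own constant
multiplier. The step function only selects one of them, and averaging the two comparisons gives the
ray. There the multipliers may cancel, so the error is measured by `E` alone. -/
lemma perturbed_of_rel {y Bm Bp : ℂ → ℂ} {μ : ℝ → ℂ} {E : ℝ → ℝ → ℂ} {μm μp : ℂ}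
    (hm : ∀ δ > 0, Rel (sector θ₀ (Real.pi / 4) δ) polar (fun p => y (polar p) - Bm (polar p))
      (fun p => μm * E p.1 p.2))
    (hp : ∀ δ > 0, Rel (sector θ₀ (Real.pi / 4) δ) polar (fun p => y (polar p) - Bp (polar p))
      (fun p => μp * E p.1 p.2))
    (h1 : ∀ θ < θ₀, μ θ = μm) (h2 : μ θ₀ = (μm + μp) / 2) (h3 : ∀ θ > θ₀, μ θ = μp) :
    Perturbed y Bm Bp μ E θ₀ := by
  intro δ hδ
  obtain ⟨C₁, hC₁, b₁⟩ := (hm δ hδ).exists_nonneg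
  obtain ⟨C₂, hC₂, b₂⟩ := (hp δ hδ).exists_nonneg
  obtain ⟨R, hR, hb⟩ := eventually_sector.1 (b₁.bound.and b₂.bound)
  set M := 1 + ‖μm‖ + ‖μp‖ with hM
  have hM1 : 1 ≤ M := by linarith [norm_nonneg μm, norm_nonneg μp]
  refine ⟨R, (C₁ + C₂) * M, hR, fun r θ hr hθ => ?_⟩
  have hr0 := hR.trans_le hr
  obtain ⟨e1, e2⟩ := hb r θ hr hθ
  rw [norm_zpow_neg_two_mul hr0] at e1 e2
  simp only [polar] at e1 e2
  refine ⟨fun h => ?_, fun h => ?_, fun h => ?_⟩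
  · rw [h1 θ h]
    calc _ ≤ _ := e1
      _ = C₁ / r ^ 2 * ‖μm * E r θ‖ := by ring
      _ ≤ _ := by gcongr; nlinarith
  · rw [h, h2]
    rw [h] at e1 e2
    have e : y (pt r θ₀) - (Bm (pt r θ₀) + Bp (pt r θ₀)) / 2 - (μm + μp) / 2 * E r θ₀ =
        ((y (pt r θ₀) - Bm (pt r θ₀) - μm * E r θ₀) +
          (y (pt r θ₀) - Bp (pt r θ₀) - μp * E r θ₀)) / 2 := by ring
    rw [e, norm_div, Complex.norm_two]
    rw [norm_mul] at e1 e2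
    have n1 : ‖μm‖ ≤ M := by linarith [norm_nonneg μp]
    have n2 : ‖μp‖ ≤ M := by linarith [norm_nonneg μm]
    have f1 : C₁ * (‖μm‖ * ‖E r θ₀‖ / r ^ 2) ≤ C₁ * (M * ‖E r θ₀‖ / r ^ 2) := by gcongr
    have f2 : C₂ * (‖μp‖ * ‖E r θ₀‖ / r ^ 2) ≤ C₂ * (M * ‖E r θ₀‖ / r ^ 2) := by gcongr
    have f3 : 0 ≤ C₁ * (M * ‖E r θ₀‖ / r ^ 2) := by positivity
    have f4 : 0 ≤ C₂ * (M * ‖E r θ₀‖ / r ^ 2) := by positivity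
    have f5 := norm_add_le (y (pt r θ₀) - Bm (pt r θ₀) - μm * E r θ₀)
      (y (pt r θ₀) - Bp (pt r θ₀) - μp * E r θ₀)
    have f6 : (C₁ + C₂) * M / r ^ 2 * ‖E r θ₀‖ =
      C₁ * (M * ‖E r θ₀‖ / r ^ 2) + C₂ * (M * ‖E r θ₀‖ / r ^ 2) := by ring
    rw [f6]
    linarith
  · rw [h3 θ h]
    calc _ ≤ _ := e2
      _ = C₂ / r ^ 2 * ‖μp * E r θ‖ := by ring
      _ ≤ _ := by gcongr; nlinarith

end P4

end

noncomputable section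

open Topology Asymptotics Set MeasureTheory

namespace P4

/-! ### Gamma function identities -/

section Gamma

variable {β : ℂ}

lemma two_I_mul_sin (x : ℂ) : 2 * I * sin x * exp (x * I) = exp (x * I) ^ 2 - 1 := by
  have h := Complex.exp_ne_zero (x * I)
  rw [Complex.sin, neg_mul, Complex.exp_neg]
  generalize exp (x * I) = Y at h ⊢
  field_simp
  linear_combination (1 - Y ^ 2) * I_sq

lemma two_mul_cos (x : ℂ) : 2 * cos x * exp (x * I) = exp (x * I) ^ 2 + 1 := by
  have h := Complex.exp_ne_zero (x * I)
  rw [Complex.cos, neg_mul, Complex.exp_neg]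
  field_simp

lemma sqrt_pi_sq : ((Real.sqrt Real.pi : ℝ) : ℂ) ^ 2 = Real.pi := by
  rw [← ofReal_pow, Real.sq_sqrt Real.pi_pos.le]

lemma sqrt_pi_ne_zero : ((Real.sqrt Real.pi : ℝ) : ℂ) ≠ 0 := by
  rw [ofReal_ne_zero]
  exact (Real.sqrt_pos.2 Real.pi_pos).ne'

lemma sin_pi_mul_ne_zero {x : ℂ} (hx : ∀ m : ℤ, x ≠ m) : sin (Real.pi * x) ≠ 0 := by
  rw [Ne, Complex.sin_eq_zero_iff]
  rintro ⟨k, hk⟩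
  refine hx k (mul_left_cancel₀ (ofReal_ne_zero.2 Real.pi_ne_zero) ?_)
  rw [hk]
  ring

/-- The sine is written through `e^{iπx}`, so that later checks become polynomial identities. -/
lemma Gamma_reflection {x : ℂ} (hx : ∀ m : ℤ, x ≠ m) :
    Gamma x * Gamma (1 - x) * (exp (Real.pi * x * I) ^ 2 - 1) =
      2 * I * Real.pi * exp (Real.pi * x * I) := by
  rw [Gamma_mul_Gamma_one_sub, ← two_I_mul_sin]
  have := sin_pi_mul_ne_zero hx
  field_simp

variable (hβ : ∀ m : ℤ, β / 2 ≠ m)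
include hβ

/-- The cylinder functions at `0` involve Gamma at quarters of `β`; this is reflection at `β/4`, and
the next lemma is reflection at `β/4 + 1/2`. -/
lemma Gamma_half_mul : Gamma (β / 2 / 2) * Gamma ((1 - β / 2 + 1) / 2) *
    (exp (Real.pi * (β / 4) * I) ^ 2 - 1) = 2 * I * Real.pi * exp (Real.pi * (β / 4) * I) := by
  rw [← Gamma_reflection (x := β / 4) fun m hm =>
    hβ (2 * m) (by push_cast; linear_combination 2 * hm)]
  ring_nf

lemma Gamma_half_mul' : Gamma ((β / 2 + 1) / 2) * Gamma ((1 - β / 2) / 2) *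
    (exp (Real.pi * (β / 4) * I) ^ 2 + 1) = 2 * Real.pi * exp (Real.pi * (β / 4) * I) := by
  have h1 : ∀ m : ℤ, (β / 2 + 1) / 2 ≠ m := fun m hm =>
    hβ (2 * m - 1) (by push_cast; linear_combination 2 * hm)
  have h2 : sin (Real.pi * ((β / 2 + 1) / 2)) = cos (Real.pi * (β / 4)) := by
    rw [← Complex.sin_add_pi_div_two]
    ring_nf
  have h3 := sin_pi_mul_ne_zero h1
  rw [show (1 - β / 2) / 2 = 1 - (β / 2 + 1) / 2 by ring, Gamma_mul_Gamma_one_sub, h2,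
    ← two_mul_cos]
  rw [h2] at h3
  generalize cos (Real.pi * (β / 4)) = c at h3 ⊢
  field_simp

omit hβ in
lemma Gamma_duplication : Gamma (β / 2 / 2) * Gamma ((β / 2 + 1) / 2) * 2 ^ (β / 2) =
    Gamma (β / 2) * 2 * (Real.sqrt Real.pi : ℝ) := by
  have := Gamma_mul_Gamma_add_half (β / 2 / 2)
  rw [show β / 2 / 2 + 1 / 2 = (β / 2 + 1) / 2 by ring, show 2 * (β / 2 / 2) = β / 2 by ring,
    cpow_sub _ _ two_ne_zero, cpow_one] at this
  rw [this]
  have h2 : (2 : ℂ) ^ (β / 2) ≠ 0 := by simp [cpow_eq_zero_iff]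
  field_simp

omit hβ in
lemma Gamma_duplication' : Gamma ((1 - β / 2) / 2) * Gamma ((1 - β / 2 + 1) / 2) =
    Gamma (1 - β / 2) * 2 ^ (β / 2) * (Real.sqrt Real.pi : ℝ) := by
  have := Gamma_mul_Gamma_add_half ((1 - β / 2) / 2)
  rw [show (1 - β / 2) / 2 + 1 / 2 = (1 - β / 2 + 1) / 2 by ring,
    show 2 * ((1 - β / 2) / 2) = 1 - β / 2 by ring,
    show 1 - (1 - β / 2) = β / 2 by ring] at this
  exact this

end Gamma

/-! ### Connection formulas -/

/-- The Stokes multiplier relating the two algebraic solutions. -/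
def stokesB (β : ℂ) : ℂ := iSqrtPi * 2 ^ (β / 2) / Gamma (1 - β / 2)

/-- The Stokes multiplier relating the two exponential solutions. -/
def stokesQ (β : ℂ) : ℂ :=
  -(exp (I * Real.pi * β / 2) * (2 / 2 ^ (β / 2)) * (Real.sqrt Real.pi : ℝ) / Gamma (β / 2))

/-- A fundamental system of `z'' + 2 x z' + β z = 0` with its asymptotics: `d` is algebraic about
`arg x = 3π/2`, `d - B e` about `arg x = π/2`, `e` is exponential about `arg x = 0` and
`Q d + e^{iπβ} e` about `arg x = π`. -/
structure IsBasis (β : ℂ) (d d' e e' : ℂ → ℂ) : Prop where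
  weber_d : IsWeber β d d'
  weber_e : IsWeber β e e'
  wronskian : d 0 * e' 0 - d' 0 * e 0 = -2 * (Gamma (β / 2) * Gamma (1 - β / 2))
  exp_zero : ExpAsymp (β / 2) e e' (Gamma (1 - β / 2)) 0 (3 * Real.pi / 4)
  exp_two_pi : ExpAsymp (β / 2) e e' ((exp (I * Real.pi * β))⁻¹ * Gamma (1 - β / 2))
    (2 * Real.pi) (3 * Real.pi / 4)
  exp_pi : ExpAsymp (β / 2) (fun x => stokesQ β * d x + exp (I * Real.pi * β) * e x)
    (fun x => stokesQ β * d' x + exp (I * Real.pi * β) * e' x) (Gamma (1 - β / 2))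
    Real.pi (3 * Real.pi / 4)
  alg_neg : AlgAsymp (β / 2) d d' (Gamma (β / 2)) (-(Real.pi / 2)) (3 * Real.pi / 4)
  alg_pos : AlgAsymp (β / 2) d d' (exp (I * Real.pi * β) * Gamma (β / 2))
    (3 * Real.pi / 2) (3 * Real.pi / 4)
  alg_half : AlgAsymp (β / 2) (fun x => 1 * d x + -stokesB β * e x)
    (fun x => 1 * d' x + -stokesB β * e' x) (Gamma (β / 2)) (Real.pi / 2) (3 * Real.pi / 4)

lemma expAsymp_of_algAsymp {s K : ℂ} {V V' : ℂ → ℂ} {θ₀ w : ℝ}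
    (h : AlgAsymp (1 - s) V V' K θ₀ w) :
    ExpAsymp s (fun x => exp (-x ^ 2) * V x) (fun x => exp (-x ^ 2) * (V' x - 2 * x * V x))
      K θ₀ w := by
  have e : ∀ x : ℂ, exp (x ^ 2) * exp (-x ^ 2) = 1 := fun x => by
    rw [← Complex.exp_add]; simp
  unfold ExpAsymp
  convert h using 1
  · funext x
    linear_combination (V x) * e x
  · funext x
    linear_combination (V' x) * e x

/-- The initial values of the solutions satisfy the connection formulas. -/
lemma connection_algebra {A1 A2 C1 C2 g h S Y P : ℂ} (nA1 : A1 ≠ 0) (nA2 : A2 ≠ 0) (nC1 : C1 ≠ 0)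
    (nC2 : C2 ≠ 0) (ng : g ≠ 0) (nh : h ≠ 0) (nS : S ≠ 0) (nY : Y ≠ 0) (nP : P ≠ 0)
    (g1 : A1 * C2 * (Y ^ 2 - 1) = 2 * I * P ^ 2 * Y) (g2 : A2 * C1 * (Y ^ 2 + 1) = 2 * P ^ 2 * Y)
    (g3 : A1 * A2 * S = g * 2 * P) (g4 : C1 * C2 = h * S * P) :
    (Y⁻¹ * (S / 2 * A1) = 1 * (Y * (S / 2 * A1)) + -(I * P * S / h) * (S⁻¹ * C1)) ∧
    (Y⁻¹ * (-I * -(S * A2)) = 1 * (Y * (I * -(S * A2))) + -(I * P * S / h) * -(2 / S * C2)) ∧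
    (-Y ^ 2 * (S⁻¹ * C1) = -(Y ^ 2 * (2 / S) * P / g) * (Y * (S / 2 * A1)) + Y ^ 4 * (S⁻¹ * C1)) ∧
    (-Y ^ 2 * (-1 * -(2 / S * C2)) =
      -(Y ^ 2 * (2 / S) * P / g) * (Y * (I * -(S * A2))) + Y ^ 4 * -(2 / S * C2)) ∧
    (Y * (S / 2 * A1) * -(2 / S * C2) - Y * (I * -(S * A2)) * (S⁻¹ * C1) = -2 * (g * h)) := by
  -- In the application `A1, A2 = Γ(β/4), Γ(β/4+1/2)`, `C1, C2 = Γ(1/2-β/4), Γ(1-β/4)`, `g, h =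
  -- Γ(β/2), Γ(1-β/2)`, `S = 2^{β/2}`, `Y = e^{iπβ/4}`, `P = √π`. Eliminating one Gamma value from a
  -- reflection and a duplication formula gives the four linear relations needed.
  have k1 : S * A1 * (Y ^ 2 - 1) * h = 2 * I * P * C1 * Y :=
    mul_right_cancel₀ nC2 (by linear_combination S * h * g1 - 2 * I * P * Y * g4)
  have k2 : A2 * S * (Y ^ 2 + 1) * h = 2 * P * C2 * Y :=
    mul_right_cancel₀ nC1 (by linear_combination S * h * g2 - 2 * P * Y * g4)
  have k3 : P * A1 * S * Y = (1 + Y ^ 2) * C1 * g :=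
    mul_right_cancel₀ nA2 (by linear_combination P * Y * g3 - g * g2)
  have k4 : I * P * A2 * S * Y = (Y ^ 2 - 1) * C2 * g :=
    mul_right_cancel₀ nA1 (by linear_combination I * P * Y * g3 - g * g1)
  have n1 : Y ^ 2 - 1 ≠ 0 := fun h0 => by
    rw [h0, mul_zero] at g1
    exact mul_ne_zero (mul_ne_zero (mul_ne_zero two_ne_zero I_ne_zero) (pow_ne_zero 2 nP)) nY
      g1.symm
  have n2 : Y ^ 2 + 1 ≠ 0 := fun h0 => by
    rw [h0, mul_zero] at g2
    exact mul_ne_zero (mul_ne_zero two_ne_zero (pow_ne_zero 2 nP)) nY g2.symm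
  -- Reflection at `β/2`, recovered from the two reflections at quarter arguments; it evaluates the
  -- Wronskian.
  have k5 : g * h * ((Y ^ 2 - 1) * (Y ^ 2 + 1)) = 2 * I * P ^ 2 * Y ^ 2 := by
    refine mul_right_cancel₀ (mul_ne_zero two_ne_zero (pow_ne_zero 2 nP)) ?_
    refine mul_right_cancel₀ nS ?_
    linear_combination -(Y ^ 2 - 1) * (Y ^ 2 + 1) * (C1 * C2 * g3 + g * 2 * P * g4) +
      S * (A2 * C1 * (Y ^ 2 + 1) * g1 + 2 * I * P ^ 2 * Y * g2)
  refine ⟨?_, ?_, ?_, ?_, ?_⟩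
  · field_simp
    linear_combination -k1
  · field_simp
    linear_combination k2
  · field_simp
    linear_combination k3
  · field_simp
    linear_combination -k4
  · have k6 : Y * (-(A1 * C2) + I * (A2 * C1)) = -2 * (g * h) :=
      mul_right_cancel₀ (mul_ne_zero n1 n2) (by
        linear_combination 2 * k5 - Y * (Y ^ 2 + 1) * g1 + I * Y * (Y ^ 2 - 1) * g2)
    rw [← k6]
    field_simp
    ring

lemma Gamma_half_ne_zero {β : ℂ} (hβ : ∀ m : ℤ, β / 2 ≠ m) : Gamma (β / 2) ≠ 0 := Gamma_ne_zero fun m hm =>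
  hβ (-m) (by push_cast; linear_combination hm)

lemma Gamma_one_sub_half_ne_zero {β : ℂ} (hβ : ∀ m : ℤ, β / 2 ≠ m) : Gamma (1 - β / 2) ≠ 0 :=
  Gamma_ne_zero fun m hm => hβ (1 + m) (by push_cast; linear_combination -hm)

theorem exists_isBasis {β : ℂ} (hβ : ∀ m : ℤ, β / 2 ≠ m) : ∃ d d' e e', IsBasis β d d' e e' := by
  obtain ⟨F, F', hF⟩ := exists_isCylinder (s := β / 2) fun m hm => hβ (-m) (by push_cast; exact hm)
  obtain ⟨E, E', hE⟩ := exists_isCylinder (s := 1 - β / 2) fun m hm =>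
    hβ (m + 1) (by push_cast; linear_combination -hm)
  have h2s : 2 * (β / 2) = β := by ring
  set Y := exp (Real.pi * (β / 4) * I) with hY
  have hY0 : Y ≠ 0 := Complex.exp_ne_zero _
  have hX : exp (I * Real.pi * β / 2) = Y ^ 2 := by
    rw [hY, ← Complex.exp_nat_mul]; push_cast; ring_nf
  have hX2 : exp (I * Real.pi * β) = Y ^ 4 := by
    rw [hY, ← Complex.exp_nat_mul]; push_cast; ring_nf
  -- The four pure solutions are `Y F(ix)`, `Y⁻¹F(-ix)`, `e^{-x²}E(x)` and `-Y²e^{-x²}E(-x)`. The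
  -- prefactors make the leading coefficients `Γ(β/2)` or `Γ(1-β/2)` on the central rays `∓π/2`,
  -- `0`, `π` respectively.
  have hd := h2s ▸ hF.isWeber (c := I) I_sq Y
  have hd1 := h2s ▸ hF.isWeber (c := -I) (by simp) Y⁻¹
  have he := h2s ▸ hE.isWeber_exp (s := β / 2) (c := 1) (by simp) 1
  have he2 := h2s ▸ hE.isWeber_exp (s := β / 2) (c := -1) (by simp) (-Y ^ 2)
  have g1 := Gamma_half_mul hβ
  have g2 := Gamma_half_mul' hβ
  have g3 := Gamma_duplication (β := β)
  have g4 := Gamma_duplication' (β := β)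
  rw [← hY, ← sqrt_pi_sq] at g1 g2
  have hP0 := sqrt_pi_ne_zero
  have f0 := hF.at_zero
  have f0' := hF.at_zero'
  have e0 := hE.at_zero
  have e0' := hE.at_zero'
  have hS0 : (2 : ℂ) ^ (β / 2) ≠ 0 := by simp [cpow_eq_zero_iff]
  rw [show 1 - β / 2 - 1 = -(β / 2) by ring, cpow_neg] at e0
  rw [cpow_sub _ _ two_ne_zero, cpow_one] at f0 e0'
  have nA1 : Gamma (β / 2 / 2) ≠ 0 := Gamma_ne_zero fun m hm =>
    hβ (-(2 * m)) (by push_cast; linear_combination 2 * hm)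
  have nA2 : Gamma ((β / 2 + 1) / 2) ≠ 0 := Gamma_ne_zero fun m hm =>
    hβ (-(2 * m) - 1) (by push_cast; linear_combination 2 * hm)
  have nC1 : Gamma ((1 - β / 2) / 2) ≠ 0 := Gamma_ne_zero fun m hm =>
    hβ (1 + 2 * m) (by push_cast; linear_combination -2 * hm)
  have nC2 : Gamma ((1 - β / 2 + 1) / 2) ≠ 0 := Gamma_ne_zero fun m hm =>
    hβ (2 + 2 * m) (by push_cast; linear_combination -2 * hm)
  have ng := Gamma_half_ne_zero hβ
  have nh := Gamma_one_sub_half_ne_zero hβ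
  have hB : stokesB β = I * (Real.sqrt Real.pi : ℝ) * 2 ^ (β / 2) / Gamma (1 - β / 2) := rfl
  have hQ : stokesQ β = -(Y ^ 2 * (2 / 2 ^ (β / 2)) * (Real.sqrt Real.pi : ℝ) / Gamma (β / 2)) := by
    rw [stokesQ, hX]
  obtain ⟨c1, c2, c3, c4, c5⟩ :=
    connection_algebra nA1 nA2 nC1 nC2 ng nh hS0 hY0 hP0 g1 g2 g3 g4
  rw [← hB] at c1 c2
  rw [← hQ] at c3 c4
  obtain ⟨q1, q1'⟩ := hd1.eq (hd.comb he 1 (-stokesB β))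
    (by simpa only [mul_zero, f0, e0, zero_pow two_ne_zero, neg_zero, Complex.exp_zero, one_mul,
      div_mul_eq_mul_div] using c1)
    (by simpa only [mul_zero, f0', e0', zero_pow two_ne_zero, neg_zero, Complex.exp_zero, one_mul,
      div_mul_eq_mul_div, zero_mul, sub_zero] using c2)
  obtain ⟨q2, q2'⟩ := he2.eq (hd.comb he (stokesQ β) (exp (I * Real.pi * β)))
    (by simpa only [mul_zero, f0, e0, zero_pow two_ne_zero, neg_zero, Complex.exp_zero, one_mul,
      div_mul_eq_mul_div, hX2] using c3)
    (by simpa only [mul_zero, f0', e0', zero_pow two_ne_zero, neg_zero, Complex.exp_zero, one_mul,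
      div_mul_eq_mul_div, zero_mul, sub_zero, hX2] using c4)
  have hpi := Real.pi_pos
  have r : ∀ ψ : ℝ, ∀ c : ℂ, exp (ψ * I) = c → ∀ C : ℂ,
      AlgAsymp (β / 2) (fun x => C * F (c * x)) (fun x => C * (c * F' (c * x)))
        (C * exp (-(ψ * (β / 2) * I)) * Gamma (β / 2)) (-ψ) (3 * Real.pi / 4) :=
    fun ψ c hc C => hc ▸ hF.asymp.rotate ψ C
  have t : ∀ ψ : ℝ, ∀ c : ℂ, exp (ψ * I) = c → ∀ C : ℂ,
      AlgAsymp (1 - β / 2) (fun x => C * E (c * x)) (fun x => C * (c * E' (c * x)))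
        (C * exp (-(ψ * (1 - β / 2) * I)) * Gamma (1 - β / 2)) (-ψ) (3 * Real.pi / 4) :=
    fun ψ c hc C => hc ▸ hE.asymp.rotate ψ C
  have hI : exp ((Real.pi / 2 : ℝ) * I) = I := by push_cast; exact exp_pi_div_two_mul_I
  refine ⟨_, _, _, _, hd, he, ?_, ?_, ?_, ?_, ?_, ?_, ?_⟩
  · simpa only [mul_zero, f0, e0, f0', e0', zero_pow two_ne_zero, neg_zero, Complex.exp_zero,
      one_mul, div_mul_eq_mul_div, zero_mul, sub_zero] using c5
  · convert expAsymp_of_algAsymp (t 0 1 (by simp) 1) using 1 <;> simp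
  -- The same entire function on the next sheet: only the branch of `x^{β/2-1}` changes, which costs
  -- `e^{-iπβ}`.
  · convert expAsymp_of_algAsymp (t (-(2 * Real.pi)) 1 ?_ 1) using 1
    · rw [one_mul, ← Complex.exp_neg, ← Complex.exp_periodic (-(I * Real.pi * β))]
      push_cast
      ring_nf
    · simp
    · rw [← Complex.exp_two_pi_mul_I, ← Complex.exp_periodic.sub_eq (2 * Real.pi * I),
        ← Complex.exp_periodic.sub_eq (2 * Real.pi * I - 2 * Real.pi * I)]
      push_cast
      ring_nf
  · rw [← q2, ← q2']
    convert expAsymp_of_algAsymp (t (-Real.pi) (-1) ?_ (-Y ^ 2)) using 1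
    · rw [show exp (-((-Real.pi : ℝ) * (1 - β / 2) * I)) = -(Y ^ 2)⁻¹ by
        rw [← hX, ← Complex.exp_neg, ← Complex.exp_antiperiodic]
        push_cast
        ring_nf]
      field_simp
    · simp
    · rw [← Complex.exp_pi_mul_I, ← Complex.exp_periodic.sub_eq (Real.pi * I)]
      push_cast
      ring_nf
  · convert r (Real.pi / 2) I hI Y using 1
    rw [show exp (-((Real.pi / 2 : ℝ) * (β / 2) * I)) = Y⁻¹ by
      rw [hY, ← Complex.exp_neg]
      push_cast
      ring_nf]
    field_simp
  · convert r (-(3 * Real.pi / 2)) I ?_ Y using 1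
    · rw [hX2, show exp (-((-(3 * Real.pi / 2) : ℝ) * (β / 2) * I)) = Y ^ 3 by
        rw [hY, ← Complex.exp_nat_mul]
        push_cast
        ring_nf]
      ring
    · simp
    · refine Eq.trans ?_ hI
      rw [← Complex.exp_periodic.sub_eq ((Real.pi / 2 : ℝ) * I)]
      push_cast
      ring_nf
  · rw [← q1, ← q1']
    convert r (-(Real.pi / 2)) (-I) ?_ Y⁻¹ using 1
    · rw [show exp (-((-(Real.pi / 2) : ℝ) * (β / 2) * I)) = Y by
        rw [hY]
        push_cast
        ring_nf]
      field_simp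
    · simp
    · rw [ofReal_neg, neg_mul, Complex.exp_neg, hI, inv_I]

end P4

end

noncomputable section

open Topology Asymptotics Set MeasureTheory

namespace P4

/-! ### Asymptotics of the general solution in the four sectors -/

section

variable {β s K K₁ K₂ : ℂ} {z z' z₁ z₁' z₂ z₂' d d' e e' : ℂ → ℂ} {θ₀ w : ℝ}

lemma exp_sq_mul_exp_neg (x y : ℂ) : exp (-(1 * x ^ 2)) * (exp (x ^ 2) * y) = y := by
  rw [← mul_assoc, ← Complex.exp_add]
  simp

/-- Where `e^{-x²}` decays, an exponential solution is an algebraic one with leading coefficient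
zero, so it can be added freely. The next lemma is the same with the roles exchanged. -/
lemma ExpAsymp.recessive (h : ExpAsymp s z z' K θ₀ (Real.pi / 4)) (hθ : exp (-(2 * θ₀ * I)) = 1) :
    AlgAsymp s z z' 0 θ₀ (Real.pi / 4) := by
  convert AlgAsymp.recessive h hθ.symm s (-2) using 1
  · funext x
    rw [exp_sq_mul_exp_neg]
  · funext x
    rw [show exp (x ^ 2) * (z' x + 2 * x * z x) + -2 * x * (exp (x ^ 2) * z x) =
      exp (x ^ 2) * z' x by ring, exp_sq_mul_exp_neg]

lemma AlgAsymp.recessive_exp (h : AlgAsymp s z z' K θ₀ (Real.pi / 4))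
    (hθ : exp (-(2 * θ₀ * I)) = -1) : ExpAsymp s z z' 0 θ₀ (Real.pi / 4) := by
  have := AlgAsymp.recessive h hθ.symm (1 - s) 2
  unfold ExpAsymp
  simpa only [neg_one_mul, neg_neg] using this

lemma ExpAsymp.comb (h₁ : ExpAsymp s z₁ z₁' K₁ θ₀ w) (h₂ : ExpAsymp s z₂ z₂' K₂ θ₀ w) (a b : ℂ) :
    ExpAsymp s (fun x => a * z₁ x + b * z₂ x) (fun x => a * z₁' x + b * z₂' x)
      (a * K₁ + b * K₂) θ₀ w := by
  unfold ExpAsymp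
  convert AlgAsymp.comb h₁ h₂ a b using 1 <;>
  · funext x
    ring

namespace IsBasis

lemma alg_comb_zero (H : IsBasis β d d' e e') (a b : ℂ) :
    AlgAsymp (β / 2) (fun x => a * d x + b * e x) (fun x => a * d' x + b * e' x)
      (a * Gamma (β / 2)) 0 (Real.pi / 4) := by
  have hpi := Real.pi_pos
  have h1 : AlgAsymp (β / 2) d d' (Gamma (β / 2)) 0 (Real.pi / 4) :=
    H.alg_neg.mono (by rw [abs_of_pos (by linarith)]; linarith)
  have h2 : ExpAsymp (β / 2) e e' (Gamma (1 - β / 2)) 0 (Real.pi / 4) :=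
    AlgAsymp.mono H.exp_zero (by rw [sub_self, abs_zero]; linarith)
  simpa using h1.comb (h2.recessive (by simp)) a b

/-- Write `a d + b e = a(d - Be) + (b + aB)e`; the first part is recessive about the positive
imaginary axis. -/
lemma exp_comb_half (H : IsBasis β d d' e e') (a b : ℂ) :
    ExpAsymp (β / 2) (fun x => a * d x + b * e x) (fun x => a * d' x + b * e' x)
      ((b + a * stokesB β) * Gamma (1 - β / 2)) (Real.pi / 2) (Real.pi / 4) := by
  have hpi := Real.pi_pos
  have h1 : AlgAsymp (β / 2) (fun x => 1 * d x + -stokesB β * e x)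
      (fun x => 1 * d' x + -stokesB β * e' x) (Gamma (β / 2)) (Real.pi / 2) (Real.pi / 4) :=
    H.alg_half.mono (by rw [sub_self, abs_zero]; linarith)
  have h2 : ExpAsymp (β / 2) e e' (Gamma (1 - β / 2)) (Real.pi / 2) (Real.pi / 4) :=
    AlgAsymp.mono H.exp_zero (by rw [abs_of_pos (by linarith)]; linarith)
  have h3 : exp (-(2 * (Real.pi / 2 : ℝ) * I)) = -1 := by
    rw [← Complex.exp_pi_mul_I, ← Complex.exp_periodic.sub_eq (Real.pi * I)]
    push_cast
    ring_nf
  convert (h1.recessive_exp h3).comb h2 a (b + a * stokesB β) using 1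
  · funext x; ring
  · funext x; ring
  · ring

/-- About the negative axis the sectors of `d` and `d - Be` overlap; both are algebraic there, and
`e` is expressed through their difference. -/
lemma alg_comb_pi (H : IsBasis β d d' e e') (hB : stokesB β ≠ 0) (a b : ℂ) :
    AlgAsymp (β / 2) (fun x => a * d x + b * e x) (fun x => a * d' x + b * e' x)
      (((a + b / stokesB β) * exp (I * Real.pi * β) - b / stokesB β) * Gamma (β / 2))
      Real.pi (Real.pi / 4) := by
  have hpi := Real.pi_pos
  have h1 : AlgAsymp (β / 2) d d' (exp (I * Real.pi * β) * Gamma (β / 2)) Real.pi (Real.pi / 4) :=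
    H.alg_pos.mono (by rw [abs_of_neg (by linarith)]; linarith)
  have h2 : AlgAsymp (β / 2) (fun x => 1 * d x + -stokesB β * e x)
      (fun x => 1 * d' x + -stokesB β * e' x) (Gamma (β / 2)) Real.pi (Real.pi / 4) :=
    H.alg_half.mono (by rw [abs_of_pos (by linarith)]; linarith)
  convert h1.comb h2 (a + b / stokesB β) (-(b / stokesB β)) using 1
  · funext x; field_simp; ring
  · funext x; field_simp; ring
  · ring

/-- Here `d` is recessive, and `e` is taken from the sheet about `arg x = 2π`. -/
lemma exp_comb_three_half (H : IsBasis β d d' e e') (a b : ℂ) :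
    ExpAsymp (β / 2) (fun x => a * d x + b * e x) (fun x => a * d' x + b * e' x)
      (b * ((exp (I * Real.pi * β))⁻¹ * Gamma (1 - β / 2))) (3 * Real.pi / 2) (Real.pi / 4) := by
  have hpi := Real.pi_pos
  have h1 : AlgAsymp (β / 2) d d' (exp (I * Real.pi * β) * Gamma (β / 2))
      (3 * Real.pi / 2) (Real.pi / 4) :=
    H.alg_pos.mono (by rw [sub_self, abs_zero]; linarith)
  have h2 : ExpAsymp (β / 2) e e' ((exp (I * Real.pi * β))⁻¹ * Gamma (1 - β / 2))
      (3 * Real.pi / 2) (Real.pi / 4) :=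
    AlgAsymp.mono H.exp_two_pi (by rw [abs_of_neg (by linarith)]; linarith)
  have h3 : exp (-(2 * (3 * Real.pi / 2 : ℝ) * I)) = -1 := by
    rw [← Complex.exp_pi_mul_I, ← Complex.exp_periodic.sub_eq (Real.pi * I),
      ← Complex.exp_periodic.sub_eq (Real.pi * I - 2 * Real.pi * I)]
    push_cast
    ring_nf
  simpa using (h1.recessive_exp h3).comb h2 a b

/-- The condition says that the combination is a multiple of the solution that is exponential about
`π`. -/
lemma exp_comb_pi (H : IsBasis β d d' e e') (hQ : stokesQ β ≠ 0) {a b : ℂ}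
    (hab : b * stokesQ β = a * exp (I * Real.pi * β)) :
    ExpAsymp (β / 2) (fun x => a * d x + b * e x) (fun x => a * d' x + b * e' x)
      (a / stokesQ β * Gamma (1 - β / 2)) Real.pi (Real.pi / 4) := by
  have hpi := Real.pi_pos
  have h1 : ExpAsymp (β / 2) (fun x => stokesQ β * d x + exp (I * Real.pi * β) * e x)
      (fun x => stokesQ β * d' x + exp (I * Real.pi * β) * e' x) (Gamma (1 - β / 2))
      Real.pi (Real.pi / 4) :=
    AlgAsymp.mono H.exp_pi (by rw [sub_self, abs_zero]; linarith)
  convert h1.comb h1 (a / stokesQ β) 0 using 1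
  · funext x; field_simp; linear_combination (e x) * hab
  · funext x; field_simp; linear_combination (e' x) * hab
  · ring

lemma isWeber_comb (H : IsBasis β d d' e e') (a b : ℂ) :
    IsWeber β (fun x => a * d x + b * e x) (fun x => a * d' x + b * e' x) :=
  H.weber_d.comb H.weber_e a b

lemma wronskian_comb (H : IsBasis β d d' e e') (a₁ b₁ a₂ b₂ : ℂ) :
    (a₁ * d 0 + b₁ * e 0) * (a₂ * d' 0 + b₂ * e' 0) -
      (a₁ * d' 0 + b₁ * e' 0) * (a₂ * d 0 + b₂ * e 0) =
      (a₁ * b₂ - b₁ * a₂) * (-2 * (Gamma (β / 2) * Gamma (1 - β / 2))) := by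
  rw [← H.wronskian]
  ring

end IsBasis

/-- If both initial values vanished, so would the Wronskians with `d` and with `e`, and these are
nonzero multiples of the coefficients. -/
lemma IsBasis.isSeed_comb (hβ : ∀ m : ℤ, β / 2 ≠ m) (H : IsBasis β d d' e e') {a b : ℂ}
    (hab : a ≠ 0 ∨ b ≠ 0) : IsSeed β (fun x => a * d x + b * e x) := by
  refine (H.isWeber_comb a b).isSeed ?_
  by_contra! hc
  have hW := mul_ne_zero (Gamma_half_ne_zero hβ) (Gamma_one_sub_half_ne_zero hβ)
  have h1 := H.wronskian_comb a b 0 1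
  have h2 := H.wronskian_comb a b 1 0
  simp only [hc.1, hc.2] at h1 h2
  rcases hab with ha | hb
  · exact mul_ne_zero ha hW (by linear_combination h1 / 2)
  · exact mul_ne_zero hb hW (by linear_combination -h2 / 2)

/-- The member of the ladder which starts from `a d + b e`. -/
def member (β : ℂ) (n : ℕ) (d e : ℂ → ℂ) (a b : ℂ) : ℂ → ℂ :=
  ladder β (riccati fun x => a * d x + b * e x) n

lemma Theta_of_neg {s : ℝ} (hs : s < 0) : Theta s = 0 := by simp [Theta, hs]

lemma Theta_zero : Theta 0 = 1 / 2 := by simp [Theta]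

lemma Theta_of_pos {s : ℝ} (hs : 0 < s) : Theta s = 1 := by simp [Theta, hs.ne', hs.not_gt]

variable {a b am bm ap bp Ky Km Kp μm μp : ℂ} {μ : ℝ → ℂ} {n : ℕ}

/-- A multiplier is an elementary factor times the Wronskian with the background, divided by the two
leading coefficients; `hμm` and `hμp` state this with denominators cleared. -/
lemma IsBasis.perturbed_alg (hβ : ∀ m : ℤ, β / 2 ≠ m) (H : IsBasis β d d' e e')
    (hab : a ≠ 0 ∨ b ≠ 0) (habm : am ≠ 0 ∨ bm ≠ 0) (habp : ap ≠ 0 ∨ bp ≠ 0)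
    (hy : AlgAsymp (β / 2) (fun x => a * d x + b * e x) (fun x => a * d' x + b * e' x) Ky θ₀
      (Real.pi / 4))
    (hm : AlgAsymp (β / 2) (fun x => am * d x + bm * e x) (fun x => am * d' x + bm * e' x) Km θ₀
      (Real.pi / 4))
    (hp : AlgAsymp (β / 2) (fun x => ap * d x + bp * e x) (fun x => ap * d' x + bp * e' x) Kp θ₀
      (Real.pi / 4))
    (nKy : Ky ≠ 0) (nKm : Km ≠ 0) (nKp : Kp ≠ 0)
    (hμm : 2 ^ n / n.factorial * ((am * b - bm * a) * (-2 * (Gamma (β / 2) * Gamma (1 - β / 2)))) =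
      μm * (Km * Ky))
    (hμp : 2 ^ n / n.factorial * ((ap * b - bp * a) * (-2 * (Gamma (β / 2) * Gamma (1 - β / 2)))) =
      μp * (Kp * Ky))
    (h1 : ∀ θ < θ₀, μ θ = μm) (h2 : μ θ₀ = (μm + μp) / 2) (h3 : ∀ θ > θ₀, μ θ = μp) :
    Perturbed (member β n d e a b) (member β n d e am bm) (member β n d e ap bp) μ (EMinus n β)
      θ₀ := by
  refine perturbed_of_rel (fun δ hδ => ?_) (fun δ hδ => ?_) h1 h2 h3
  · have := hm.rel_ladder_sub hβ (H.isWeber_comb am bm) (H.isWeber_comb a b)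
      (H.isSeed_comb hβ habm) (H.isSeed_comb hβ hab) hy nKm nKy hδ n
    rwa [H.wronskian_comb, ← mul_div_assoc, hμm,
      mul_div_cancel_right₀ _ (mul_ne_zero nKm nKy)] at this
  · have := hp.rel_ladder_sub hβ (H.isWeber_comb ap bp) (H.isWeber_comb a b)
      (H.isSeed_comb hβ habp) (H.isSeed_comb hβ hab) hy nKp nKy hδ n
    rwa [H.wronskian_comb, ← mul_div_assoc, hμp,
      mul_div_cancel_right₀ _ (mul_ne_zero nKp nKy)] at this

lemma IsBasis.perturbed_exp (hβ : ∀ m : ℤ, β / 2 ≠ m) (H : IsBasis β d d' e e')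
    (hab : a ≠ 0 ∨ b ≠ 0) (habm : am ≠ 0 ∨ bm ≠ 0) (habp : ap ≠ 0 ∨ bp ≠ 0)
    (hy : ExpAsymp (β / 2) (fun x => a * d x + b * e x) (fun x => a * d' x + b * e' x) Ky θ₀
      (Real.pi / 4))
    (hm : ExpAsymp (β / 2) (fun x => am * d x + bm * e x) (fun x => am * d' x + bm * e' x) Km θ₀
      (Real.pi / 4))
    (hp : ExpAsymp (β / 2) (fun x => ap * d x + bp * e x) (fun x => ap * d' x + bp * e' x) Kp θ₀
      (Real.pi / 4))
    (nKy : Ky ≠ 0) (nKm : Km ≠ 0) (nKp : Kp ≠ 0)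
    (hμm : 4 ^ n * Gamma (1 - β / 2) / (n.factorial * Gamma (n + 1 - β / 2)) *
      ((am * b - bm * a) * (-2 * (Gamma (β / 2) * Gamma (1 - β / 2)))) = μm * (Km * Ky))
    (hμp : 4 ^ n * Gamma (1 - β / 2) / (n.factorial * Gamma (n + 1 - β / 2)) *
      ((ap * b - bp * a) * (-2 * (Gamma (β / 2) * Gamma (1 - β / 2)))) = μp * (Kp * Ky))
    (h1 : ∀ θ < θ₀, μ θ = μm) (h2 : μ θ₀ = (μm + μp) / 2) (h3 : ∀ θ > θ₀, μ θ = μp) :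
    Perturbed (member β n d e a b) (member β n d e am bm) (member β n d e ap bp) μ (EPlus n β)
      θ₀ := by
  refine perturbed_of_rel (fun δ hδ => ?_) (fun δ hδ => ?_) h1 h2 h3
  · have := hm.rel_ladder_sub hβ (H.isWeber_comb am bm) (H.isWeber_comb a b)
      (H.isSeed_comb hβ habm) (H.isSeed_comb hβ hab) hy nKm nKy hδ n
    rwa [H.wronskian_comb, ← mul_div_assoc, hμm,
      mul_div_cancel_right₀ _ (mul_ne_zero nKm nKy)] at this
  · have := hp.rel_ladder_sub hβ (H.isWeber_comb ap bp) (H.isWeber_comb a b)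
      (H.isSeed_comb hβ habp) (H.isSeed_comb hβ hab) hy nKp nKy hδ n
    rwa [H.wronskian_comb, ← mul_div_assoc, hμp,
      mul_div_cancel_right₀ _ (mul_ne_zero nKp nKy)] at this

end

end P4

end

noncomputable section

open Topology Asymptotics Set MeasureTheory

namespace P4

/-! ### The multipliers -/

section

variable {β a b c κ : ℂ} {d d' e e' : ℂ → ℂ} {n : ℕ}

lemma exp_I_pi_mul : exp (I * Real.pi * β) = exp (I * Real.pi * β / 2) ^ 2 := by
  rw [← Complex.exp_nat_mul]
  push_cast
  ring_nf

lemma Gamma_reflection_half (hβ : ∀ m : ℤ, β / 2 ≠ m) :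
    Gamma (β / 2) * Gamma (1 - β / 2) * (exp (I * Real.pi * β / 2) ^ 2 - 1) =
      2 * I * (Real.sqrt Real.pi : ℂ) ^ 2 * exp (I * Real.pi * β / 2) := by
  have := Gamma_reflection hβ
  rwa [sqrt_pi_sq, show I * Real.pi * β / 2 = Real.pi * (β / 2) * I by ring]

lemma exp_sub_one_ne_zero (hβ : ∀ m : ℤ, β / 2 ≠ m) : exp (I * Real.pi * β / 2) ^ 2 - 1 ≠ 0 := by
  intro h0
  have := Gamma_reflection_half hβ
  rw [h0, mul_zero] at this
  exact mul_ne_zero (mul_ne_zero (mul_ne_zero two_ne_zero I_ne_zero)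
    (pow_ne_zero 2 sqrt_pi_ne_zero)) (Complex.exp_ne_zero _) this.symm

lemma two_cpow_ne_zero (x : ℂ) : (2 : ℂ) ^ x ≠ 0 := by simp [cpow_eq_zero_iff]

lemma two_cpow_minus : (2 : ℂ) ^ (n + β / 2) = 2 ^ n * 2 ^ (β / 2) := by
  rw [cpow_add _ _ two_ne_zero, cpow_natCast]

lemma two_cpow_plus : (2 : ℂ) ^ (2 * n + 1 - β / 2) = 4 ^ n * 2 / 2 ^ (β / 2) := by
  rw [cpow_sub _ _ two_ne_zero, cpow_add _ _ two_ne_zero, cpow_one,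
    show (2 * n : ℂ) = ((2 * n : ℕ) : ℂ) by push_cast; ring, cpow_natCast, pow_mul]
  norm_num

lemma stokesB_eq : stokesB β = I * (Real.sqrt Real.pi : ℂ) * 2 ^ (β / 2) / Gamma (1 - β / 2) := rfl

lemma stokesB_ne_zero (hβ : ∀ m : ℤ, β / 2 ≠ m) : stokesB β ≠ 0 :=
  div_ne_zero (mul_ne_zero (mul_ne_zero I_ne_zero sqrt_pi_ne_zero) (two_cpow_ne_zero _))
    (Gamma_one_sub_half_ne_zero hβ)

lemma stokesQ_ne_zero (hβ : ∀ m : ℤ, β / 2 ≠ m) : stokesQ β ≠ 0 :=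
  neg_ne_zero.2 (div_ne_zero (mul_ne_zero (mul_ne_zero (Complex.exp_ne_zero _)
    (div_ne_zero two_ne_zero (two_cpow_ne_zero _))) sqrt_pi_ne_zero) (Gamma_half_ne_zero hβ))

/-- This is the reflection formula. It makes the leading coefficient of the exponential solution
about `π` equal to `Γ(1-β/2)` on the positive imaginary axis too. -/
lemma stokesQ_mul_stokesB (hβ : ∀ m : ℤ, β / 2 ≠ m) :
    stokesQ β * stokesB β = 1 - exp (I * Real.pi * β / 2) ^ 2 := by
  have h1 := Gamma_reflection_half hβ
  have ng := Gamma_half_ne_zero hβ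
  have nh := Gamma_one_sub_half_ne_zero hβ
  have nS := two_cpow_ne_zero (β / 2)
  rw [stokesB_eq, stokesQ]
  generalize Gamma (1 - β / 2) = h at *
  generalize Gamma (β / 2) = g at *
  generalize exp (I * Real.pi * β / 2) = X at *
  field_simp
  linear_combination h1

lemma natCast_factorial_ne_zero : (n.factorial : ℂ) ≠ 0 := Nat.cast_ne_zero.2 n.factorial_ne_zero

lemma Gamma_natCast_add_ne_zero (hβ : ∀ m : ℤ, β / 2 ≠ m) : Gamma (n + 1 - β / 2) ≠ 0 :=
  Gamma_ne_zero fun m hm => hβ (n + 1 + m) (by push_cast; linear_combination -hm)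

variable (hβ : ∀ m : ℤ, β / 2 ≠ m) (H : IsBasis β d d' e e')
include hβ H

/-- The Wronskians with the two backgrounds are proportional to `b` and `b + B`. In units of
`2^{β/2}/Γ(1-β/2)` these are `c` and `c + i√π`, whence the Stokes jump. -/
theorem IsBasis.perturbed_zero (hb : b * Gamma (1 - β / 2) = c * 2 ^ (β / 2)) :
    Perturbed (member β n d e 1 b) (member β n d e 1 0) (member β n d e 1 (-stokesB β))
      (mu1 n β c) (EMinus n β) 0 := by
  have ng := Gamma_half_ne_zero hβ
  have nh := Gamma_one_sub_half_ne_zero hβ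
  have nN := natCast_factorial_ne_zero (n := n)
  refine H.perturbed_alg hβ (by simp) (by simp) (by simp) (H.alg_comb_zero _ _)
    (H.alg_comb_zero _ _) (H.alg_comb_zero _ _) (by simpa) (by simpa) (by simpa)
    (μm := -2 * (c + iSqrtPi * 0) * ((2 : ℂ) ^ (n + β / 2) / (n.factorial * Gamma (β / 2))))
    (μp := -2 * (c + iSqrtPi * 1) * ((2 : ℂ) ^ (n + β / 2) / (n.factorial * Gamma (β / 2))))
    ?_ ?_ (fun θ hθ => ?_) ?_ (fun θ hθ => ?_)
  · rw [two_cpow_minus]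
    generalize Gamma (1 - β / 2) = h at *
    field_simp
    linear_combination -hb
  · rw [two_cpow_minus, stokesB_eq, iSqrtPi]
    generalize Gamma (1 - β / 2) = h at *
    field_simp
    linear_combination -hb
  · rw [mu1, Theta_of_neg hθ, ofReal_zero]
  · rw [mu1, Theta_zero]
    push_cast
    ring
  · rw [mu1, Theta_of_pos hθ, ofReal_one]

theorem IsBasis.perturbed_half (hab : b + a * stokesB β ≠ 0)
    (hκ : κ * ((exp (I * Real.pi * β / 2) ^ 2 - 1) * ((b + a * stokesB β) * Gamma (1 - β / 2))) =
      iSqrtPi * 2 ^ (β / 2) * a) :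
    Perturbed (member β n d e a b) (member β n d e 0 1)
      (member β n d e (stokesQ β) (exp (I * Real.pi * β))) (mu2 n β κ) (EPlus n β)
      (Real.pi / 2) := by
  have ng := Gamma_half_ne_zero hβ
  have nh := Gamma_one_sub_half_ne_zero hβ
  have nN := natCast_factorial_ne_zero (n := n)
  have nG := Gamma_natCast_add_ne_zero (n := n) hβ
  have nS := two_cpow_ne_zero (β / 2)
  have nX := Complex.exp_ne_zero (I * Real.pi * β / 2)
  have nX1 := exp_sub_one_ne_zero hβ
  have hg := Gamma_reflection_half hβ
  have hQB := stokesQ_mul_stokesB hβ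
  have hB : stokesB β * Gamma (1 - β / 2) = iSqrtPi * 2 ^ (β / 2) := div_mul_cancel₀ _ nh
  have hQ : stokesQ β * (2 ^ (β / 2) * Gamma (β / 2)) =
      -(2 * exp (I * Real.pi * β / 2) * (Real.sqrt Real.pi : ℂ)) := by
    rw [stokesQ]
    field_simp
  -- The reflection formula trades `Γ(β/2)` for `Γ(1-β/2)` and the exponential denominator of `κ`.
  have k : a * Gamma (β / 2) * 2 ^ (β / 2) =
      2 * (Real.sqrt Real.pi : ℂ) * κ * exp (I * Real.pi * β / 2) *
        (b + a * stokesB β) := mul_right_cancel₀ (mul_ne_zero nh nX1) (by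
    rw [iSqrtPi] at hκ
    linear_combination a * 2 ^ (β / 2) * hg -
      2 * (Real.sqrt Real.pi : ℂ) * exp (I * Real.pi * β / 2) * hκ)
  have hp := H.exp_comb_half (stokesQ β) (exp (I * Real.pi * β))
  rw [show exp (I * Real.pi * β) + stokesQ β * stokesB β = 1 by rw [hQB, exp_I_pi_mul]; ring] at hp
  have hor : a ≠ 0 ∨ b ≠ 0 := by
    by_contra! h0
    exact hab (by rw [h0.1, h0.2]; ring)
  refine H.perturbed_exp hβ hor (by simp) (by simp) (H.exp_comb_half _ _)
    (H.exp_comb_half _ _) hp (mul_ne_zero hab nh) (by simpa) (by simpa)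
    (μm := 2 * (Real.sqrt Real.pi : ℂ) * (κ + 0) * exp (I * Real.pi * β / 2) *
      ((2 : ℂ) ^ (2 * n + 1 - β / 2) / (n.factorial * Gamma (n + 1 - β / 2))))
    (μp := 2 * (Real.sqrt Real.pi : ℂ) * (κ + 1) * exp (I * Real.pi * β / 2) *
      ((2 : ℂ) ^ (2 * n + 1 - β / 2) / (n.factorial * Gamma (n + 1 - β / 2))))
    ?_ ?_ (fun θ hθ => ?_) ?_ (fun θ hθ => ?_)
  · rw [two_cpow_plus]
    generalize Gamma (1 - β / 2) = h at *
    generalize Gamma (β / 2) = g at *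
    generalize Gamma (n + 1 - β / 2) = G at *
    generalize exp (I * Real.pi * β / 2) = X at *
    generalize (2 : ℂ) ^ (β / 2) = S at *
    field_simp
    linear_combination k
  · rw [two_cpow_plus, exp_I_pi_mul]
    generalize Gamma (1 - β / 2) = h at *
    generalize Gamma (β / 2) = g at *
    generalize Gamma (n + 1 - β / 2) = G at *
    generalize exp (I * Real.pi * β / 2) = X at *
    generalize (2 : ℂ) ^ (β / 2) = S at *
    field_simp
    linear_combination k - b * hQ + (a * S * g) * hQB - (a * stokesB β) * hQ
  · rw [mu2, Theta_of_neg (by linarith), ofReal_zero]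
  · rw [mu2, sub_self, Theta_zero]
    push_cast
    ring
  · rw [mu2, Theta_of_pos (by linarith), ofReal_one]

theorem IsBasis.perturbed_pi (hab : (b + a * stokesB β) * exp (I * Real.pi * β / 2) ^ 2 - b ≠ 0)
    (hκ : κ * ((b + a * stokesB β) * exp (I * Real.pi * β / 2) ^ 2 - b) =
      (b + a * stokesB β) * exp (I * Real.pi * β / 2) ^ 2) :
    Perturbed (member β n d e a b) (member β n d e 1 (-stokesB β)) (member β n d e 1 0)
      (mu3 n β κ) (EMinus n β) Real.pi := by
  have ng := Gamma_half_ne_zero hβ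
  have nh := Gamma_one_sub_half_ne_zero hβ
  have nN := natCast_factorial_ne_zero (n := n)
  have nS := two_cpow_ne_zero (β / 2)
  have nX := Complex.exp_ne_zero (I * Real.pi * β / 2)
  have nB := stokesB_ne_zero hβ
  have hB : stokesB β * Gamma (1 - β / 2) = iSqrtPi * 2 ^ (β / 2) := div_mul_cancel₀ _ nh
  have hy := H.alg_comb_pi nB a b
  have hm := H.alg_comb_pi nB 1 (-stokesB β)
  have hp := H.alg_comb_pi nB 1 0
  -- Over the common denominator `B` the leading coefficient shows the numerator that is assumed
  -- nonzero and divides `κ`.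
  rw [show ((a + b / stokesB β) * exp (I * Real.pi * β) - b / stokesB β) =
    ((b + a * stokesB β) * exp (I * Real.pi * β / 2) ^ 2 - b) / stokesB β by
      rw [exp_I_pi_mul]; field_simp; ring] at hy
  rw [neg_div, div_self nB, add_neg_cancel, zero_mul, sub_neg_eq_add, zero_add, one_mul] at hm
  rw [zero_div, add_zero, one_mul, sub_zero, exp_I_pi_mul] at hp
  have hor : a ≠ 0 ∨ b ≠ 0 := by
    by_contra! h0
    exact hab (by rw [h0.1, h0.2]; ring)
  refine H.perturbed_alg hβ hor (by simp) (by simp) hy hm hp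
    (mul_ne_zero (div_ne_zero hab nB) ng) ng (mul_ne_zero (pow_ne_zero 2 nX) ng)
    (μm := -2 * iSqrtPi * (κ - 0) * exp (-(I * Real.pi * β)) *
      ((2 : ℂ) ^ (n + β / 2) / (n.factorial * Gamma (β / 2))))
    (μp := -2 * iSqrtPi * (κ - 1) * exp (-(I * Real.pi * β)) *
      ((2 : ℂ) ^ (n + β / 2) / (n.factorial * Gamma (β / 2))))
    ?_ ?_ (fun θ hθ => ?_) ?_ (fun θ hθ => ?_)
  · rw [two_cpow_minus, Complex.exp_neg, exp_I_pi_mul]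
    generalize Gamma (1 - β / 2) = h at *
    generalize Gamma (β / 2) = g at *
    generalize Gamma (n + 1 - β / 2) = G at *
    generalize exp (I * Real.pi * β / 2) = X at *
    generalize (2 : ℂ) ^ (β / 2) = S at *
    field_simp
    linear_combination (stokesB β * h) * hκ - κ * ((b + a * stokesB β) * X ^ 2 - b) * hB
  · rw [two_cpow_minus, Complex.exp_neg, exp_I_pi_mul]
    generalize Gamma (1 - β / 2) = h at *
    generalize Gamma (β / 2) = g at *
    generalize Gamma (n + 1 - β / 2) = G at *
    generalize exp (I * Real.pi * β / 2) = X at *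
    generalize (2 : ℂ) ^ (β / 2) = S at *
    field_simp
    linear_combination (stokesB β * h) * hκ - (κ - 1) * ((b + a * stokesB β) * X ^ 2 - b) * hB
  · rw [mu3, Theta_of_neg (by linarith), ofReal_zero]
  · rw [mu3, sub_self, Theta_zero]
    push_cast
    ring
  · rw [mu3, Theta_of_pos (by linarith), ofReal_one]

theorem IsBasis.perturbed_three_half (hb : b ≠ 0)
    (hκ : κ * (b * Gamma (1 - β / 2) * (exp (I * Real.pi * β / 2) ^ 2 - 1)) =
      iSqrtPi * 2 ^ (β / 2) * a * exp (I * Real.pi * β / 2) ^ 2) :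
    Perturbed (member β n d e a b) (member β n d e (stokesQ β) (exp (I * Real.pi * β)))
      (member β n d e 0 1) (mu4 n β κ) (EPlus n β) (3 * Real.pi / 2) := by
  have ng := Gamma_half_ne_zero hβ
  have nh := Gamma_one_sub_half_ne_zero hβ
  have nN := natCast_factorial_ne_zero (n := n)
  have nG := Gamma_natCast_add_ne_zero (n := n) hβ
  have nS := two_cpow_ne_zero (β / 2)
  have nX := Complex.exp_ne_zero (I * Real.pi * β / 2)
  have nX1 := exp_sub_one_ne_zero hβ
  have hg := Gamma_reflection_half hβ
  have hX3 : exp (I * (3 * Real.pi * β / 2)) = exp (I * Real.pi * β / 2) ^ 3 := by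
    rw [← Complex.exp_nat_mul]
    push_cast
    ring_nf
  have hQ : stokesQ β * (2 ^ (β / 2) * Gamma (β / 2)) =
      -(2 * exp (I * Real.pi * β / 2) * (Real.sqrt Real.pi : ℂ)) := by
    rw [stokesQ]
    field_simp
  have k : exp (I * Real.pi * β / 2) * a * Gamma (β / 2) * 2 ^ (β / 2) =
      2 * (Real.sqrt Real.pi : ℂ) * κ * b := mul_right_cancel₀ (mul_ne_zero nh nX1) (by
    rw [iSqrtPi] at hκ
    linear_combination exp (I * Real.pi * β / 2) * a * 2 ^ (β / 2) * hg -
      2 * (Real.sqrt Real.pi : ℂ) * hκ)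
  refine H.perturbed_exp hβ (Or.inr hb) (by simp) (by simp) (H.exp_comb_three_half _ _)
    (H.exp_comb_three_half _ _) (H.exp_comb_three_half _ _) (by simp [hb, nh]) (by simp [nh])
    (by simp [nh])
    -- The argument of `Theta` in `mu4` is reversed, so the unit jump belongs to the side below the
    -- ray.
    (μm := 2 * (Real.sqrt Real.pi : ℂ) * (κ + 1) * exp (I * (3 * Real.pi * β / 2)) *
      ((2 : ℂ) ^ (2 * n + 1 - β / 2) / (n.factorial * Gamma (n + 1 - β / 2))))
    (μp := 2 * (Real.sqrt Real.pi : ℂ) * (κ + 0) * exp (I * (3 * Real.pi * β / 2)) *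
      ((2 : ℂ) ^ (2 * n + 1 - β / 2) / (n.factorial * Gamma (n + 1 - β / 2))))
    ?_ ?_ (fun θ hθ => ?_) ?_ (fun θ hθ => ?_)
  · rw [two_cpow_plus, hX3, exp_I_pi_mul]
    generalize Gamma (1 - β / 2) = h at *
    generalize Gamma (β / 2) = g at *
    generalize Gamma (n + 1 - β / 2) = G at *
    generalize exp (I * Real.pi * β / 2) = X at *
    generalize (2 : ℂ) ^ (β / 2) = S at *
    field_simp
    linear_combination X * k - b * hQ
  · rw [two_cpow_plus, hX3, exp_I_pi_mul]
    generalize Gamma (1 - β / 2) = h at *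
    generalize Gamma (β / 2) = g at *
    generalize Gamma (n + 1 - β / 2) = G at *
    generalize exp (I * Real.pi * β / 2) = X at *
    generalize (2 : ℂ) ^ (β / 2) = S at *
    field_simp
    linear_combination k
  · rw [mu4, Theta_of_pos (by linarith), ofReal_one]
  · rw [mu4, sub_self, Theta_zero]
    push_cast
    ring
  · rw [mu4, Theta_of_neg (by linarith), ofReal_zero]

end

end P4

end

noncomputable section

open Topology Asymptotics Set MeasureTheory

namespace P4

/-! ### The family `y_c` and its backgrounds -/

section

variable {β a b c : ℂ} {d d' e e' : ℂ → ℂ} (n : ℕ)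

lemma IsBasis.isSolution_member (hβ : ∀ m : ℤ, β / 2 ≠ m) (H : IsBasis β d d' e e')
    (hab : a ≠ 0 ∨ b ≠ 0) : IsSolution (1 / 2 + n) β (member β n d e a b) :=
  (H.isSeed_comb hβ hab).isSolution hβ n

lemma IsBasis.isClassical_member (hβ : ∀ m : ℤ, β / 2 ≠ m) (H : IsBasis β d d' e e')
    (hab : a ≠ 0 ∨ b ≠ 0) : IsClassical n β (member β n d e a b) :=
  have h := H.isSeed_comb hβ hab
  ⟨_, h.diff, h.nontrivial, h.ode, rfl⟩

/-- The backgrounds `B 0, B 1, B 2, B 3`. -/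
def background (β : ℂ) (d e : ℂ → ℂ) : Fin 4 → ℂ → ℂ :=
  ![member β n d e 0 1, member β n d e 1 (-stokesB β),
    member β n d e (stokesQ β) (exp (I * Real.pi * β)), member β n d e 1 0]

lemma IsBasis.areBackgrounds (hβ : ∀ m : ℤ, β / 2 ≠ m) (H : IsBasis β d d' e e') :
    AreBackgrounds n β (background n β d e) := by
  have nh := Gamma_one_sub_half_ne_zero hβ
  have ng := Gamma_half_ne_zero hβ
  have h0 : ExpAsymp (β / 2) (fun x => 0 * d x + 1 * e x) (fun x => 0 * d' x + 1 * e' x)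
      (Gamma (1 - β / 2)) 0 (3 * Real.pi / 4) := by
    simpa only [zero_mul, zero_add, one_mul] using H.exp_zero
  have h3 : AlgAsymp (β / 2) (fun x => 1 * d x + 0 * e x) (fun x => 1 * d' x + 0 * e' x)
      (exp (I * Real.pi * β) * Gamma (β / 2)) (3 * Real.pi / 2) (3 * Real.pi / 4) := by
    simpa only [zero_mul, add_zero, one_mul] using H.alg_pos
  refine ⟨fun k => ?_, ?_, ?_, ?_, ?_⟩
  · fin_cases k
    · exact H.isSolution_member n hβ (by simp)
    · exact H.isSolution_member n hβ (by simp)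
    · exact H.isSolution_member n hβ (by simp)
    · exact H.isSolution_member n hβ (by simp)
  · exact h0.algebraic hβ (H.isWeber_comb _ _) (H.isSeed_comb hβ (by simp)) nh n
  · exact H.alg_half.algebraic hβ (H.isWeber_comb _ _) (H.isSeed_comb hβ (by simp)) ng n
  · exact H.exp_pi.algebraic hβ (H.isWeber_comb _ _) (H.isSeed_comb hβ (by simp)) nh n
  · exact h3.algebraic hβ (H.isWeber_comb _ _) (H.isSeed_comb hβ (by simp))
      (mul_ne_zero (Complex.exp_ne_zero _) ng) n

end

end P4

end

theorem theorem1 (n : ℕ) (β : ℂ) (hβ : ∀ m : ℤ, β / 2 ≠ m) :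
    ∃ (y : OnePoint ℂ → ℂ → ℂ) (B : Fin 4 → ℂ → ℂ),
      P4.AreBackgrounds n β B ∧
      (∀ c : OnePoint ℂ, P4.IsSolution (1 / 2 + n) β (y c) ∧ P4.IsClassical n β (y c)) ∧
      -- finite values of the parameter
      (∀ c : ℂ,
        -- i)
        P4.Perturbed (y c) (B 3) (B 1) (P4.mu1 n β c) (P4.EMinus n β) 0 ∧
        -- ii)
        (c + P4.iSqrtPi ≠ 0 →
          P4.Perturbed (y c) (B 0) (B 2)
            (P4.mu2 n β (P4.iSqrtPi / ((c + P4.iSqrtPi) * (Complex.exp (Complex.I * Real.pi * β) - 1))))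
            (P4.EPlus n β) (Real.pi / 2)) ∧
        (c + P4.iSqrtPi = 0 →
          P4.Algebraic (y c) (P4.decaying β) (Real.pi / 2) (Real.pi / 4)) ∧
        -- iii)
        (c * (1 - Complex.exp (-(Complex.I * Real.pi * β))) + P4.iSqrtPi ≠ 0 →
          P4.Perturbed (y c) (B 1) (B 3)
            (P4.mu3 n β ((c + P4.iSqrtPi) /
              (c * (1 - Complex.exp (-(Complex.I * Real.pi * β))) + P4.iSqrtPi)))
            (P4.EMinus n β) Real.pi) ∧
        (c * (1 - Complex.exp (-(Complex.I * Real.pi * β))) + P4.iSqrtPi = 0 →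
          P4.Algebraic (y c) P4.growing Real.pi (Real.pi / 4)) ∧
        -- iv)
        (c ≠ 0 →
          P4.Perturbed (y c) (B 2) (B 0)
            (P4.mu4 n β (P4.iSqrtPi / (c * (1 - Complex.exp (-(Complex.I * Real.pi * β))))))
            (P4.EPlus n β) (3 * Real.pi / 2)) ∧
        (c = 0 →
          P4.Algebraic (y c) (P4.decaying β) (3 * Real.pi / 2) (Real.pi / 4))) ∧
      -- the value `c = ∞`, with the limits of the multipliers
      (P4.Algebraic (y OnePoint.infty) P4.growing 0 (Real.pi / 4) ∧
        P4.Perturbed (y OnePoint.infty) (B 0) (B 2) (P4.mu2 n β 0) (P4.EPlus n β) (Real.pi / 2) ∧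
        P4.Perturbed (y OnePoint.infty) (B 1) (B 3)
          (P4.mu3 n β (1 / (1 - Complex.exp (-(Complex.I * Real.pi * β)))))
          (P4.EMinus n β) Real.pi ∧
        P4.Perturbed (y OnePoint.infty) (B 2) (B 0) (P4.mu4 n β 0) (P4.EPlus n β)
          (3 * Real.pi / 2)) := by
  obtain ⟨d, d', e, e', H⟩ := P4.exists_isBasis hβ
  have ng := P4.Gamma_half_ne_zero hβ
  have nh := P4.Gamma_one_sub_half_ne_zero hβ
  have nS := P4.two_cpow_ne_zero (β / 2)
  have nB := P4.stokesB_ne_zero hβ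
  have nQ := P4.stokesQ_ne_zero hβ
  have nX := Complex.exp_ne_zero (I * Real.pi * β / 2)
  have nX1 := P4.exp_sub_one_ne_zero hβ
  have hQB := P4.stokesQ_mul_stokesB hβ
  have nP : P4.iSqrtPi ≠ 0 := mul_ne_zero I_ne_zero P4.sqrt_pi_ne_zero
  have hB : P4.stokesB β * Gamma (1 - β / 2) = P4.iSqrtPi * 2 ^ (β / 2) := div_mul_cancel₀ _ nh
  have hpi := Real.pi_pos
  have hk : ∀ c : ℂ, c * (2 ^ (β / 2) / Gamma (1 - β / 2)) * Gamma (1 - β / 2) =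
    c * 2 ^ (β / 2) := fun c => by rw [mul_assoc, div_mul_cancel₀ _ nh]
  -- The scale of `b` makes `b = -B` correspond to `c = -i√π`; the value `c = ∞` is the solution `e`
  -- alone.
  refine ⟨fun c => c.elim (P4.member β n d e 0 1)
      fun c => P4.member β n d e 1 (c * (2 ^ (β / 2) / Gamma (1 - β / 2))),
    P4.background n β d e, H.areBackgrounds n hβ, fun c => ?_, fun c => ?_, ?_⟩
  · induction c using OnePoint.rec with
    | infty => exact ⟨H.isSolution_member n hβ (by simp), H.isClassical_member n hβ (by simp)⟩
    | coe c => exact ⟨H.isSolution_member n hβ (by simp), H.isClassical_member n hβ (by simp)⟩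
  · specialize hk c
    simp only [OnePoint.elim_some]
    set b := c * (2 ^ (β / 2) / Gamma (1 - β / 2))
    have hw := H.isWeber_comb 1 b
    have hs := H.isSeed_comb hβ (a := 1) (b := b) (by simp)
    have hD : (b + 1 * P4.stokesB β) * Gamma (1 - β / 2) = (c + P4.iSqrtPi) * 2 ^ (β / 2) := by
      linear_combination hk + hB
    refine ⟨H.perturbed_zero hβ hk, fun hc => ?_, fun hc => ?_, fun hc => ?_, fun hc => ?_,
      fun hc => ?_, fun hc => ?_⟩
    · refine H.perturbed_half hβ (left_ne_zero_of_mul (hD ▸ mul_ne_zero hc nS)) ?_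
      rw [hD, P4.exp_I_pi_mul]
      field_simp
    -- The seed is now `d - Be` itself, the algebraic solution about `π/2`.
    · have h0 : b = -P4.stokesB β := mul_right_cancel₀ nh (by
        linear_combination hk + hB + 2 ^ (β / 2) * hc)
      rw [h0] at hw hs ⊢
      exact P4.AlgAsymp.algebraic hβ hw hs (H.alg_half.mono
        (by rw [sub_self, abs_zero]; linarith)) ng n
    · rw [Complex.exp_neg, P4.exp_I_pi_mul] at hc ⊢
      have h1 : ((b + 1 * P4.stokesB β) * exp (I * Real.pi * β / 2) ^ 2 - b) * Gamma (1 - β / 2) =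
          2 ^ (β / 2) * exp (I * Real.pi * β / 2) ^ 2 *
            (c * (1 - (exp (I * Real.pi * β / 2) ^ 2)⁻¹) + P4.iSqrtPi) := by
        linear_combination exp (I * Real.pi * β / 2) ^ 2 * hD - hk +
          c * 2 ^ (β / 2) * mul_inv_cancel₀ (pow_ne_zero 2 nX)
      refine H.perturbed_pi hβ (left_ne_zero_of_mul (h1 ▸ mul_ne_zero
        (mul_ne_zero nS (pow_ne_zero 2 nX)) hc)) (mul_right_cancel₀ nh ?_)
      rw [mul_assoc, h1, div_mul_eq_mul_div, div_eq_iff hc]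
      linear_combination -(exp (I * Real.pi * β / 2) ^ 2 *
        (c * (1 - (exp (I * Real.pi * β / 2) ^ 2)⁻¹) + P4.iSqrtPi)) * hD
    -- Multiplied by `QB = 1 - e^{iπβ}`, the condition on `c` says that `d + b e` is a multiple of
    -- the exponential solution about `π`.
    · rw [Complex.exp_neg, P4.exp_I_pi_mul] at hc
      field_simp at hc
      have h1 : b * P4.stokesQ β = 1 * exp (I * Real.pi * β) := by
        rw [P4.exp_I_pi_mul]
        refine mul_right_cancel₀ (mul_ne_zero nB nh) ?_
        linear_combination b * Gamma (1 - β / 2) * hQB +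
          (1 - exp (I * Real.pi * β / 2) ^ 2) * hk - exp (I * Real.pi * β / 2) ^ 2 * hB -
          2 ^ (β / 2) * hc
      exact (H.exp_comb_pi nQ h1).algebraic hβ hw hs (mul_ne_zero (div_ne_zero one_ne_zero nQ) nh) n
    · have hb : b ≠ 0 := left_ne_zero_of_mul (hk ▸ mul_ne_zero hc nS)
      refine H.perturbed_three_half hβ hb ?_
      rw [hk, Complex.exp_neg, P4.exp_I_pi_mul]
      field_simp
    · have h0 : b = 0 := mul_right_cancel₀ nh (by linear_combination hk + 2 ^ (β / 2) * hc)
      rw [h0] at hw hs ⊢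
      refine P4.AlgAsymp.algebraic hβ hw hs (K := exp (I * Real.pi * β) * Gamma (β / 2)) ?_
        (mul_ne_zero (Complex.exp_ne_zero _) ng) n
      simpa only [zero_mul, add_zero, one_mul] using
        H.alg_pos.mono (by rw [sub_self, abs_zero]; linarith)
  -- With `a = 0` and `b = 1`, the relations for `κ` give `0` on the imaginary rays and
  -- `e^{iπβ}/(e^{iπβ}-1)` on the negative ray.
  · simp only [OnePoint.elim_infty]
    refine ⟨?_, H.perturbed_half hβ (by simp) (by simp), H.perturbed_pi hβ (by simpa) ?_,
      H.perturbed_three_half hβ one_ne_zero (by simp)⟩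
    · refine P4.ExpAsymp.algebraic hβ (H.isWeber_comb 0 1) (H.isSeed_comb hβ (by simp))
        (K := Gamma (1 - β / 2)) ?_ nh n
      have h0 : P4.ExpAsymp (β / 2) e e' (Gamma (1 - β / 2)) 0 (Real.pi / 4) :=
        P4.AlgAsymp.mono H.exp_zero (by rw [sub_self, abs_zero]; linarith)
      simpa only [zero_mul, zero_add, one_mul] using h0
    · rw [Complex.exp_neg, P4.exp_I_pi_mul]
      field_simp
      ring
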